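/- In the $s$-bounded General Profit Scheduling Problem ($s$-GPSP) one is given an integer $s\ge 0$ and $n$ jobs; job $j$ has a release date $r_j\ge 0$, a processing time $p_j\ge 0$ and a profit function $f_j$ that is non-increasing on times $t\ge 0$. Times and profits are elements of an ordered abelian group, such as $\mathbb Z$, $\mathbb Q$ or $\mathbb R$. A feasible non-preemptive schedule consists of a set $\bar J$ of at most $s$ jobs and start times $S_j\ge r_j$ for $j\in\bar J$ such that, with $C_j=S_j+p_j$, any two distinct jobs $i,j\in\bar J$ satisfy $C_i\le S_j$ or $C_j\le S_i$ (single machine). It is optimal if it maximizes $\sum_{j\in\bar J}f_j(C_j)$ among all feasible schedules. Let $\overline p$ be the number of distinct processing times of the instance. The machine model is the unit-cost random access machine with two kinds of memory cells: index cells hold natural numbers, which can be added, subtracted (truncated at $0$), compared and used as addresses; number cells hold times and profits, which can be added, subtracted and compared. The functions $f_j$ are given by an oracle, and a query $(j,t)\mapsto f_j(t)$ takes one time unit. The input consists of $n$, $s$, $(r_j)_j$ and $(p_j)_j$; the output consists of the set $\bar J$ and the start times. Theorem. There is a deterministic algorithm (one fixed program of this machine model) that, given an instance of $s$-GPSP with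 $n$ jobs and $\overline p$ distinct processing times, computes an optimal non-preemptive schedule in time $2^{O(s)}\cdot(s+1)^{2\overline p}\cdot n^2\log n$. That is, there is a constant $C$, independent of the instance, of $n$, $s$ and $\overline p$, and of the ordered group, such that on every instance the program halts with an optimal non-preemptive schedule after at most $C\cdot 2^{Cs}\cdot(s+1)^{2\overline p}\cdot N^2\log N$ time units, where $N=\max\{n,2\}$. -/

import Mathlib

namespace GPSP

/-! ### The problem

Times and profits are taken from an ordered abelian group `K`, such as the integers, the rationals
or the reals. -/

/-- A job set with `n` jobs: release dates, processing times, and for each job a non-increasing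
profit function of its completion time. -/
structure JobSet (K : Type*) [AddCommGroup K] [LinearOrder K] (n : ℕ) where
  release : Fin n → K
  proc : Fin n → K
  profit : Fin n → K → K
  release_nonneg : ∀ j, 0 ≤ release j
  proc_nonneg : ∀ j, 0 ≤ proc j
  profit_antitone : ∀ j, AntitoneOn (profit j) (Set.Ici 0)

/-- A non-preemptive schedule: the set of scheduled jobs, and their start times (the values of
`start` on jobs that are not selected are irrelevant). -/
structure Schedule (K : Type*) (n : ℕ) where
  selected : Finset (Fin n)
  start : Fin n → K

namespace JobSet

variable {K : Type*} [AddCommGroup K] [LinearOrder K] {n : ℕ}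

/-- The number of distinct processing times. -/
def numProc (I : JobSet K n) : ℕ := (Finset.univ.image I.proc).card

/-- The completion time of job `j`. -/
def completion (I : JobSet K n) (S : Schedule K n) (j : Fin n) : K := S.start j + I.proc j

/-- At most `s` jobs are scheduled, none before its release date, and each one is processed without
interruption on a single machine that handles one job at a time. -/
structure IsFeasible (I : JobSet K n) (s : ℕ) (S : Schedule K n) : Prop where
  card_le : S.selected.card ≤ s
  release_le : ∀ j ∈ S.selected, I.release j ≤ S.start j
  disjoint : ∀ i ∈ S.selected, ∀ j ∈ S.selected, i ≠ j →
    I.completion S i ≤ S.start j ∨ I.completion S j ≤ S.start i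

/-- The total profit of the scheduled jobs. -/
def totalProfit (I : JobSet K n) (S : Schedule K n) : K :=
  ∑ j ∈ S.selected, I.profit j (I.completion S j)

/-- Feasible, and of maximum total profit among all feasible schedules. -/
def IsOptimal (I : JobSet K n) (s : ℕ) (S : Schedule K n) : Prop :=
  I.IsFeasible s S ∧ ∀ S' : Schedule K n, I.IsFeasible s S' → I.totalProfit S' ≤ I.totalProfit S

end JobSet

/-! ### The machine

A random access machine in structured form.  It has finitely many memory banks (those mentioned in
the program) of two kinds: index banks hold natural numbers, which can be added, subtracted,
compared, and used as addresses; number banks hold elements of `K`, which can be added, subtracted,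
compared, and passed to the profit oracle.  There is no multiplication and no conversion between
the two kinds.  A program is a finite object that mentions neither `K` nor the instance.  Every
elementary operation, memory access, test and oracle query takes one time unit. -/

/-- Index expressions; `cell b a` reads index bank `b` at address `a`. -/
inductive IExp : Type
  | lit (k : ℕ)
  | cell (b : ℕ) (a : IExp)
  | add (x y : IExp)
  | sub (x y : IExp)

/-- Number expressions; `cell b a` reads number bank `b` at address `a`, and `query j t` asks the
oracle for the profit of job `j` when completed at time `t`. -/
inductive VExp : Type
  | zero
  | cell (b : ℕ) (a : IExp)
  | add (x y : VExp)
  | sub (x y : VExp)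
  | query (j : IExp) (t : VExp)

/-- Tests. -/
inductive BExp : Type
  | ile (x y : IExp)
  | vle (x y : VExp)
  | neg (b : BExp)
  | conj (b c : BExp)

/-- Programs; `iset b a x` and `vset b a x` write the value of `x` to address `a` of the index,
respectively number, bank `b`. -/
inductive Prog : Type
  | skip
  | iset (b : ℕ) (a : IExp) (x : IExp)
  | vset (b : ℕ) (a : IExp) (x : VExp)
  | seq (P Q : Prog)
  | cond (b : BExp) (P Q : Prog)
  | loop (b : BExp) (P : Prog)

/-- Memory contents: `imem b a` and `vmem b a` are the contents of address `a` of bank `b`. -/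
structure State (K : Type*) where
  imem : ℕ → ℕ → ℕ
  vmem : ℕ → ℕ → K

/-- Write to an index bank. -/
def State.setI {K : Type*} (σ : State K) (b a x : ℕ) : State K :=
  { σ with imem := Function.update σ.imem b (Function.update (σ.imem b) a x) }

/-- Write to a number bank. -/
def State.setV {K : Type*} (σ : State K) (b a : ℕ) (x : K) : State K :=
  { σ with vmem := Function.update σ.vmem b (Function.update (σ.vmem b) a x) }

/-- The value of an index expression (subtraction is truncated at `0`). -/
def IExp.eval {K : Type*} (σ : State K) : IExp → ℕ
  | .lit k => k
  | .cell b a => σ.imem b (a.eval σ)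
  | .add x y => x.eval σ + y.eval σ
  | .sub x y => x.eval σ - y.eval σ

/-- The time needed to evaluate an index expression. -/
def IExp.cost : IExp → ℕ
  | .lit _ => 1
  | .cell _ a => 1 + a.cost
  | .add x y => 1 + x.cost + y.cost
  | .sub x y => 1 + x.cost + y.cost

/-- The value of a number expression, where `f` is the oracle. -/
def VExp.eval {K : Type*} [AddCommGroup K] (f : ℕ → K → K) (σ : State K) : VExp → K
  | .zero => 0
  | .cell b a => σ.vmem b (a.eval σ)
  | .add x y => x.eval f σ + y.eval f σ
  | .sub x y => x.eval f σ - y.eval f σ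
  | .query j t => f (j.eval σ) (t.eval f σ)

/-- The time needed to evaluate a number expression. -/
def VExp.cost : VExp → ℕ
  | .zero => 1
  | .cell _ a => 1 + a.cost
  | .add x y => 1 + x.cost + y.cost
  | .sub x y => 1 + x.cost + y.cost
  | .query j t => 1 + j.cost + t.cost

/-- The outcome of a test. -/
def BExp.eval {K : Type*} [AddCommGroup K] [LinearOrder K] (f : ℕ → K → K) (σ : State K) :
    BExp → Bool
  | .ile x y => decide (x.eval σ ≤ y.eval σ)
  | .vle x y => decide (x.eval f σ ≤ y.eval f σ)
  | .neg b => !(b.eval f σ)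
  | .conj b c => b.eval f σ && c.eval f σ

/-- The time needed for a test. -/
def BExp.cost : BExp → ℕ
  | .ile x y => 1 + x.cost + y.cost
  | .vle x y => 1 + x.cost + y.cost
  | .neg b => 1 + b.cost
  | .conj b c => 1 + b.cost + c.cost

/-- `Exec f P σ t σ'`: with oracle `f`, the program `P` started with memory `σ` halts after exactly
`t` time units with memory `σ'`. -/
inductive Exec {K : Type*} [AddCommGroup K] [LinearOrder K] (f : ℕ → K → K) :
    Prog → State K → ℕ → State K → Prop
  | skip (σ : State K) : Exec f .skip σ 1 σ
  | iset (b : ℕ) (a x : IExp) (σ : State K) :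
      Exec f (.iset b a x) σ (1 + a.cost + x.cost) (σ.setI b (a.eval σ) (x.eval σ))
  | vset (b : ℕ) (a : IExp) (x : VExp) (σ : State K) :
      Exec f (.vset b a x) σ (1 + a.cost + x.cost) (σ.setV b (a.eval σ) (x.eval f σ))
  | seq {P Q : Prog} {σ₁ σ₂ σ₃ : State K} {t u : ℕ} :
      Exec f P σ₁ t σ₂ → Exec f Q σ₂ u σ₃ → Exec f (.seq P Q) σ₁ (t + u) σ₃
  | cond_true {b : BExp} {P Q : Prog} {σ σ' : State K} {t : ℕ} :
      b.eval f σ = true → Exec f P σ t σ' → Exec f (.cond b P Q) σ (1 + b.cost + t) σ'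
  | cond_false {b : BExp} {P Q : Prog} {σ σ' : State K} {t : ℕ} :
      b.eval f σ = false → Exec f Q σ t σ' → Exec f (.cond b P Q) σ (1 + b.cost + t) σ'
  | loop_true {b : BExp} {P : Prog} {σ₁ σ₂ σ₃ : State K} {t u : ℕ} :
      b.eval f σ₁ = true → Exec f P σ₁ t σ₂ → Exec f (.loop b P) σ₂ u σ₃ →
        Exec f (.loop b P) σ₁ (1 + b.cost + t + u) σ₃
  | loop_false {b : BExp} {P : Prog} {σ : State K} :
      b.eval f σ = false → Exec f (.loop b P) σ (1 + b.cost) σ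

/-- Programs are deterministic: running time and final memory are determined by the program, the
oracle and the initial memory. -/
theorem Exec.deterministic {K : Type*} [AddCommGroup K] [LinearOrder K] {f : ℕ → K → K}
    {P : Prog} {σ σ₁ σ₂ : State K} {t u : ℕ} (h : Exec f P σ t σ₁) (h' : Exec f P σ u σ₂) :
    t = u ∧ σ₁ = σ₂ := by
  induction h generalizing u σ₂ with
  | skip σ => cases h'; exact ⟨rfl, rfl⟩
  | iset b a x σ => cases h'; exact ⟨rfl, rfl⟩
  | vset b a x σ => cases h'; exact ⟨rfl, rfl⟩
  | seq _ _ ih₁ ih₂ =>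
    cases h' with
    | seq k₁ k₂ =>
      obtain ⟨rfl, rfl⟩ := ih₁ k₁
      obtain ⟨rfl, rfl⟩ := ih₂ k₂
      exact ⟨rfl, rfl⟩
  | cond_true hb _ ih =>
    cases h' with
    | cond_true _ k => obtain ⟨rfl, rfl⟩ := ih k; exact ⟨rfl, rfl⟩
    | cond_false hb' _ => simp [hb] at hb'
  | cond_false hb _ ih =>
    cases h' with
    | cond_true hb' _ => simp [hb] at hb'
    | cond_false _ k => obtain ⟨rfl, rfl⟩ := ih k; exact ⟨rfl, rfl⟩
  | loop_true hb _ _ ih₁ ih₂ =>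
    cases h' with
    | loop_true _ k₁ k₂ =>
      obtain ⟨rfl, rfl⟩ := ih₁ k₁
      obtain ⟨rfl, rfl⟩ := ih₂ k₂
      exact ⟨rfl, rfl⟩
    | loop_false hb' => simp [hb] at hb'
  | loop_false hb =>
    cases h' with
    | loop_true hb' _ _ => simp [hb] at hb'
    | loop_false _ => exact ⟨rfl, rfl⟩

/-! ### Input and output -/

/-- The profit functions as an oracle (jobs are numbered `0, …, n - 1`; queries for other numbers
return `0`). -/
def JobSet.oracle {K : Type*} [AddCommGroup K] [LinearOrder K] {n : ℕ} (I : JobSet K n) :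
    ℕ → K → K :=
  fun j t => if h : j < n then I.profit ⟨j, h⟩ t else 0

/-- The initial memory: `n` and `s` are stored at addresses `0` and `1` of index bank `0`, the
release dates and the processing times in the number banks `0` and `1`, and all other cells
are `0`. -/
def JobSet.input {K : Type*} [AddCommGroup K] [LinearOrder K] {n : ℕ} (I : JobSet K n) (s : ℕ) :
    State K where
  imem b a := if b = 0 then (if a = 0 then n else if a = 1 then s else 0) else 0
  vmem b a :=
    if h : a < n then
      (if b = 0 then I.release ⟨a, h⟩ else if b = 1 then I.proc ⟨a, h⟩ else 0)
    else 0

/-- The output read off the final memory: job `j` is scheduled if address `j` of index bank `1`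
is not `0`, and then its start time is at address `j` of number bank `2`. -/
def State.output {K : Type*} (σ : State K) (n : ℕ) : Schedule K n where
  selected := Finset.univ.filter fun j : Fin n => σ.imem 1 j ≠ 0
  start j := σ.vmem 2 j

end GPSP

/-!
The algorithm is a dynamic program over job sequences, and the sets of jobs used so far are handled
by representative families.

An optimal schedule is determined by a sequence of at most `s` distinct jobs, each started as early
as possible: processing a feasible schedule in this way in the order of its start times does not
delay any job (`JobSet.exists_seq`, `JobSet.isOptimal_of_starts`).  In such a sequence, every start
time is the release date of some job (or `0`) plus the total processing time of a multiset of at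
most `s` jobs, and such totals are counted by numbers with one digit in base `s + 1` for each
processing time.  So there are `(n + 1) * (s + 1) ^ numProc` states (`IsStateTable`), and starting
another job in a state leads to a state (`Reaches.succState`).

It remains to keep the jobs distinct.  For every `k ≤ s` and every state, the program stores a
family of sequences of `k` distinct jobs that start in this state, such that for every sequence `l`
of this kind and every set `B` of at most `s - k` jobs disjoint from `l` some member of the family
is disjoint from `B` as well and at least as profitable as `l` (`IsFamily`).  Sequences of `k + 1`
jobs are obtained by putting a job in front of a member of the family of the next state; to shrink
the collection of these candidates to a family of bounded size, let `p > n + s + 1` be a prime.  The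
set `Y` of the jobs of a candidate is the root set of a monic polynomial of degree `k + 1` over
`ZMod p`.  For a fixed `B`, the product of the values of this polynomial at the elements of `B` is
nonzero exactly if `B` and `Y` are disjoint.  By Lagrange interpolation each value is a linear
combination of the values at `0, …, k + 1`, so the product is a linear function of the monomials
of degree `#B` in these values.  All these monomials occur among the labels of the first
`2 * 2 ^ s + 1` nodes of a binary tree (`exists_functional`).  Hence every candidate has a vector
with `D = 2 * 2 ^ s + 1` coordinates, and every `B` a linear functional.

The program chooses candidates greedily: it adds a most profitable candidate whose vector is not
spanned by the vectors chosen before, until there is none.  At most `D` candidates are chosen, and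
whenever a functional does not vanish on a candidate, it does not vanish on a chosen candidate that
is at least as profitable (`GreedyInv.complete`, `FamilyInv.isFamily`).  Linear independence is
decided by elimination modulo `p`, with tables for arithmetic modulo `p`, as the machine has no
multiplication.  The running time is dominated by comparing, in each of `D + 1` rounds for each `k`
and each state, at most `n * D` candidates in time `O(D ^ 2)` each, that is
`2 ^ O(s) * (s + 1) ^ numProc * n ^ 2` (`run_schedulingProg`).

Programs are verified with a calculus of time-bounded total correctness (`Run`).  Its rule for loops
(`Run.forLoop`) provides for free that memory banks to which a program does not write keep their
contents (`Frame`).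
-/

namespace GPSP

/-! ### Time-bounded total correctness -/

section Framework

variable {K : Type*}

/-- Index banks that a program may write to. -/
def Prog.wI : Prog → ℕ → Bool
  | .skip, _ => false
  | .iset b _ _, c => c == b
  | .vset _ _ _, _ => false
  | .seq P Q, c => P.wI c || Q.wI c
  | .cond _ P Q, c => P.wI c || Q.wI c
  | .loop _ P, c => P.wI c

/-- Number banks that a program may write to. -/
def Prog.wV : Prog → ℕ → Bool
  | .skip, _ => false
  | .iset _ _ _, _ => false
  | .vset b _ _, c => c == b
  | .seq P Q, c => P.wV c || Q.wV c
  | .cond _ P Q, c => P.wV c || Q.wV c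
  | .loop _ P, c => P.wV c

/-- The two memories agree on all banks that `P` does not write to. -/
structure Frame (P : Prog) (σ σ' : State K) : Prop where
  i : ∀ b, P.wI b = false → σ'.imem b = σ.imem b
  v : ∀ b, P.wV b = false → σ'.vmem b = σ.vmem b

theorem Frame.rfl {P : Prog} {σ : State K} : Frame P σ σ :=
  ⟨fun _ _ => Eq.refl _, fun _ _ => Eq.refl _⟩

theorem Frame.trans {P : Prog} {σ σ' σ'' : State K} (h : Frame P σ σ') (h' : Frame P σ' σ'') :
    Frame P σ σ'' :=
  ⟨fun b hb => (h'.i b hb).trans (h.i b hb), fun b hb => (h'.v b hb).trans (h.v b hb)⟩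

theorem Frame.mono {P Q : Prog} {σ σ' : State K} (h : Frame P σ σ')
    (hI : ∀ b, Q.wI b = false → P.wI b = false) (hV : ∀ b, Q.wV b = false → P.wV b = false) :
    Frame Q σ σ' :=
  ⟨fun b hb => h.i b (hI b hb), fun b hb => h.v b (hV b hb)⟩

theorem imem_setI_same (σ : State K) (b a x : ℕ) :
    (σ.setI b a x).imem b = Function.update (σ.imem b) a x := by
  simp [State.setI]

theorem imem_setI_ne (σ : State K) {b b' : ℕ} (a x : ℕ) (h : b' ≠ b) :
    (σ.setI b a x).imem b' = σ.imem b' := by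
  simp [State.setI, h]

theorem vmem_setI (σ : State K) (b a x : ℕ) : (σ.setI b a x).vmem = σ.vmem := rfl

theorem vmem_setV_same (σ : State K) (b a : ℕ) (x : K) :
    (σ.setV b a x).vmem b = Function.update (σ.vmem b) a x := by
  simp [State.setV]

theorem vmem_setV_ne (σ : State K) {b b' : ℕ} (a : ℕ) (x : K) (h : b' ≠ b) :
    (σ.setV b a x).vmem b' = σ.vmem b' := by
  simp [State.setV, h]

theorem imem_setV (σ : State K) (b a : ℕ) (x : K) : (σ.setV b a x).imem = σ.imem := rfl

theorem imem_ite (c : Prop) [Decidable c] (σ σ' : State K) (b : ℕ) :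
    (if c then σ else σ').imem b = if c then σ.imem b else σ'.imem b := by split_ifs <;> rfl

theorem vmem_ite (c : Prop) [Decidable c] (σ σ' : State K) (b : ℕ) :
    (if c then σ else σ').vmem b = if c then σ.vmem b else σ'.vmem b := by split_ifs <;> rfl

variable [AddCommGroup K] [LinearOrder K] {f : ℕ → K → K}

theorem Exec.frame {P : Prog} {σ σ' : State K} {t : ℕ} (h : Exec f P σ t σ') : Frame P σ σ' := by
  induction h with
  | skip σ => exact Frame.rfl
  | iset b a x σ =>
    refine ⟨fun c hc => imem_setI_ne _ _ _ ?_, fun c _ => by rw [vmem_setI]⟩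
    simpa [Prog.wI] using hc
  | vset b a x σ =>
    refine ⟨fun c _ => by rw [imem_setV], fun c hc => vmem_setV_ne _ _ _ ?_⟩
    simpa [Prog.wV] using hc
  | seq _ _ h₁ h₂ =>
    exact (h₁.mono (by simp +contextual [Prog.wI]) (by simp +contextual [Prog.wV])).trans
      (h₂.mono (by simp +contextual [Prog.wI]) (by simp +contextual [Prog.wV]))
  | cond_true _ _ h₁ =>
    exact h₁.mono (by simp +contextual [Prog.wI]) (by simp +contextual [Prog.wV])
  | cond_false _ _ h₁ =>
    exact h₁.mono (by simp +contextual [Prog.wI]) (by simp +contextual [Prog.wV])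
  | loop_true _ _ _ h₁ h₂ =>
    exact (h₁.mono (by simp +contextual [Prog.wI]) (by simp +contextual [Prog.wV])).trans h₂
  | loop_false _ => exact Frame.rfl

/-- Started in `σ`, the program `P` halts within time `T` in a memory that satisfies `Q`. -/
def Run (f : ℕ → K → K) (P : Prog) (σ : State K) (T : ℕ) (Q : State K → Prop) : Prop :=
  ∃ t σ', Exec f P σ t σ' ∧ t ≤ T ∧ Q σ'

theorem Run.mono {P : Prog} {σ : State K} {T T' : ℕ} {Q Q' : State K → Prop} (h : Run f P σ T Q)
    (hT : T ≤ T') (hQ : ∀ σ', Frame P σ σ' → Q σ' → Q' σ') : Run f P σ T' Q' := by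
  obtain ⟨t, σ', he, ht, hq⟩ := h
  exact ⟨t, σ', he, ht.trans hT, hQ σ' he.frame hq⟩

theorem Run.le {P : Prog} {σ : State K} {T T' : ℕ} {Q : State K → Prop} (h : Run f P σ T Q)
    (hT : T ≤ T') : Run f P σ T' Q := h.mono hT fun _ _ h => h

theorem Run.with_frame {P : Prog} {σ : State K} {T : ℕ} {Q : State K → Prop} (h : Run f P σ T Q) :
    Run f P σ T fun σ' => Frame P σ σ' ∧ Q σ' := h.mono le_rfl fun _ hF h => ⟨hF, h⟩

theorem Run.post {P : Prog} {σ : State K} {T : ℕ} {Q Q' : State K → Prop} (h : Run f P σ T Q)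
    (hQ : ∀ σ', Frame P σ σ' → Q σ' → Q' σ') : Run f P σ T Q' := h.mono le_rfl hQ

theorem Run.seq {P Q : Prog} {σ : State K} {T U : ℕ} {R : State K → Prop}
    (h : Run f P σ T fun σ₁ => Run f Q σ₁ U R) : Run f (.seq P Q) σ (T + U) R := by
  obtain ⟨t, σ₁, he, ht, u, σ₂, he', hu, hr⟩ := h
  exact ⟨t + u, σ₂, .seq he he', by omega, hr⟩

theorem Run.cond {b : BExp} {P Q : Prog} {σ : State K} {T : ℕ} {R : State K → Prop}
    (h₁ : b.eval f σ = true → Run f P σ T R) (h₂ : b.eval f σ = false → Run f Q σ T R) :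
    Run f (.cond b P Q) σ (1 + b.cost + T) R := by
  cases hb : b.eval f σ with
  | true =>
    obtain ⟨t, σ₁, he, ht, hr⟩ := h₁ hb
    exact ⟨_, σ₁, .cond_true hb he, by omega, hr⟩
  | false =>
    obtain ⟨t, σ₁, he, ht, hr⟩ := h₂ hb
    exact ⟨_, σ₁, .cond_false hb he, by omega, hr⟩

/-- The program contains no loop. -/
def Prog.loopFree : Prog → Bool
  | .seq P Q => P.loopFree && Q.loopFree
  | .cond _ P Q => P.loopFree && Q.loopFree
  | .loop _ _ => false
  | _ => true

/-- The effect of a loop-free program (loops are skipped). -/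
def Prog.sem (f : ℕ → K → K) : Prog → State K → State K
  | .skip, σ => σ
  | .iset b a x, σ => σ.setI b (a.eval σ) (x.eval σ)
  | .vset b a x, σ => σ.setV b (a.eval σ) (x.eval f σ)
  | .seq P Q, σ => Q.sem f (P.sem f σ)
  | .cond b P Q, σ => if b.eval f σ then P.sem f σ else Q.sem f σ
  | .loop _ _, σ => σ

/-- An upper bound for the running time of a loop-free program. -/
def Prog.time : Prog → ℕ
  | .skip => 1
  | .iset _ a x => 1 + a.cost + x.cost
  | .vset _ a x => 1 + a.cost + x.cost
  | .seq P Q => P.time + Q.time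
  | .cond b P Q => 1 + b.cost + (P.time + Q.time)
  | .loop _ _ => 0

theorem Run.straight {P : Prog} {σ : State K} {R : State K → Prop} (hP : P.loopFree = true)
    (hR : R (P.sem f σ)) : Run f P σ P.time R := by
  suffices h : ∀ (P : Prog) (σ : State K), P.loopFree = true →
      ∃ t, Exec f P σ t (P.sem f σ) ∧ t ≤ P.time by
    obtain ⟨t, he, ht⟩ := h P σ hP
    exact ⟨t, _, he, ht, hR⟩
  clear hR hP
  intro P
  induction P with
  | skip => exact fun σ _ => ⟨_, .skip σ, le_rfl⟩
  | iset b a x => exact fun σ _ => ⟨_, .iset b a x σ, le_rfl⟩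
  | vset b a x => exact fun σ _ => ⟨_, .vset b a x σ, le_rfl⟩
  | seq P Q hP hQ =>
    intro σ h
    simp only [Prog.loopFree, Bool.and_eq_true] at h
    obtain ⟨t, he, ht⟩ := hP σ h.1
    obtain ⟨u, he', hu⟩ := hQ (P.sem f σ) h.2
    exact ⟨t + u, .seq he he', by simp only [Prog.time]; omega⟩
  | cond b P Q hP hQ =>
    intro σ h
    simp only [Prog.loopFree, Bool.and_eq_true] at h
    obtain ⟨t, he, ht⟩ := hP σ h.1
    obtain ⟨u, he', hu⟩ := hQ σ h.2
    cases hb : b.eval f σ with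
    | true =>
      refine ⟨1 + b.cost + t, ?_, by simp only [Prog.time]; omega⟩
      simpa only [Prog.sem, hb, if_true] using Exec.cond_true hb he
    | false =>
      refine ⟨1 + b.cost + u, ?_, by simp only [Prog.time]; omega⟩
      simpa only [Prog.sem, hb, Bool.false_eq_true, if_false] using Exec.cond_false hb he'
  | loop b P => intro σ h; simp [Prog.loopFree] at h

/-- The rule for sequential composition; `σ₁` is the memory between `P` and `Q`. -/
theorem Run.bind {P Q : Prog} {σ : State K} {T U V : ℕ} {R : State K → Prop} (A : State K → Prop)
    (h₁ : Run f P σ T A) (h₂ : ∀ σ₁, Frame P σ σ₁ → A σ₁ → Run f Q σ₁ U R) (hV : T + U ≤ V) :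
    Run f (.seq P Q) σ V R :=
  (Run.seq (h₁.post h₂)).le hV

/-- Loop-free programs are evaluated. -/
theorem Run.block {P : Prog} {σ : State K} {T : ℕ} {R : State K → Prop} (hR : R (P.sem f σ))
    (hP : P.loopFree = true ∧ P.time ≤ T := by decide) : Run f P σ T R :=
  (Run.straight hP.1 hR).le hP.2

/-- The content of address `0` of an index bank; such banks serve as variables. -/
abbrev var (b : ℕ) : IExp := .cell b (.lit 0)

/-- `forLoop v N P` runs `P` for the values `0, …, N - 1` of the variable `v`. -/
def forLoop (v : ℕ) (N : IExp) (P : Prog) : Prog :=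
  .seq (.iset v (.lit 0) (.lit 0))
    (.loop (.neg (.ile N (var v))) (.seq P (.iset v (.lit 0) (.add (var v) (.lit 1)))))

/-- The invariant rule for `forLoop`.  Whatever the loop does not write to may be used in the proof
of the body, without being mentioned in the invariant. -/
theorem Run.forLoop {v : ℕ} {B : IExp} {P : Prog} {σ : State K} {T N : ℕ}
    (Inv : ℕ → State K → Prop) (hv : P.wI v = false)
    (hN : ∀ σ', Frame (GPSP.forLoop v B P) σ σ' → B.eval σ' = N)
    (h0 : Inv 0 (σ.setI v 0 0))
    (hs : ∀ i σ', i < N → σ'.imem v 0 = i → Frame (GPSP.forLoop v B P) σ σ' → Inv i σ' →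
      Run f P σ' T fun σ'' => Inv (i + 1) (σ''.setI v 0 (i + 1))) :
    Run f (GPSP.forLoop v B P) σ ((N + 1) * (T + B.cost + 11)) (Inv N) := by
  have hw : (GPSP.forLoop v B P).wI v = true := by simp [GPSP.forLoop, Prog.wI]
  have hset : ∀ (τ : State K) (x : ℕ), Frame (GPSP.forLoop v B P) τ (τ.setI v 0 x) := by
    intro τ x
    refine ⟨fun b hb => imem_setI_ne _ _ _ ?_, fun b _ => by rw [vmem_setI]⟩
    rintro rfl
    simp [hw] at hb
  have key : ∀ d i τ, i + d = N → τ.imem v 0 = i → Frame (GPSP.forLoop v B P) σ τ → Inv i τ →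
      Run f (.loop (.neg (.ile B (var v))) (.seq P (.iset v (.lit 0) (.add (var v) (.lit 1))))) τ
        (d * (T + B.cost + 11) + (B.cost + 5)) (Inv N) := by
    intro d
    induction d with
    | zero =>
      intro i τ hi hτ hF hI
      obtain rfl : i = N := by omega
      refine ⟨_, τ, .loop_false ?_, ?_, hI⟩
      · simp [BExp.eval, IExp.eval, hN τ hF, hτ]
      · simp [BExp.cost, IExp.cost]; omega
    | succ d ih =>
      intro i τ hi hτ hF hI
      obtain ⟨t, τ', he, ht, hI'⟩ := hs i τ (by omega) hτ hF hI
      have hF' : Frame (GPSP.forLoop v B P) τ τ' :=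
        he.frame.mono (by simp +contextual [GPSP.forLoop, Prog.wI])
          (by simp +contextual [GPSP.forLoop, Prog.wV])
      have hv' : τ'.imem v 0 = i := by rw [he.frame.i v hv, hτ]
      obtain ⟨u, τ'', he', hu, hq⟩ := ih (i + 1) (τ'.setI v 0 (i + 1)) (by omega)
        (by simp [imem_setI_same]) ((hF.trans hF').trans (hset _ _)) hI'
      have hinc : Exec f (.iset v (.lit 0) (.add (var v) (.lit 1))) τ' 6
          (τ'.setI v 0 (i + 1)) := by
        simpa [IExp.eval, IExp.cost, hv'] using
          Exec.iset (f := f) v (.lit 0) (.add (var v) (.lit 1)) τ'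
      refine ⟨_, τ'', .loop_true ?_ (.seq he hinc) he', ?_, hq⟩
      · simp [BExp.eval, IExp.eval, hN τ hF, hτ]; omega
      · simp only [BExp.cost, IExp.cost]; linarith
  obtain ⟨t, τ, he, ht, hq⟩ := key N 0 (σ.setI v 0 0) (by omega) (by simp [imem_setI_same])
    (hset _ _) h0
  exact ⟨_, τ, .seq (.iset v (.lit 0) (.lit 0) σ) he, by simp only [IExp.cost]; linarith, hq⟩

end Framework

infixr:65 " ;; " => Prog.seq

/-! ### Monomials on a binary tree -/

/-- Nodes of the infinite binary tree are numbered so that `h` has the children `2 * h + 1` and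
`2 * h + 2`; `zeros h` counts the steps to a left child on the way from the root `0` to `h`. -/
def zeros : ℕ → ℕ
  | 0 => 0
  | h + 1 => if h % 2 = 0 then zeros (h / 2) + 1 else zeros (h / 2)
decreasing_by all_goals omega

/-- The monomial at a node: on the way from the root, every step to a right child contributes the
variable whose index is the number of steps to a left child made before it. -/
def mon {R : Type*} [CommSemiring R] (v : ℕ → R) : ℕ → R
  | 0 => 1
  | h + 1 => if h % 2 = 0 then mon v (h / 2) else mon v (h / 2) * v (zeros (h / 2))
decreasing_by all_goals omega

theorem zeros_left (h : ℕ) : zeros (h + h + 1) = zeros h + 1 := by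
  rw [zeros, if_pos (by omega), show (h + h) / 2 = h by omega]

theorem zeros_right (h : ℕ) : zeros (h + h + 2) = zeros h := by
  rw [zeros, if_neg (by omega), show (h + h + 1) / 2 = h by omega]

theorem mon_zero {R : Type*} [CommSemiring R] (v : ℕ → R) : mon v 0 = 1 := by rw [mon]

theorem mon_left {R : Type*} [CommSemiring R] (v : ℕ → R) (h : ℕ) :
    mon v (h + h + 1) = mon v h := by
  rw [mon, if_pos (by omega), show (h + h) / 2 = h by omega]

theorem mon_right {R : Type*} [CommSemiring R] (v : ℕ → R) (h : ℕ) :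
    mon v (h + h + 2) = mon v h * v (zeros h) := by
  rw [mon, if_neg (by omega), show (h + h + 1) / 2 = h by omega]

theorem two_pow_zeros_le (h : ℕ) : 2 ^ zeros h ≤ h + 1 := by
  induction h using Nat.strong_induction_on with
  | _ h ih =>
    cases h with
    | zero => simp [zeros]
    | succ h =>
      have := ih (h / 2) (by omega)
      rw [zeros]
      split_ifs
      · rw [pow_succ]; omega
      · omega

theorem zeros_le_of_lt {h s : ℕ} (hh : h < 2 ^ s) : zeros h ≤ s := by
  have h1 := two_pow_zeros_le h
  exact (Nat.pow_le_pow_iff_right (by norm_num : 1 < 2)).1 (h1.trans hh)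

/-- Steps to left children increase `zeros` and keep the monomial. -/
theorem exists_left_descendant (h d e : ℕ) (hd : h + 1 < 2 ^ (d + 1)) :
    ∃ h', h' + 1 < 2 ^ (d + e + 1) ∧ zeros h' = zeros h + e ∧
      ∀ {R : Type} [CommSemiring R] (v : ℕ → R), mon v h' = mon v h := by
  induction e with
  | zero => exact ⟨h, hd, rfl, fun _ => rfl⟩
  | succ e ih =>
    obtain ⟨h', h1, h2, h3⟩ := ih
    refine ⟨h' + h' + 1, ?_, by rw [zeros_left, h2]; rfl, fun v => by rw [mon_left, h3]⟩
    rw [← add_assoc, pow_succ]; omega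

/-- Every monomial of degree `l.length` in the variables `0, …, k` occurs at depth at most
`l.length + k`: visit the variables in increasing order. -/
theorem exists_node_of_sorted (k : ℕ) (l : List ℕ) (hl : l.Pairwise (· ≤ ·)) (hk : ∀ i ∈ l, i ≤ k)
    (h d : ℕ) (hz : ∀ i ∈ l, zeros h ≤ i) (hzk : zeros h ≤ k) (hd : h + 1 < 2 ^ (d + 1)) :
    ∃ h', h' + 1 < 2 ^ (d + (k - zeros h) + l.length + 1) ∧
      ∀ {R : Type} [CommSemiring R] (v : ℕ → R), mon v h' = mon v h * (l.map v).prod := by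
  induction l generalizing h d with
  | nil =>
    exact ⟨h, hd.trans_le (Nat.pow_le_pow_right (by norm_num) (by simp)), fun v => by simp⟩
  | cons i l ih =>
    obtain ⟨h₁, h1, h2, h3⟩ := exists_left_descendant h d (i - zeros h) hd
    have hi := hz i (by simp)
    have hik := hk i (by simp)
    have hzi : zeros h + (i - zeros h) = i := Nat.add_sub_cancel' hi
    rw [List.pairwise_cons] at hl
    have hz' : zeros (h₁ + h₁ + 2) = i := by rw [zeros_right, h2, hzi]
    obtain ⟨h₂, h4, h5⟩ := ih hl.2 (fun j hj => hk j (by simp [hj])) (h₁ + h₁ + 2)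
      (d + (i - zeros h) + 1) (by rw [hz']; exact hl.1) (by rw [hz']; exact hik)
      (by rw [pow_succ]; omega)
    refine ⟨h₂, ?_, fun v => ?_⟩
    · rw [hz'] at h4
      convert h4 using 2
      simp only [List.length_cons]; omega
    · rw [h5, mon_right, h3, h2, hzi, List.map_cons, List.prod_cons, mul_assoc]

/-- Every monomial of degree at most `s - k` in the variables `0, …, k` occurs at depth at most `s`,
that is, among the first `2 * 2 ^ s + 1` nodes. -/
theorem exists_node {s k q : ℕ} (hs : k + q ≤ s) (g : Fin q → ℕ) (hg : ∀ b, g b ≤ k) :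
    ∃ h, h < 2 * 2 ^ s + 1 ∧
      ∀ {R : Type} [CommSemiring R] (v : ℕ → R), mon v h = ∏ b, v (g b) := by
  have hp := (List.ofFn g).perm_insertionSort (· ≤ ·)
  obtain ⟨h, h1, h2⟩ := exists_node_of_sorted k ((List.ofFn g).insertionSort (· ≤ ·))
    (List.pairwise_insertionSort _ _)
    (fun i hi => by
      rw [hp.mem_iff, List.mem_ofFn] at hi
      obtain ⟨b, rfl⟩ := hi
      exact hg b) 0 0 (by simp [zeros]) (by simp [zeros]) (by norm_num)
  refine ⟨h, ?_, fun v => ?_⟩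
  · have : 2 ^ (0 + (k - zeros 0) + ((List.ofFn g).insertionSort (· ≤ ·)).length + 1)
        ≤ 2 ^ (s + 1) :=
      Nat.pow_le_pow_right (by norm_num) (by simp [zeros]; omega)
    rw [pow_succ 2 s] at this
    omega
  · rw [h2, mon_zero, one_mul, (hp.map v).prod_eq, List.map_ofFn, List.prod_ofFn]
    rfl

/-- The values at `0, …, s` of the monic polynomial with roots `Y`. -/
def rootValues {F : Type} [Field F] (s : ℕ) (Y : List F) (t : ℕ) : F :=
  if t ≤ s then (Y.map fun y => (t : F) - y).prod else 0

/-- Lagrange interpolation: the value at `b` of a monic polynomial of degree `k` with given roots is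
a fixed linear combination of its values at `0, …, k`. -/
theorem exists_interpolation {F : Type} [Field F] {s k : ℕ}
    (hinj : Set.InjOn (fun t : ℕ => (t : F)) (Finset.range (s + 1))) (hk : k ≤ s) (b : F) :
    ∃ c : ℕ → F, ∀ Y : List F, Y.length = k →
      (Y.map fun y => b - y).prod = ∑ t ∈ Finset.range (k + 1), c t * rootValues s Y t := by
  classical
  refine ⟨fun t => (Lagrange.basis (Finset.range (k + 1)) (fun t : ℕ => (t : F)) t).eval b,
    fun Y hY => ?_⟩
  have hev : ∀ x : F, (Y.map fun y => x - y).prod =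
      ((Y.map fun y => Polynomial.X - Polynomial.C y).prod).eval x := by
    intro x
    rw [Polynomial.eval_list_prod, List.map_map]
    congr 1
    exact List.map_congr_left fun y _ => by simp
  have hdeg : ((Y.map fun y => Polynomial.X - Polynomial.C y).prod).degree
      < ((Finset.range (k + 1)).card : WithBot ℕ) := by
    have : ((Y.map fun y => Polynomial.X - Polynomial.C y).prod).degree = (k : WithBot ℕ) := by
      rw [← hY]
      clear hev hY
      induction Y with
      | nil => simp
      | cons y Y ih =>
        rw [List.map_cons, List.prod_cons, Polynomial.degree_mul, ih]
        simp [add_comm]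
    rw [this, Finset.card_range]
    exact_mod_cast Nat.lt_succ_self k
  have hinj' : Set.InjOn (fun t : ℕ => (t : F)) (Finset.range (k + 1)) :=
    hinj.mono (by simpa using hk)
  rw [hev b, Lagrange.eq_interpolate hinj' hdeg, Lagrange.interpolate_apply,
    Polynomial.eval_finsetSum]
  refine Finset.sum_congr rfl fun t ht => ?_
  have ht' : t ≤ s := by have := Finset.mem_range.1 ht; omega
  simp [rootValues, ht', hev, mul_comm]

/-- For a fixed list `B`, the product of all differences `b - y` with `b ∈ B` and `y ∈ Y` depends
linearly on the vector of monomials of `Y`; it vanishes exactly if `B` and `Y` meet. -/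
theorem exists_functional {F : Type} [Field F] {s k : ℕ}
    (hinj : Set.InjOn (fun t : ℕ => (t : F)) (Finset.range (s + 1))) (B : List F)
    (hk : k + B.length ≤ s) :
    ∃ c : ℕ → F, ∀ Y : List F, Y.length = k →
      ∑ h ∈ Finset.range (2 * 2 ^ s + 1), c h * mon (rootValues s Y) h =
        (B.map fun b => (Y.map fun y => b - y).prod).prod := by
  classical
  choose lam hlam using fun b => exists_interpolation hinj (by omega : k ≤ s) b
  have hnode : ∀ g : Fin B.length → ℕ, ∃ h, (∀ b, g b ≤ k) → h < 2 * 2 ^ s + 1 ∧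
      ∀ v : ℕ → F, mon v h = ∏ b, v (g b) := by
    intro g
    by_cases hg : ∀ b, g b ≤ k
    · obtain ⟨h, h1, h2⟩ := exists_node hk g hg
      exact ⟨h, fun _ => ⟨h1, fun v => h2 v⟩⟩
    · exact ⟨0, fun h => absurd h hg⟩
  choose nd hnd using hnode
  refine ⟨fun h => ∑ g ∈ Fintype.piFinset fun _ : Fin B.length => Finset.range (k + 1),
    if nd g = h then ∏ b, lam (B.get b) (g b) else 0, fun Y hY => ?_⟩
  have h1 : (B.map fun b => (Y.map fun y => b - y).prod).prod =
      ∏ b : Fin B.length, ∑ t ∈ Finset.range (k + 1), lam (B.get b) t * rootValues s Y t := by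
    conv_lhs => rw [← List.ofFn_get B]
    rw [List.map_ofFn, List.prod_ofFn]
    exact Finset.prod_congr rfl fun b _ => hlam _ Y hY
  -- Expand the product of the interpolation sums and collect equal nodes.
  rw [h1, Finset.prod_univ_sum]
  simp only [Finset.sum_mul]
  rw [Finset.sum_comm]
  refine Finset.sum_congr rfl fun g hg => ?_
  have hg' : ∀ b, g b ≤ k := fun b => by
    have := Finset.mem_range.1 (Fintype.mem_piFinset.1 hg b); omega
  obtain ⟨h2, h3⟩ := hnd g hg'
  simp only [ite_mul, zero_mul]
  rw [Finset.sum_ite_eq, if_pos (Finset.mem_range.2 h2), h3, Finset.prod_mul_distrib]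

theorem prod_prod_sub_ne_zero_iff {F : Type} [Field F] (B Y : List F) :
    (B.map fun b => (Y.map fun y => b - y).prod).prod ≠ 0 ↔ ∀ b ∈ B, b ∉ Y := by
  simp only [ne_eq, List.prod_eq_zero_iff, List.mem_map, not_exists, not_and, sub_eq_zero]
  refine forall₂_congr fun b _ => ⟨fun h hb => h b hb rfl, fun h y hy hby => h (hby ▸ hy)⟩

/-! ### Schedules and job sequences -/

section Sequences

variable {K : Type*} [AddCommGroup K] [LinearOrder K]

/-- The profit of processing the jobs of a list in this order, each one as early as possible, from
time `τ` on (`r`, `p` and `f` are release dates, processing times and profit functions). -/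
def seqProfit (r p : ℕ → K) (f : ℕ → K → K) : K → List ℕ → K
  | _, [] => 0
  | τ, j :: l => f j (max τ (r j) + p j) + seqProfit r p f (max τ (r j) + p j) l

/-- `st` gives the start times when the jobs of the list are processed in this order, each one as
early as possible, from time `τ` on. -/
def Starts (r p : ℕ → K) (st : ℕ → K) : K → List ℕ → Prop
  | _, [] => True
  | τ, j :: l => st j = max τ (r j) ∧ Starts r p st (max τ (r j) + p j) l

variable {r p : ℕ → K} {f : ℕ → K → K}

theorem Starts.congr {st st' : ℕ → K} {τ : K} {l : List ℕ} (h : Starts r p st τ l)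
    (he : ∀ j ∈ l, st' j = st j) : Starts r p st' τ l := by
  induction l generalizing τ with
  | nil => trivial
  | cons j l ih =>
    exact ⟨by rw [he j (by simp), h.1], ih h.2 fun i hi => he i (by simp [hi])⟩

theorem Starts.sum_eq {st : ℕ → K} {τ : K} {l : List ℕ} (h : Starts r p st τ l) :
    (l.map fun j => f j (st j + p j)).sum = seqProfit r p f τ l := by
  induction l generalizing τ with
  | nil => rfl
  | cons j l ih => simp [seqProfit, ih h.2, h.1]

variable [IsOrderedAddMonoid K]

theorem Starts.le {st : ℕ → K} {τ : K} {l : List ℕ} (hp : ∀ j, 0 ≤ p j) (h : Starts r p st τ l) :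
    ∀ j ∈ l, τ ≤ st j ∧ r j ≤ st j := by
  induction l generalizing τ with
  | nil => simp
  | cons i l ih =>
    intro j hj
    rw [List.mem_cons] at hj
    rcases hj with rfl | hj
    · rw [h.1]; exact ⟨le_max_left _ _, le_max_right _ _⟩
    · have := ih h.2 j hj
      exact ⟨((le_max_left _ _).trans (le_add_of_nonneg_right (hp i))).trans this.1, this.2⟩

theorem Starts.disjoint {st : ℕ → K} {τ : K} {l : List ℕ} (hp : ∀ j, 0 ≤ p j)
    (h : Starts r p st τ l) :
    ∀ i ∈ l, ∀ j ∈ l, i ≠ j → st i + p i ≤ st j ∨ st j + p j ≤ st i := by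
  induction l generalizing τ with
  | nil => simp
  | cons a l ih =>
    have hle := Starts.le hp h.2
    rw [← h.1] at hle
    intro i hi j hj hij
    rw [List.mem_cons] at hi hj
    rcases hi with rfl | hi <;> rcases hj with rfl | hj
    · exact absurd rfl hij
    · exact Or.inl (hle j hj).1
    · exact Or.inr (hle i hi).1
    · exact ih h.2 i hi j hj hij

end Sequences

section Instance

variable {K : Type*} [AddCommGroup K] [LinearOrder K] {n : ℕ}

/-- The release dates, extended by `0`; in particular `I.rel n = 0`, the time at which a schedule
may begin. -/
def JobSet.rel (I : JobSet K n) (j : ℕ) : K := if h : j < n then I.release ⟨j, h⟩ else 0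

/-- The processing times, extended by `0`. -/
def JobSet.len (I : JobSet K n) (j : ℕ) : K := if h : j < n then I.proc ⟨j, h⟩ else 0

theorem JobSet.len_nonneg (I : JobSet K n) (j : ℕ) : 0 ≤ I.len j := by
  unfold JobSet.len; split_ifs; exacts [I.proc_nonneg _, le_rfl]

/-- The profit of a job sequence that starts at time `τ`. -/
abbrev JobSet.value (I : JobSet K n) (τ : K) (l : List ℕ) : K := seqProfit I.rel I.len I.oracle τ l

variable [IsOrderedAddMonoid K]

/-- Processing the jobs of a schedule in the order of their start times, each one as early as
possible, does not decrease the profit.  Jobs of length `0` may share their start time with another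
job; ties are broken by the completion times. -/
theorem JobSet.exists_seq (I : JobSet K n) {s : ℕ} {S : Schedule K n} (hS : I.IsFeasible s S)
    (A : Finset (Fin n)) (hA : A ⊆ S.selected) (τ : K) (hτ : 0 ≤ τ) (hle : ∀ j ∈ A, τ ≤ S.start j) :
    ∃ l : List ℕ, l.Nodup ∧ (∀ j ∈ l, ∃ i ∈ A, (i : ℕ) = j) ∧ l.length = A.card ∧
      ∑ j ∈ A, I.profit j (I.completion S j) ≤ I.value τ l := by
  induction hc : A.card generalizing A τ with
  | zero =>
    obtain rfl := Finset.card_eq_zero.1 hc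
    exact ⟨[], by simp [seqProfit]⟩
  | succ c ih =>
    obtain ⟨j, hj, hmin⟩ := A.exists_min_image (fun j => toLex (S.start j, I.completion S j))
      (Finset.card_pos.1 (by omega))
    have hC : max τ (I.rel j) + I.len j ≤ I.completion S j := by
      have h1 : I.len j = I.proc j := by simp [JobSet.len]
      have h2 : I.rel j = I.release j := by simp [JobSet.rel]
      rw [h1, h2]
      exact add_le_add_left (max_le (hle j hj) (hS.release_le j (hA hj))) _
    have h0 : 0 ≤ max τ (I.rel j) + I.len j :=
      add_nonneg (hτ.trans (le_max_left _ _)) (I.len_nonneg j)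
    have hrest : ∀ i ∈ A.erase j, max τ (I.rel j) + I.len j ≤ S.start i := by
      intro i hi
      refine hC.trans ?_
      -- `j` comes first; if `i` is completed before the start of `j`, both have length `0` and the
      -- same start time.
      have hiA := Finset.mem_of_mem_erase hi
      have hlex := hmin i hiA
      rw [Prod.Lex.toLex_le_toLex] at hlex
      rcases hS.disjoint j (hA hj) i (hA hiA) (Finset.ne_of_mem_erase hi).symm with h | h
      · exact h
      · have h5 : S.start i ≤ I.completion S i := le_add_of_nonneg_right (I.proc_nonneg i)
        rcases hlex with hlt | ⟨heq, hle'⟩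
        · exact absurd (hlt.trans_le (h5.trans h)) (lt_irrefl _)
        · exact hle'.trans (h.trans heq.le)
    obtain ⟨l, h1, h2, h3, h4⟩ := ih (A.erase j) ((A.erase_subset j).trans hA) _ h0
      hrest (by rw [Finset.card_erase_of_mem hj, hc]; rfl)
    refine ⟨j :: l, ?_, ?_, by simp [h3], ?_⟩
    · refine List.nodup_cons.2 ⟨fun hjl => ?_, h1⟩
      obtain ⟨i, hi, hij⟩ := h2 _ hjl
      exact Finset.ne_of_mem_erase hi (Fin.ext hij)
    · intro i hi
      rcases List.mem_cons.1 hi with rfl | hi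
      · exact ⟨j, hj, rfl⟩
      · obtain ⟨a, ha, hai⟩ := h2 i hi
        exact ⟨a, Finset.mem_of_mem_erase ha, hai⟩
    · rw [← Finset.add_sum_erase _ _ hj]
      refine add_le_add ?_ h4
      have : I.oracle j = I.profit j := by funext t; simp [JobSet.oracle]
      rw [this]
      exact I.profit_antitone j h0 (h0.trans hC) hC

/-- A job sequence of maximum profit gives an optimal schedule. -/
theorem JobSet.isOptimal_of_starts (I : JobSet K n) {s : ℕ} {S : Schedule K n} {st : ℕ → K}
    {l : List ℕ} (hl : l.Nodup) (hn : ∀ j ∈ l, j < n) (hs : l.length ≤ s)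
    (hsel : ∀ j : Fin n, j ∈ S.selected ↔ (j : ℕ) ∈ l) (hst : ∀ j : Fin n, S.start j = st j)
    (hS : Starts I.rel I.len st 0 l)
    (hmax : ∀ l' : List ℕ, l'.Nodup → (∀ j ∈ l', j < n) → l'.length ≤ s →
      I.value 0 l' ≤ I.value 0 l) : I.IsOptimal s S := by
  have hlen : ∀ j : Fin n, I.proc j = I.len j := fun j => by simp [JobSet.len]
  have hrel : ∀ j : Fin n, I.release j = I.rel j := fun j => by simp [JobSet.rel]
  have himg : S.selected.image (fun j : Fin n => (j : ℕ)) = l.toFinset := by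
    ext j
    simp only [Finset.mem_image, List.mem_toFinset, hsel]
    exact ⟨fun ⟨i, hi, hij⟩ => hij ▸ hi, fun hj => ⟨⟨j, hn j hj⟩, hj, rfl⟩⟩
  have hcard : S.selected.card = l.length := by
    rw [← Finset.card_image_of_injective S.selected Fin.val_injective, himg,
      List.toFinset_card_of_nodup hl]
  have hprofit : I.totalProfit S = I.value 0 l := by
    rw [JobSet.value, ← hS.sum_eq, ← List.sum_toFinset _ hl, ← himg,
      Finset.sum_image Fin.val_injective.injOn]
    refine Finset.sum_congr rfl fun j _ => ?_
    simp [JobSet.completion, JobSet.oracle, hst, hlen]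
  refine ⟨⟨hcard.trans_le hs, fun j hj => ?_, fun i hi j hj hij => ?_⟩, fun S' hS' => ?_⟩
  · rw [hst, hrel]; exact (hS.le I.len_nonneg j ((hsel j).1 hj)).2
  · simp only [JobSet.completion, hst, hlen]
    exact hS.disjoint I.len_nonneg i ((hsel i).1 hi) j ((hsel j).1 hj)
      fun h => hij (Fin.ext h)
  · obtain ⟨l', h1, h2, h3, h4⟩ := I.exists_seq hS' S'.selected subset_rfl 0 le_rfl
      fun j hj => (I.release_nonneg j).trans (hS'.release_le j hj)
    rw [hprofit]
    refine h4.trans (hmax l' h1 (fun j hj => ?_) (h3.trans_le hS'.card_le))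
    obtain ⟨i, _, rfl⟩ := h2 j hj
    exact i.2

end Instance

/-! ### Memory banks -/

-- The bank `0` of the index banks is the input, the bank `1` the output.  Address `0` of the next
-- ones holds the loop variables.
notation "bkV0" => 2
notation "bkV1" => 3
notation "bkV2" => 4
notation "bkV3" => 5
notation "bkV4" => 6
notation "bkV5" => 7
notation "bkV6" => 8

-- Search for a prime, and tables for arithmetic modulo this prime.
notation "bkM1" => 10
notation "bkM2" => 11
notation "bkX" => 12
notation "bkComp" => 13
notation "bkP" => 14
notation "bkRow" => 15
notation "bkAcc" => 16
notation "bkMod" => 17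
notation "bkMul" => 18

-- Tables of the states and of the nodes of the binary tree.
notation "bkM" => 19
notation "bkStep" => 20
notation "bkFound" => 21
notation "bkBase" => 22
notation "bkPow" => 23
notation "bkDim" => 24
notation "bkZeros" => 25
notation "bkBasisRow" => 26
notation "bkStates" => 27

-- The families: the family with index `z` consists of the entries from `bkBeg z` to `bkEnd z`.  An
-- entry is a linked list of jobs: `bkJob` is its first job, and `bkNxt` is the entry of its tail.
-- `bkCnt` is the number of entries, `bkPrev` the index of the first family of the previous layer,
-- and `bkCur` the index of the current family.
notation "bkBeg" => 28
notation "bkEnd" => 29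
notation "bkJob" => 30
notation "bkNxt" => 31
notation "bkCnt" => 32
notation "bkPrev" => 33
notation "bkCur" => 34

-- Comparison of candidates and elimination.
notation "bkRank" => 35
notation "bkFnd" => 36
notation "bkY" => 37
notation "bkE" => 38
notation "bkDup" => 39
notation "bkCh" => 40
notation "bkVal" => 41
notation "bkVec" => 42
notation "bkA" => 43
notation "bkB" => 44
notation "bkBas" => 45
notation "bkPiv" => 46
notation "bkNz" => 47
notation "bkPv" => 48

-- The chosen list.
notation "bkBest" => 49
notation "bkSize" => 50
notation "bkZ" => 51
notation "bkOut" => 52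

-- Number banks: the input, the start times of the output, offsets and times of states, profits of
-- entries, quantities of the current candidate, and of the chosen list.
notation "vbRel" => 0
notation "vbLen" => 1
notation "vbStart" => 2
notation "vbOff" => 3
notation "vbTau" => 4
notation "vbWt" => 5
notation "vbSt" => 6
notation "vbWj" => 7
notation "vbW" => 8
notation "vbBest" => 9
notation "vbTime" => 10

attribute [local simp] IExp.eval VExp.eval BExp.eval Prog.sem IExp.cost BExp.cost VExp.cost
  Prog.time imem_setI_same imem_setI_ne vmem_setI vmem_setV_same vmem_setV_ne imem_setV
  Function.update_apply imem_ite vmem_ite ite_apply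

/-! ### Multiples, primes, and arithmetic modulo a prime -/

section Arithmetic

variable {K : Type*} [AddCommGroup K] [LinearOrder K] {f : ℕ → K → K}

/-- Stores the multiples `i * c` for `i < N` in the bank `arr`, where `c` is the value of `step`. -/
def multiplesProg (arr v acc : ℕ) (N step : IExp) : Prog :=
  .iset acc (.lit 0) (.lit 0) ;;
  forLoop v N (.iset arr (var v) (var acc) ;; .iset acc (.lit 0) (.add (var acc) step))

theorem run_multiplesProg {arr v acc : ℕ} {N step : IExp} {σ : State K} {n c : ℕ}
    (h1 : v ≠ arr) (h2 : v ≠ acc) (h3 : arr ≠ acc)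
    (hN : ∀ σ', Frame (multiplesProg arr v acc N step) σ σ' → N.eval σ' = n)
    (hc : ∀ σ', Frame (multiplesProg arr v acc N step) σ σ' → step.eval σ' = c) :
    Run f (multiplesProg arr v acc N step) σ ((n + 2) * (N.cost + step.cost + 22))
      (fun σ' => ∀ i < n, σ'.imem arr i = i * c) := by
  have hF₁ : ∀ σ₁, Frame (.iset acc (.lit 0) (.lit 0)) σ σ₁ →
      Frame (multiplesProg arr v acc N step) σ σ₁ := fun σ₁ hF =>
    hF.mono (by simp +contextual [multiplesProg, Prog.wI])
      (by simp +contextual [multiplesProg, Prog.wV])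
  have hF₂ : ∀ σ₁ σ₂ : State K,
      Frame (forLoop v N (.iset arr (var v) (var acc) ;; .iset acc (.lit 0) (.add (var acc) step)))
        σ₁ σ₂ → Frame (multiplesProg arr v acc N step) σ₁ σ₂ := fun σ₁ σ₂ hF =>
    hF.mono (by simp +contextual [multiplesProg, Prog.wI])
      (by simp +contextual [multiplesProg, Prog.wV])
  refine Run.bind (T := 3) (fun σ₁ => σ₁.imem acc 0 = 0) (Run.straight rfl (by simp))
    (fun σ₁ hF hA => Run.post (Run.forLoop (N := n) (T := step.cost + 10)
      (fun i σ' => σ'.imem acc 0 = i * c ∧ ∀ j < i, σ'.imem arr j = j * c)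
      (by simp [Prog.wI, h1, h2]) (fun σ' hF' => hN σ' ((hF₁ _ hF).trans (hF₂ _ _ hF')))
      (by simp [h2.symm, hA]) ?_) fun _ _ h => h.2) (by nlinarith)
  rintro i σ' hi hv hF' ⟨h4, h5⟩
  have h6 : Frame (multiplesProg arr v acc N step) σ (σ'.setI arr i (i * c)) := by
    refine (hF₁ _ hF).trans ((hF₂ _ _ hF').trans ⟨fun b hb => imem_setI_ne _ _ _ ?_,
      fun b _ => rfl⟩)
    rintro rfl
    simp [multiplesProg, forLoop, Prog.wI] at hb
  have h7 := hc _ h6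
  refine (Run.straight rfl ?_).le (by simp; omega)
  have h8 : v ≠ acc := h2
  simp [h1.symm, h2.symm, h3, h3.symm, hv, h4, h7]
  refine ⟨by ring, fun j hj => ?_⟩
  split_ifs with hji
  · rw [hji]
  · exact h5 j (by omega)

/-- Marks the numbers `(a + 2) * (b + 2)` with `b < 2 * m`, where `a` is the variable `bkV0`. -/
def sieveRowProg : Prog :=
  .iset bkX (.lit 0) (.add (.add (var bkV0) (.lit 2)) (.add (var bkV0) (.lit 2))) ;;
  forLoop bkV1 (var bkM2)
    (.iset bkComp (var bkX) (.lit 1) ;;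
     .iset bkX (.lit 0) (.add (var bkX) (.add (var bkV0) (.lit 2))))

/-- Finds a prime number between `m + 1` and `2 * m`, where `m = n + s + 1`, by a sieve. -/
def primeProg : Prog :=
  .iset bkM1 (.lit 0) (.add (.add (.cell 0 (.lit 0)) (.cell 0 (.lit 1))) (.lit 1)) ;;
  .iset bkM2 (.lit 0) (.add (var bkM1) (var bkM1)) ;;
  forLoop bkV0 (var bkM2) sieveRowProg ;;
  forLoop bkV0 (var bkM1)
    (.cond (.ile (.cell bkComp (.add (.add (var bkM1) (.lit 1)) (var bkV0))) (.lit 0))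
      (.iset bkP (.lit 0) (.add (.add (var bkM1) (.lit 1)) (var bkV0))) .skip)

/-- The marked numbers are composite, and all multiples `(a + 2) * (b + 2)` with `a < i` and
`b < B` are marked. -/
def Sieved (i B : ℕ) (comp : ℕ → ℕ) : Prop :=
  (∀ x, comp x ≠ 0 → ∃ a b, x = (a + 2) * (b + 2)) ∧
    ∀ a b, a < i → b < B → comp ((a + 2) * (b + 2)) ≠ 0

theorem run_sieveRowProg {σ : State K} {i B : ℕ} (hi : σ.imem bkV0 0 = i) (hB : σ.imem bkM2 0 = B)
    (h : Sieved i B (σ.imem bkComp)) :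
    Run f sieveRowProg σ (60 * (B + 1)) (fun σ' => Sieved (i + 1) B (σ'.imem bkComp)) := by
  refine Run.bind (T := 20) (fun σ₁ => σ₁.imem bkX 0 = (i + 2) * 2)
    (Run.block (by simp [hi]; ring)) (fun σ₁ hF hX => Run.post (Run.forLoop (N := B) (T := 15)
      (fun b σ' => σ'.imem bkX 0 = (i + 2) * (b + 2) ∧ Sieved i B (σ'.imem bkComp) ∧
        ∀ b' < b, σ'.imem bkComp ((i + 2) * (b' + 2)) ≠ 0) rfl ?_ ?_ ?_) ?_)
      (by simp; omega)
  · intro σ' hF'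
    simp [hF'.i bkM2 rfl, hF.i bkM2 rfl, hB]
  · simp [hX, hF.i bkComp rfl, h]
  · rintro b σ' hb hv hF' ⟨h1, h2, h3⟩
    have h4 : σ'.imem bkV0 0 = i := by rw [hF'.i bkV0 rfl, hF.i bkV0 rfl, hi]
    refine Run.block ⟨?_, ⟨?_, ?_⟩, ?_⟩
    · simp [h1, h4]; ring
    · intro x hx
      by_cases hx' : x = (i + 2) * (b + 2)
      · exact ⟨i, b, hx'⟩
      · simp [h1, hx'] at hx
        exact h2.1 x hx
    · intro a b' ha hb'
      simp only [Prog.sem, IExp.eval]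
      simp [Function.update_apply, h1]
      split_ifs
      · simp
      · exact h2.2 a b' ha hb'
    · intro b' hb'
      by_cases hbb : b' = b
      · simp [h1, hbb]
      · have := h3 b' (by omega)
        simp [h1, hbb, this]
  · rintro σ' hF' ⟨h1, h2, h3⟩
    refine ⟨h2.1, fun a b ha hb => ?_⟩
    rcases Nat.lt_succ_iff_lt_or_eq.1 ha with ha | rfl
    · exact h2.2 a b ha hb
    · exact h3 b hb

/-- The search succeeds by Bertrand's postulate. -/
theorem run_primeProg {σ : State K} {n s : ℕ} (hn : σ.imem 0 0 = n) (hs : σ.imem 0 1 = s)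
    (hcomp : ∀ x, σ.imem bkComp x = 0) :
    Run f primeProg σ (1000 * (n + s + 1) ^ 2) (fun σ' => (σ'.imem bkP 0).Prime ∧
      n + s + 1 < σ'.imem bkP 0 ∧ σ'.imem bkP 0 ≤ 2 * (n + s + 1)) := by
  obtain ⟨m, hm⟩ : ∃ m, n + s + 1 = m := ⟨_, rfl⟩
  refine Run.bind (T := 10) (fun σ₁ => σ₁.imem bkM1 0 = m) (Run.block (by simp [*]))
    (fun σ₁ hF₁ h1 => Run.bind (T := 10) (fun σ₂ => σ₂.imem bkM2 0 = 2 * m)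
      (Run.block (by simp [h1]; omega))
    (fun σ₂ hF₂ h2 => Run.bind (fun σ₃ => Sieved (2 * m) (2 * m) (σ₃.imem bkComp))
      (Run.forLoop (N := 2 * m) (T := 60 * (2 * m + 1))
        (fun i σ' => Sieved i (2 * m) (σ'.imem bkComp)) rfl ?_ ?_ ?_)
    (fun σ₃ hF₃ h3 => Run.post (Run.forLoop (N := m) (T := 30) (fun i σ' =>
        (∀ c < i, σ'.imem bkComp (m + 1 + c) ≠ 0) ∨
        (m < σ'.imem bkP 0 ∧ σ'.imem bkP 0 ≤ 2 * m ∧ σ'.imem bkComp (σ'.imem bkP 0) = 0)) rfl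
        ?_ ?_ ?_) ?_) le_rfl) le_rfl) ?_
  · intro σ' hF'
    simp [hF'.i bkM2 rfl, h2]
  · simp [Sieved, hF₂.i bkComp rfl, hF₁.i bkComp rfl, hcomp]
  · intro i σ' hi hv hF' hI
    exact (run_sieveRowProg hv (by rw [hF'.i bkM2 rfl, h2]) hI).post fun _ _ h => by simpa using h
  · intro σ' hF'
    simp [hF'.i bkM1 rfl, hF₃.i bkM1 rfl, hF₂.i bkM1 rfl, h1]
  · simp
  · intro i σ' hi hv hF' hI
    have h4 : σ'.imem bkM1 0 = m := by
      rw [hF'.i bkM1 rfl, hF₃.i bkM1 rfl, hF₂.i bkM1 rfl, h1]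
    refine Run.block ?_
    by_cases hc : σ'.imem bkComp (m + 1 + i) = 0
    · right
      simp [hv, h4, hc]; omega
    · simp only [Prog.sem, BExp.eval, IExp.eval, h4, hv, Nat.le_zero, hc, decide_false,
        Bool.false_eq_true, if_false]
      simp only [ne_eq, show (bkComp : ℕ) ≠ bkV0 by decide, not_false_eq_true, imem_setI_ne,
        show (bkP : ℕ) ≠ bkV0 by decide]
      refine hI.imp (fun h c hci => ?_) id
      rcases Nat.lt_succ_iff_lt_or_eq.1 hci with hci | rfl
      · exact h c hci
      · exact hc
  · intro σ' hF' hI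
    rw [hm]
    have hcomp' : σ'.imem bkComp = σ₃.imem bkComp := hF'.i bkComp rfl
    rw [hcomp'] at hI
    rcases hI with hI | ⟨h4, h5, h6⟩
    · exfalso
      obtain ⟨q, hq, hmq, hq2⟩ := Nat.exists_prime_lt_and_le_two_mul m (by omega)
      obtain ⟨a, b, hab⟩ := h3.1 q (by have := hI (q - m - 1) (by omega)
                                       rwa [show m + 1 + (q - m - 1) = q by omega] at this)
      exact Nat.not_prime_mul (by omega) (by omega) (hab ▸ hq)
    · refine ⟨?_, h4, h5⟩
      by_contra hP
      obtain ⟨a, b, ha, hb, hab⟩ := (Nat.not_prime_iff_exists_mul_eq (by omega)).1 hP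
      have ha1 : 1 < a := by
        by_contra h
        interval_cases a <;> omega
      have hb1 : 1 < b := by
        by_contra h
        interval_cases b <;> omega
      refine h3.2 (a - 2) (b - 2) (by omega) (by omega) ?_
      rw [show a - 2 + 2 = a by omega, show b - 2 + 2 = b by omega, hab, h6]
  · rw [hm]
    have : 1 ≤ m := by omega
    simp only [IExp.cost]
    nlinarith

/-- The contents of the tables for arithmetic modulo `p`: multiples of `p`, remainders, and
products modulo `p`. -/
structure IsModTable (p : ℕ) (row md mul : ℕ → ℕ) : Prop where
  row : ∀ x < p, row x = x * p
  md : ∀ z < 2 * p, md z = z % p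
  mul : ∀ x < p, ∀ y < p, mul (x * p + y) = x * y % p

/-- Stores the remainders of the numbers below `2 * p` modulo `p`. -/
def modProg : Prog :=
  .iset bkAcc (.lit 0) (.lit 0) ;;
  forLoop bkV0 (.add (var bkP) (var bkP))
    (.iset bkMod (var bkV0) (var bkAcc) ;;
     .cond (.ile (var bkP) (.add (var bkAcc) (.lit 1))) (.iset bkAcc (.lit 0) (.lit 0))
       (.iset bkAcc (.lit 0) (.add (var bkAcc) (.lit 1))))

theorem run_modProg {σ : State K} {p : ℕ} (hp : σ.imem bkP 0 = p) (hp0 : 0 < p) :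
    Run f modProg σ (150 * p) (fun σ' => ∀ z < 2 * p, σ'.imem bkMod z = z % p) := by
  refine Run.bind (T := 3) (fun σ₁ => σ₁.imem bkAcc 0 = 0) (Run.block (by simp))
    (fun σ₁ hF h => Run.post (Run.forLoop (N := 2 * p) (T := 30) (fun i σ' =>
      σ'.imem bkAcc 0 = i % p ∧ ∀ z < i, σ'.imem bkMod z = z % p) rfl ?_ ?_ ?_)
      fun _ _ h => h.2) (by simp; omega)
  · intro σ' hF'
    simp [hF'.i bkP rfl, hF.i bkP rfl, hp]; omega
  · simp [h]
  · rintro i σ' hi hv hF' ⟨h1, h2⟩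
    have h3 : σ'.imem bkP 0 = p := by rw [hF'.i bkP rfl, hF.i bkP rfl, hp]
    refine Run.block ⟨?_, fun z hz => ?_⟩
    · have h4 := Nat.mod_lt i hp0
      by_cases hc : p ≤ i % p + 1
      · have h5 : (i + 1) % p = 0 := by
          rw [← Nat.mod_add_mod, show i % p + 1 = p by omega, Nat.mod_self]
        simp [h1, hv, h3, hc, h5]
      · have h5 : (i + 1) % p = i % p + 1 := by
          rw [← Nat.mod_add_mod, Nat.mod_eq_of_lt (by omega)]
        simp [h1, hv, h3, hc, h5]
    · rcases Nat.lt_succ_iff_lt_or_eq.1 hz with hz | rfl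
      · have := h2 z hz
        have hne : z ≠ i := by omega
        simp [hv, hne, this]
      · simp [hv, h1]

/-- Stores the products of all residues with the value of the variable `bkV0`. -/
def mulRowProg : Prog :=
  .iset bkAcc (.lit 0) (.lit 0) ;;
  forLoop bkV1 (var bkP)
    (.iset bkMul (.add (.cell bkRow (var bkV0)) (var bkV1)) (var bkAcc) ;;
     .iset bkAcc (.lit 0) (.cell bkMod (.add (var bkAcc) (var bkV0))))

theorem run_mulRowProg {σ : State K} {p x : ℕ} (hp : σ.imem bkP 0 = p) (hx : σ.imem bkV0 0 = x)
    (hxp : x < p) (hrow : ∀ x < p, σ.imem bkRow x = x * p)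
    (hmod : ∀ z < 2 * p, σ.imem bkMod z = z % p)
    (h : ∀ x' < x, ∀ y < p, σ.imem bkMul (x' * p + y) = x' * y % p) :
    Run f mulRowProg σ (80 * p) (fun σ' =>
      ∀ x' < x + 1, ∀ y < p, σ'.imem bkMul (x' * p + y) = x' * y % p) := by
  refine Run.bind (T := 3) (fun σ₁ => σ₁.imem bkAcc 0 = 0) (Run.block (by simp))
    (fun σ₁ hF h0 => Run.post (Run.forLoop (N := p) (T := 20) (fun i σ' =>
      σ'.imem bkAcc 0 = x * i % p ∧
      (∀ x' < x, ∀ y < p, σ'.imem bkMul (x' * p + y) = x' * y % p) ∧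
      ∀ y < i, σ'.imem bkMul (x * p + y) = x * y % p) rfl ?_ ?_ ?_)
      ?_) (by simp; omega)
  · intro σ' hF'
    simp [hF'.i bkP rfl, hF.i bkP rfl, hp]
  · simp [h0, hF.i bkMul rfl]
    exact h
  · rintro i σ' hi hv hF' ⟨h1, h2, h3⟩
    have h4 : σ'.imem bkV0 0 = x := by rw [hF'.i bkV0 rfl, hF.i bkV0 rfl, hx]
    have h5 : σ'.imem bkRow x = x * p := by rw [hF'.i bkRow rfl, hF.i bkRow rfl, hrow x hxp]
    have h6 : σ'.imem bkMod (x * i % p + x) = x * (i + 1) % p := by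
      have := Nat.mod_lt (x * i) (by omega : 0 < p)
      rw [hF'.i bkMod rfl, hF.i bkMod rfl, hmod _ (by omega), Nat.mod_add_mod, mul_add, mul_one]
    refine Run.block ⟨?_, fun x' hx' y hy => ?_, fun y hy => ?_⟩
    · simp [h1, hv, h4, h6]
    · have hne : x' * p + y ≠ x * p + i := by
        have : (x' + 1) * p ≤ x * p := Nat.mul_le_mul_right p hx'
        rw [add_mul] at this
        omega
      simp [h1, hv, h4, h5, hne, h2 x' hx' y hy]
    · rcases Nat.lt_succ_iff_lt_or_eq.1 hy with hy | rfl
      · have hne : y ≠ i := by omega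
        simp [h1, hv, h4, h5, hne, h3 y hy]
      · simp [h1, hv, h4, h5]
  · rintro σ' hF' ⟨h1, h2, h3⟩ x' hx' y hy
    rcases Nat.lt_succ_iff_lt_or_eq.1 hx' with hx' | rfl
    · exact h2 x' hx' y hy
    · exact h3 y hy

/-- Finds a prime `p` and stores the tables for arithmetic modulo `p`. -/
def fieldProg : Prog :=
  primeProg ;; multiplesProg bkRow bkV0 bkAcc (var bkP) (var bkP) ;; modProg ;;
  forLoop bkV0 (var bkP) mulRowProg

theorem run_fieldProg {σ : State K} {n s : ℕ} (hn : σ.imem 0 0 = n) (hs : σ.imem 0 1 = s)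
    (hcomp : ∀ x, σ.imem bkComp x = 0) :
    Run f fieldProg σ (2000 * (n + s + 1) ^ 2) (fun σ' => (σ'.imem bkP 0).Prime ∧
      n + s + 1 < σ'.imem bkP 0 ∧
      IsModTable (σ'.imem bkP 0) (σ'.imem bkRow) (σ'.imem bkMod) (σ'.imem bkMul)) := by
  obtain ⟨m, hm⟩ : ∃ m, n + s + 1 = m := ⟨_, rfl⟩
  rw [hm]
  refine Run.bind (U := 1000 * m ^ 2) _ (run_primeProg hn hs hcomp) (fun σ₁ hF₁ ⟨h1, h2, h3⟩ => ?_)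
    (by rw [hm]; linarith)
  obtain ⟨p, hp⟩ : ∃ p, σ₁.imem bkP 0 = p := ⟨_, rfl⟩
  rw [hp, hm] at h2 h3
  rw [hp] at h1
  refine Run.bind _ (run_multiplesProg (n := p) (c := p) (by decide) (by decide) (by decide)
    (fun σ' hF => by simp [hF.i bkP rfl, hp]) (fun σ' hF => by simp [hF.i bkP rfl, hp]))
    (fun σ₂ hF₂ h4 => Run.bind _ (run_modProg (by rw [hF₂.i bkP rfl, hp]) h1.pos)
    (fun σ₃ hF₃ h5 => Run.post (Run.forLoop (N := p) (T := 80 * p)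
      (fun i σ' => ∀ x' < i, ∀ y < p, σ'.imem bkMul (x' * p + y) = x' * y % p) rfl ?_ (by simp) ?_)
      ?_) le_rfl) ?_
  · intro σ' hF
    simp [hF.i bkP rfl, hF₃.i bkP rfl, hF₂.i bkP rfl, hp]
  · intro i σ' hi hv hF hI
    refine (run_mulRowProg (by rw [hF.i bkP rfl, hF₃.i bkP rfl, hF₂.i bkP rfl, hp]) hv hi ?_ ?_
      hI).post fun _ _ h => by simpa using h
    · rw [hF.i bkRow rfl, hF₃.i bkRow rfl]; exact h4
    · rw [hF.i bkMod rfl]; exact h5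
  · intro σ' hF hI
    have h6 : σ'.imem bkP 0 = p := by rw [hF.i bkP rfl, hF₃.i bkP rfl, hF₂.i bkP rfl, hp]
    rw [h6]
    refine ⟨h1, h2, ⟨?_, ?_, hI⟩⟩
    · rw [hF.i bkRow rfl, hF₃.i bkRow rfl]; exact h4
    · rw [hF.i bkMod rfl]; exact h5
  · simp only [IExp.cost]
    have : 1 ≤ m := by omega
    nlinarith

end Arithmetic

/-! ### Total processing times of at most `s` jobs -/

section Offsets

variable {K : Type*}

/-- The number of distinct values of `len` on the first `j` jobs. -/
noncomputable def numLen (len : ℕ → K) (j : ℕ) : ℕ :=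
  letI := Classical.decEq K
  ((Finset.range j).image len).card

theorem numLen_mono (len : ℕ → K) {i j : ℕ} (h : i ≤ j) : numLen len i ≤ numLen len j := by
  classical
  exact Finset.card_le_card (Finset.image_subset_image (Finset.range_mono h))

theorem numLen_succ_of_eq {len : ℕ → K} {i j : ℕ} (hi : i < j) (h : len i = len j) :
    numLen len (j + 1) = numLen len j := by
  classical
  unfold numLen
  rw [Finset.range_add_one, Finset.image_insert, Finset.insert_eq_of_mem]
  exact Finset.mem_image.2 ⟨i, Finset.mem_range.2 hi, h⟩

theorem numLen_succ_of_ne {len : ℕ → K} {j : ℕ} (h : ∀ i < j, len i ≠ len j) :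
    numLen len (j + 1) = numLen len j + 1 := by
  classical
  unfold numLen
  rw [Finset.range_add_one, Finset.image_insert, Finset.card_insert_of_notMem]
  intro hmem
  obtain ⟨i, hi, hij⟩ := Finset.mem_image.1 hmem
  exact h i (Finset.mem_range.1 hi) hij

variable [AddCommGroup K]

/-- Every list of at most `s` of the first `j` jobs has an index below `M`, the sum of the numbers
`step i` of its members, at which the bank `off` holds the total processing time of the list.
These indices are numbers in base `s + 1` with one digit for each processing time. -/
structure IsOffsetTable (len : ℕ → K) (s j M : ℕ) (step : ℕ → ℕ) (off : ℕ → K) : Prop where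
  size : M = (s + 1) ^ numLen len j
  lt : ∀ l : List ℕ, (∀ i ∈ l, i < j) → l.length ≤ s → (l.map step).sum < M
  off : ∀ l : List ℕ, (∀ i ∈ l, i < j) → l.length ≤ s →
    off (l.map step).sum = (l.map len).sum

theorem IsOffsetTable.zero {len : ℕ → K} {s : ℕ} {step : ℕ → ℕ} {off : ℕ → K} (h : off 0 = 0) :
    IsOffsetTable len s 0 1 step off := by
  have hnil : ∀ l : List ℕ, (∀ i ∈ l, i < 0) → l = [] := fun l hl =>
    List.eq_nil_iff_forall_not_mem.2 fun i hi => absurd (hl i hi) (Nat.not_lt_zero i)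
  exact ⟨by simp [numLen], fun l hl _ => by simp [hnil l hl], fun l hl _ => by simp [hnil l hl, h]⟩

theorem IsOffsetTable.congr {len : ℕ → K} {s j M : ℕ} {step step' : ℕ → ℕ} {off : ℕ → K}
    (h : IsOffsetTable len s j M step off) (hs : ∀ i < j, step' i = step i) :
    IsOffsetTable len s j M step' off := by
  have key : ∀ l : List ℕ, (∀ i ∈ l, i < j) → l.map step' = l.map step := fun l hl =>
    List.map_congr_left fun i hi => hs i (hl i hi)
  exact ⟨h.size, fun l hl hs => by rw [key l hl]; exact h.lt l hl hs,
    fun l hl hs => by rw [key l hl]; exact h.off l hl hs⟩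

/-- A processing time that has occurred before uses the same digit. -/
theorem IsOffsetTable.succ_of_eq {len : ℕ → K} {s i j M : ℕ} {step : ℕ → ℕ} {off : ℕ → K}
    (h : IsOffsetTable len s j M step off) (hi : i < j) (hlen : len i = len j)
    (hstep : step j = step i) : IsOffsetTable len s (j + 1) M step off := by
  -- Replacing `j` by `i` in a list changes neither its index nor its total processing time.
  have key : ∀ l : List ℕ, (∀ a ∈ l, a < j + 1) → ∃ l' : List ℕ, (∀ a ∈ l', a < j) ∧
      l'.length = l.length ∧ l'.map step = l.map step ∧ l'.map len = l.map len := by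
    intro l hl
    refine ⟨l.map fun a => if a = j then i else a, ?_, by simp, ?_, ?_⟩
    · intro a ha
      obtain ⟨b, hb, rfl⟩ := List.mem_map.1 ha
      have := hl b hb
      split_ifs <;> omega
    · rw [List.map_map]
      refine List.map_congr_left fun a _ => ?_
      by_cases ha : a = j <;> simp [ha, hstep]
    · rw [List.map_map]
      refine List.map_congr_left fun a _ => ?_
      by_cases ha : a = j <;> simp [ha, hlen]
  refine ⟨by rw [numLen_succ_of_eq hi hlen, h.size], fun l hl hs => ?_, fun l hl hs => ?_⟩
  · obtain ⟨l', h1, h2, h3, h4⟩ := key l hl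
    rw [← h3]; exact h.lt l' h1 (h2.trans_le hs)
  · obtain ⟨l', h1, h2, h3, h4⟩ := key l hl
    rw [← h3, ← h4]; exact h.off l' h1 (h2.trans_le hs)

/-- A new processing time is counted by a new leading digit. -/
theorem IsOffsetTable.succ_of_ne {len : ℕ → K} {s j M : ℕ} {step : ℕ → ℕ} {off off' : ℕ → K}
    (h : IsOffsetTable len s j M step off) (hlen : ∀ i < j, len i ≠ len j)
    (hstep : step j = M)
    (hoff : ∀ c ≤ s, ∀ y < M, off' (c * M + y) = off y + c • len j) :
    IsOffsetTable len s (j + 1) (M * (s + 1)) step off' := by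
  have key : ∀ l : List ℕ, (∀ a ∈ l, a < j + 1) → ∃ c, ∃ l' : List ℕ, (∀ a ∈ l', a < j) ∧
      c + l'.length = l.length ∧ (l.map step).sum = c * M + (l'.map step).sum ∧
      (l.map len).sum = (l'.map len).sum + c • len j := by
    intro l hl
    induction l with
    | nil => exact ⟨0, [], by simp⟩
    | cons a l ih =>
      obtain ⟨c, l', h1, h2, h3, h4⟩ := ih fun b hb => hl b (by simp [hb])
      by_cases ha : a = j
      · refine ⟨c + 1, l', h1, by simp; omega, ?_, ?_⟩
        · simp [h3, ha, hstep]; ring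
        · simp [h4, ha, add_smul]; abel
      · have haj : a < j := by have := hl a (by simp); omega
        refine ⟨c, a :: l', by simpa [haj] using h1, by simp; omega, ?_, ?_⟩
        · simp [h3]; ring
        · simp [h4]; abel
  refine ⟨by rw [numLen_succ_of_ne hlen, h.size, pow_succ], fun l hl hs => ?_, fun l hl hs => ?_⟩
  · obtain ⟨c, l', h1, h2, h3, h4⟩ := key l hl
    have h5 := h.lt l' h1 (by omega)
    have h6 : c * M ≤ s * M := Nat.mul_le_mul_right M (by omega)
    rw [h3, mul_add, mul_one, mul_comm M s]
    omega
  · obtain ⟨c, l', h1, h2, h3, h4⟩ := key l hl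
    rw [h3, h4, hoff c (by omega) _ (h.lt l' h1 (by omega)), h.off l' h1 (by omega)]

variable [LinearOrder K] {f : ℕ → K → K}

/-- Looks for a job with the same processing time before the job `bkV0`, and copies its `step`. -/
def findLenProg : Prog :=
  .iset bkFound (.lit 0) (.lit 0) ;;
  forLoop bkV1 (var bkV0)
    (.cond (.conj (.vle (.cell vbLen (var bkV1)) (.cell vbLen (var bkV0)))
        (.vle (.cell vbLen (var bkV0)) (.cell vbLen (var bkV1))))
      (.iset bkFound (.lit 0) (.lit 1) ;; .iset bkStep (var bkV0) (.cell bkStep (var bkV1))) .skip)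

theorem run_findLenProg {σ : State K} {j : ℕ} {len : ℕ → K} {step : ℕ → ℕ}
    (hj : σ.imem bkV0 0 = j) (hlen : σ.vmem vbLen = len) (hstep : σ.imem bkStep = step) :
    Run f findLenProg σ (60 * (j + 1)) (fun σ' => (∀ x ≠ j, σ'.imem bkStep x = step x) ∧
      ((σ'.imem bkFound 0 = 0 ∧ ∀ i < j, len i ≠ len j) ∨
        (σ'.imem bkFound 0 = 1 ∧ ∃ i < j, len i = len j ∧ σ'.imem bkStep j = step i))) := by
  refine Run.bind (T := 3) (fun σ₁ => σ₁.imem bkFound 0 = 0) (Run.block (by simp))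
    (fun σ₁ hF h => Run.post (Run.forLoop (N := j) (T := 40) (fun i σ' =>
      (∀ x ≠ j, σ'.imem bkStep x = step x) ∧
      ((σ'.imem bkFound 0 = 0 ∧ ∀ i' < i, len i' ≠ len j) ∨
        (σ'.imem bkFound 0 = 1 ∧ ∃ i < j, len i = len j ∧ σ'.imem bkStep j = step i))) rfl ?_ ?_ ?_)
      fun _ _ h => h) (by simp; omega)
  · intro σ' hF'
    simp [hF'.i bkV0 rfl, hF.i bkV0 rfl, hj]
  · simp [h, hF.i bkStep rfl, hstep]
  · rintro i σ' hi hv hF' ⟨h1, h2⟩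
    have h3 : σ'.imem bkV0 0 = j := by rw [hF'.i bkV0 rfl, hF.i bkV0 rfl, hj]
    have h4 : σ'.vmem vbLen = len := by rw [hF'.v vbLen rfl, hF.v vbLen rfl, hlen]
    refine Run.block ?_
    by_cases hc : len i = len j
    · have hij : i ≠ j := by omega
      simp [h3, h4, hv, hc, h1 i hij]
      exact ⟨fun x hx => by simpa [hx] using h1 x hx, i, hi, hc, rfl⟩
    · have hc' : ¬ (len i ≤ len j ∧ len j ≤ len i) := fun h => hc (le_antisymm h.1 h.2)
      simp [h3, h4, hv, hc']
      refine ⟨h1, h2.imp (fun h => ⟨h.1, fun i' hi' => ?_⟩) id⟩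
      rcases Nat.lt_or_eq_of_le hi' with hi' | rfl
      · exact h.2 i' hi'
      · exact hc

/-- Appends one shifted copy of the first `step j` offsets, where `j` is the variable `bkV0`. -/
def appendProg : Prog :=
  forLoop bkV3 (.cell bkStep (var bkV0))
    (.vset vbOff (var bkM) (.add (.cell vbOff (.sub (var bkM) (.cell bkStep (var bkV0))))
        (.cell vbLen (var bkV0))) ;;
     .iset bkM (.lit 0) (.add (var bkM) (.lit 1)))

theorem run_appendProg {σ : State K} {i j M : ℕ} {len off : ℕ → K}
    (hj : σ.imem bkV0 0 = j) (hlen : σ.vmem vbLen = len) (hstep : σ.imem bkStep j = M)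
    (hM : σ.imem bkM 0 = M * (i + 1))
    (hoff : ∀ c ≤ i, ∀ y < M, σ.vmem vbOff (c * M + y) = off y + c • len j) :
    Run f appendProg σ (50 * (M + 1)) (fun σ' => σ'.imem bkM 0 = M * (i + 2) ∧
      ∀ c ≤ i + 1, ∀ y < M, σ'.vmem vbOff (c * M + y) = off y + c • len j) := by
  refine Run.mono (Run.forLoop (N := M) (T := 30) (fun b σ' => σ'.imem bkM 0 = M * (i + 1) + b ∧
      (∀ c ≤ i, ∀ y < M, σ'.vmem vbOff (c * M + y) = off y + c • len j) ∧
      ∀ y < b, σ'.vmem vbOff ((i + 1) * M + y) = off y + (i + 1) • len j) rfl ?_ ?_ ?_)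
      (by simp; omega) ?_
  · intro σ' hF
    simp [hF.i bkV0 rfl, hF.i bkStep rfl, hj, hstep]
  · simp [hM]; exact hoff
  · rintro b σ' hb hv hF ⟨h1, h2, h3⟩
    have h4 : σ'.imem bkV0 0 = j := by rw [hF.i bkV0 rfl, hj]
    have h5 : σ'.vmem vbLen = len := by rw [hF.v vbLen rfl, hlen]
    have h6 : σ'.imem bkStep j = M := by rw [hF.i bkStep rfl, hstep]
    have h7 : M * (i + 1) + b - M = i * M + b := by
      rw [mul_add, mul_one, mul_comm M i]; omega
    have h8 : σ'.vmem vbOff (M * (i + 1) + b - M) = off b + i • len j := by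
      rw [h7, h2 i le_rfl b hb]
    refine Run.block ⟨?_, fun c hc y hy => ?_, fun y hy => ?_⟩
    · simp [h1, h4]; ring
    · have hne : c * M + y ≠ M * (i + 1) + b := by
        have : (c + 1) * M ≤ (i + 1) * M := Nat.mul_le_mul_right M (by omega)
        rw [add_mul, mul_comm (i + 1)] at this
        omega
      simp [h1, h4, h6, hne, h2 c hc y hy]
    · rcases Nat.lt_succ_iff_lt_or_eq.1 hy with hy | rfl
      · have hne : (i + 1) * M + y ≠ M * (i + 1) + b := by
          rw [mul_comm]; omega
        simp [h1, h4, h6, hne, h3 y hy]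
      · simp [h1, h4, h5, h6, h8, mul_comm (i + 1) M, add_smul, add_assoc]
  · rintro σ' hF ⟨h1, h2, h3⟩
    refine ⟨by rw [h1]; ring, fun c hc y hy => ?_⟩
    rcases Nat.le_succ_iff.1 hc with hc | rfl
    · exact h2 c hc y hy
    · exact h3 y hy

/-- Extends the table of offsets by the processing time of the job `bkV0`, if that is new. -/
def extendProg : Prog :=
  .cond (.ile (.lit 1) (var bkFound)) .skip
    (.iset bkStep (var bkV0) (var bkM) ;; forLoop bkV2 (.cell 0 (.lit 1)) appendProg)

/-- Computes the table of offsets. -/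
def offsetProg : Prog :=
  .iset bkM (.lit 0) (.lit 1) ;;
  forLoop bkV0 (.cell 0 (.lit 0)) (findLenProg ;; extendProg)

theorem run_extendProg {σ : State K} {s j M : ℕ} {len off : ℕ → K}
    (hs : σ.imem 0 1 = s) (hj : σ.imem bkV0 0 = j) (hlen : σ.vmem vbLen = len)
    (hM : σ.imem bkM 0 = M) (hoff : σ.vmem vbOff = off) (hfound : σ.imem bkFound 0 = 0) :
    Run f extendProg σ (100 * (s + 1) * (M + 1)) (fun σ' => σ'.imem bkM 0 = M * (s + 1) ∧
      (∀ x ≠ j, σ'.imem bkStep x = σ.imem bkStep x) ∧ σ'.imem bkStep j = M ∧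
      ∀ c ≤ s, ∀ y < M, σ'.vmem vbOff (c * M + y) = off y + c • len j) := by
  refine (Run.cond (fun h => ?_) (fun _ => Run.bind (T := 10) (fun σ₁ => σ₁.imem bkStep j = M ∧
    (∀ x ≠ j, σ₁.imem bkStep x = σ.imem bkStep x))
    (Run.block (by simp +contextual [hj, hM])) (fun σ₁ hF₁ ⟨h1, h2⟩ =>
      Run.post (Run.forLoop (N := s) (T := 50 * (M + 1)) (fun i σ' => σ'.imem bkM 0 = M * (i + 1) ∧
        ∀ c ≤ i, ∀ y < M, σ'.vmem vbOff (c * M + y) = off y + c • len j) rfl ?_ ?_ ?_) ?_)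
      le_rfl)).le ?_
  · simp [hfound] at h
  · intro σ' hF
    simp [hF.i 0 rfl, hF₁.i 0 rfl, hs]
  · simp [hF₁.i bkM rfl, hM, hF₁.v vbOff rfl, hoff]
  · rintro i σ' hi hv hF ⟨h3, h4⟩
    refine (run_appendProg (by rw [hF.i bkV0 rfl, hF₁.i bkV0 rfl, hj])
      (by rw [hF.v vbLen rfl, hF₁.v vbLen rfl, hlen]) (by rw [hF.i bkStep rfl, h1]) h3 h4).post ?_
    rintro σ'' hF'' ⟨h5, h6⟩
    simpa using ⟨h5, h6⟩
  · rintro σ' hF ⟨h3, h4⟩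
    exact ⟨h3, by rw [hF.i bkStep rfl]; exact h2, by rw [hF.i bkStep rfl]; exact h1, h4⟩
  · simp; nlinarith

theorem run_offsetProg {σ : State K} {n s : ℕ} {len : ℕ → K} (hn : σ.imem 0 0 = n)
    (hs : σ.imem 0 1 = s) (hlen : σ.vmem vbLen = len) (hoff : σ.vmem vbOff 0 = 0) :
    Run f offsetProg σ (400 * (n + 1) * (n + (s + 1) ^ numLen len n)) (fun σ' =>
      IsOffsetTable len s n (σ'.imem bkM 0) (σ'.imem bkStep) (σ'.vmem vbOff)) := by
  obtain ⟨Mf, hMf⟩ : ∃ Mf, (s + 1) ^ numLen len n = Mf := ⟨_, rfl⟩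
  have hMf1 : 1 ≤ Mf := hMf ▸ Nat.one_le_pow _ _ (by omega)
  refine Run.bind (T := 3) (fun σ₁ => σ₁.imem bkM 0 = 1) (Run.block (by simp))
    (fun σ₁ hF₁ h1 => Run.forLoop (N := n) (T := 60 * n + (210 * Mf)) (fun j σ' =>
      IsOffsetTable len s j (σ'.imem bkM 0) (σ'.imem bkStep) (σ'.vmem vbOff)) rfl ?_ ?_ ?_) ?_
  · intro σ' hF
    simp [hF.i 0 rfl, hF₁.i 0 rfl, hn]
  · simp only [ne_eq, show (bkM : ℕ) ≠ bkV0 by decide, not_false_eq_true, imem_setI_ne, h1,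
      vmem_setI]
    exact IsOffsetTable.zero (by rw [hF₁.v vbOff rfl, hoff])
  · intro j σ' hj hv hF hI
    have hlen' : σ'.vmem vbLen = len := by rw [hF.v vbLen rfl, hF₁.v vbLen rfl, hlen]
    have hs' : σ'.imem 0 1 = s := by rw [hF.i 0 rfl, hF₁.i 0 rfl, hs]
    refine Run.bind (U := 210 * Mf) _ (run_findLenProg hv hlen' rfl)
      (fun σ₂ hF₂ ⟨h2, h3⟩ => ?_) (by have : 60 * (j + 1) ≤ 60 * n := by omega
                                      omega)
    have hv₂ : σ₂.imem bkV0 0 = j := by rw [hF₂.i bkV0 rfl, hv]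
    have hI' : IsOffsetTable len s j (σ₂.imem bkM 0) (σ₂.imem bkStep) (σ₂.vmem vbOff) := by
      rw [hF₂.i bkM rfl, hF₂.v vbOff rfl]
      exact hI.congr fun i hi => h2 i (by omega)
    rcases h3 with ⟨h3, h4⟩ | ⟨h3, i, hi, hij, h4⟩
    · refine (run_extendProg (by rw [hF₂.i 0 rfl, hs']) hv₂ (by rw [hF₂.v vbLen rfl, hlen'])
        rfl rfl h3).mono ?_ ?_
      · have h5 := (pow_le_pow_right₀ (by omega : 1 ≤ s + 1) (numLen_mono len hj))
        rw [hMf, numLen_succ_of_ne h4, pow_succ, ← hI'.size] at h5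
        have h6 : 1 ≤ σ₂.imem bkM 0 := hI'.size ▸ Nat.one_le_pow _ _ (by omega)
        nlinarith
      · rintro σ₃ hF₃ ⟨h5, h6, h7, h8⟩
        simp only [ne_eq, show (bkM : ℕ) ≠ bkV0 by decide, show (bkStep : ℕ) ≠ bkV0 by decide,
          not_false_eq_true, imem_setI_ne, vmem_setI, h5]
        exact (hI'.congr fun i hi => h6 i (by omega)).succ_of_ne h4 h7 h8
    · refine (Run.cond (T := 1) (fun _ => Run.block ?_) (fun h => ?_)).le (by simp; omega)
      · simp only [Prog.sem, ne_eq, show (bkM : ℕ) ≠ bkV0 by decide,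
          show (bkStep : ℕ) ≠ bkV0 by decide, not_false_eq_true, imem_setI_ne, vmem_setI]
        refine hI'.succ_of_eq hi hij ?_
        rw [h4, h2 i (by omega)]
      · simp [h3] at h
  · rw [hMf]; simp only [IExp.cost]; nlinarith

end Offsets

/-! ### Tables of states and of tree nodes -/

section Tables

variable {K : Type*} [AddCommGroup K] [LinearOrder K] {n : ℕ} {f : ℕ → K → K}

/-- Stores the times `rel i + off a` of the states `i * M + a`, where `i` is the variable `bkV0`. -/
def timeRowProg : Prog :=
  forLoop bkV1 (var bkM)
    (.vset vbTau (.add (.cell bkBase (var bkV0)) (var bkV1))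
      (.add (.cell vbRel (var bkV0)) (.cell vbOff (var bkV1))))

/-- Stores the times of all states. -/
def timeProg : Prog :=
  multiplesProg bkBase bkV0 bkAcc (.add (.cell 0 (.lit 0)) (.lit 1)) (var bkM) ;;
  .iset bkStates (.lit 0) (.add (.cell bkBase (.cell 0 (.lit 0))) (var bkM)) ;;
  forLoop bkV0 (.add (.cell 0 (.lit 0)) (.lit 1)) timeRowProg

theorem run_timeRowProg {σ : State K} {i M : ℕ} {rel off : ℕ → K} (hi : σ.imem bkV0 0 = i)
    (hM : σ.imem bkM 0 = M) (hbase : σ.imem bkBase i = i * M) (hrel : σ.vmem vbRel = rel)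
    (hoff : σ.vmem vbOff = off)
    (h : ∀ i' < i, ∀ a < M, σ.vmem vbTau (i' * M + a) = rel i' + off a) :
    Run f timeRowProg σ (40 * (M + 1)) (fun σ' =>
      ∀ i' < i + 1, ∀ a < M, σ'.vmem vbTau (i' * M + a) = rel i' + off a) := by
  refine Run.mono (Run.forLoop (N := M) (T := 20) (fun a σ' =>
      (∀ i' < i, ∀ a < M, σ'.vmem vbTau (i' * M + a) = rel i' + off a) ∧
      ∀ a' < a, σ'.vmem vbTau (i * M + a') = rel i + off a') rfl ?_ ?_ ?_)
      (by simp; omega) ?_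
  · intro σ' hF
    simp [hF.i bkM rfl, hM]
  · simpa using h
  · rintro a σ' ha hv hF ⟨h1, h2⟩
    have h3 : σ'.imem bkV0 0 = i := by rw [hF.i bkV0 rfl, hi]
    have h4 : σ'.imem bkBase i = i * M := by rw [hF.i bkBase rfl, hbase]
    have h5 : σ'.vmem vbRel = rel := by rw [hF.v vbRel rfl, hrel]
    have h6 : σ'.vmem vbOff = off := by rw [hF.v vbOff rfl, hoff]
    refine Run.block ⟨fun i' hi' a' ha' => ?_, fun a' ha' => ?_⟩
    · have hne : i' * M + a' ≠ i * M + a := by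
        have : (i' + 1) * M ≤ i * M := Nat.mul_le_mul_right M hi'
        rw [add_mul] at this
        omega
      simp [hv, h3, h4, hne, h1 i' hi' a' ha']
    · rcases Nat.lt_succ_iff_lt_or_eq.1 ha' with ha' | rfl
      · have hne : a' ≠ a := by omega
        simp [hv, h3, h4, hne, h2 a' ha']
      · simp [hv, h3, h4, h5, h6]
  · rintro σ' hF ⟨h1, h2⟩ i' hi' a ha
    rcases Nat.lt_succ_iff_lt_or_eq.1 hi' with hi' | rfl
    · exact h1 i' hi' a ha
    · exact h2 a ha

theorem run_timeProg {σ : State K} {M : ℕ} {rel off : ℕ → K} (hn : σ.imem 0 0 = n)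
    (hM : σ.imem bkM 0 = M) (hM1 : 1 ≤ M) (hrel : σ.vmem vbRel = rel) (hoff : σ.vmem vbOff = off) :
    Run f timeProg σ (400 * (n + 1) * M) (fun σ' =>
      (∀ i ≤ n, σ'.imem bkBase i = i * M) ∧ σ'.imem bkStates 0 = (n + 1) * M ∧
      ∀ i ≤ n, ∀ a < M, σ'.vmem vbTau (i * M + a) = rel i + off a) := by
  refine Run.bind _ (run_multiplesProg (n := n + 1) (c := M) (by decide) (by decide) (by decide)
    (fun σ' hF => by simp [hF.i 0 rfl, hn]) (fun σ' hF => by simp [hF.i bkM rfl, hM]))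
    (fun σ₁ hF₁ h1 => Run.bind (T := 20) (fun σ₂ => σ₂.imem bkStates 0 = (n + 1) * M)
      (Run.block ?_) (fun σ₂ hF₂ h2 => Run.post (Run.forLoop (N := n + 1) (T := 40 * (M + 1))
        (fun i σ' => ∀ i' < i, ∀ a < M, σ'.vmem vbTau (i' * M + a) = rel i' + off a) rfl ?_ ?_ ?_)
        ?_) le_rfl) ?_
  · simp [hF₁.i 0 rfl, hn, hF₁.i bkM rfl, hM, h1 n (by omega), add_mul]
  · intro σ' hF
    simp [hF.i 0 rfl, hF₂.i 0 rfl, hF₁.i 0 rfl, hn]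
  · simp
  · intro i σ' hi hv hF h3
    refine (run_timeRowProg hv (by rw [hF.i bkM rfl, hF₂.i bkM rfl, hF₁.i bkM rfl, hM])
      (by rw [hF.i bkBase rfl, hF₂.i bkBase rfl, h1 i hi])
      (by rw [hF.v vbRel rfl, hF₂.v vbRel rfl, hF₁.v vbRel rfl, hrel])
      (by rw [hF.v vbOff rfl, hF₂.v vbOff rfl, hF₁.v vbOff rfl, hoff]) h3).post ?_
    intro σ'' _ h
    simpa only [vmem_setI] using h
  · intro σ' hF h3
    refine ⟨fun i hi => ?_, by rw [hF.i bkStates rfl, h2], fun i hi => h3 i (by omega)⟩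
    rw [hF.i bkBase rfl, hF₂.i bkBase rfl, h1 i (by omega)]
  · simp only [IExp.cost]
    nlinarith

/-- Stores `2 ^ s`. -/
def powProg : Prog :=
  .iset bkPow (.lit 0) (.lit 1) ;;
  forLoop bkV0 (.cell 0 (.lit 1)) (.iset bkPow (.lit 0) (.add (var bkPow) (var bkPow)))

/-- Stores `zeros h` for the tree nodes `h` of depth at most `s`. -/
def zerosProg : Prog :=
  forLoop bkV0 (var bkPow)
    (.iset bkZeros (.add (.add (var bkV0) (var bkV0)) (.lit 1))
      (.add (.cell bkZeros (var bkV0)) (.lit 1)) ;;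
     .iset bkZeros (.add (.add (var bkV0) (var bkV0)) (.lit 2)) (.cell bkZeros (var bkV0)))

/-- Stores the number `2 * 2 ^ s + 1` of coordinates and the tables that depend on it. -/
def treeProg : Prog :=
  powProg ;; .iset bkDim (.lit 0) (.add (.add (var bkPow) (var bkPow)) (.lit 1)) ;;
  zerosProg ;; multiplesProg bkBasisRow bkV0 bkAcc (.add (var bkDim) (.lit 2)) (var bkDim)

theorem run_powProg {σ : State K} {s : ℕ} (hs : σ.imem 0 1 = s) :
    Run f powProg σ (50 * 2 ^ s) (fun σ' => σ'.imem bkPow 0 = 2 ^ s) := by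
  have : s + 1 ≤ 2 ^ s := Nat.lt_two_pow_self
  refine Run.bind (T := 3) (fun σ₁ => σ₁.imem bkPow 0 = 1) (Run.block (by simp))
    (fun σ₁ hF h => Run.forLoop (N := s) (T := 10) (fun i σ' => σ'.imem bkPow 0 = 2 ^ i) rfl ?_
      (by simp [h]) ?_) (by simp; omega)
  · intro σ' hF'
    simp [hF'.i 0 rfl, hF.i 0 rfl, hs]
  · intro i σ' hi hv hF' hI
    refine Run.block ?_
    simp [hI, pow_succ]; omega

theorem run_zerosProg {σ : State K} {N : ℕ} (hN : σ.imem bkPow 0 = N)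
    (h0 : σ.imem bkZeros 0 = 0) :
    Run f zerosProg σ (50 * (N + 1)) (fun σ' =>
      ∀ h < 2 * N + 1, σ'.imem bkZeros h = zeros h) := by
  refine (Run.forLoop (N := N) (T := 30)
    (fun i σ' => ∀ h < 2 * i + 1, σ'.imem bkZeros h = zeros h) rfl ?_ ?_ ?_).le (by simp; omega)
  · intro σ' hF
    simp [hF.i bkPow rfl, hN]
  · simp [h0, zeros]
  · intro i σ' hi hv hF hI
    refine Run.block fun h hh => ?_
    have h1 := hI i (by omega)
    by_cases hh1 : h = i + i + 1
    · simp [hv, h1, hh1, zeros_left]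
    · by_cases hh2 : h = i + i + 2
      · have hne : i ≠ i + i + 1 := by omega
        simp [hv, h1, hh2, hne, zeros_right]
      · simp [hv, hh1, hh2]
        exact hI h (by omega)

theorem run_treeProg {σ : State K} {s : ℕ} (hs : σ.imem 0 1 = s) (h0 : σ.imem bkZeros 0 = 0) :
    Run f treeProg σ (500 * 2 ^ s) (fun σ' => σ'.imem bkPow 0 = 2 ^ s ∧
      σ'.imem bkDim 0 = 2 * 2 ^ s + 1 ∧ (∀ h < 2 * 2 ^ s + 1, σ'.imem bkZeros h = zeros h) ∧
      ∀ t < 2 * 2 ^ s + 3, σ'.imem bkBasisRow t = t * (2 * 2 ^ s + 1)) := by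
  refine Run.bind _ (run_powProg hs) (fun σ₁ hF₁ h1 => Run.bind (T := 10)
    (fun σ₂ => σ₂.imem bkDim 0 = 2 * 2 ^ s + 1) (Run.block (by simp [h1]; omega))
    (fun σ₂ hF₂ h2 => Run.bind _ (run_zerosProg (by rw [hF₂.i bkPow rfl, h1])
      (by rw [hF₂.i bkZeros rfl, hF₁.i bkZeros rfl, h0]))
    (fun σ₃ hF₃ h3 => Run.post (run_multiplesProg (n := 2 * 2 ^ s + 3) (c := 2 * 2 ^ s + 1)
      (by decide) (by decide) (by decide)
      (fun σ' hF => by simp [hF.i bkDim rfl, hF₃.i bkDim rfl, h2])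
      (fun σ' hF => by simp [hF.i bkDim rfl, hF₃.i bkDim rfl, h2])) ?_) le_rfl) le_rfl) ?_
  · intro σ' hF h4
    refine ⟨?_, ?_, ?_, h4⟩
    · rw [hF.i bkPow rfl, hF₃.i bkPow rfl, hF₂.i bkPow rfl, h1]
    · rw [hF.i bkDim rfl, hF₃.i bkDim rfl, h2]
    · rw [hF.i bkZeros rfl]; exact h3
  · have : 1 ≤ 2 ^ s := Nat.one_le_two_pow
    simp only [IExp.cost]; omega

theorem JobSet.numLen_len (I : JobSet K n) : numLen I.len n = I.numProc := by
  classical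
  unfold numLen JobSet.numProc
  have : ((Finset.range n).image I.len) = Finset.univ.image I.proc := by
    ext x
    simp only [Finset.mem_image, Finset.mem_range, Finset.mem_univ, true_and]
    constructor
    · rintro ⟨j, hj, rfl⟩
      exact ⟨⟨j, hj⟩, by simp [JobSet.len, hj]⟩
    · rintro ⟨j, rfl⟩
      exact ⟨j, j.2, by simp [JobSet.len]⟩
  rw [← this]
  congr!

/-- The state `i * M + a` stands for the time `rel i + off a`.  The tables `step` and `tau` are
correct for all states that are reached by at most `s` jobs. -/
structure IsStateTable (I : JobSet K n) (s M : ℕ) (step : ℕ → ℕ) (tau : ℕ → K) : Prop where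
  size : M = (s + 1) ^ I.numProc
  lt : ∀ l : List ℕ, (∀ i ∈ l, i < n) → l.length ≤ s → (l.map step).sum < M
  tau : ∀ i ≤ n, ∀ l : List ℕ, (∀ i ∈ l, i < n) → l.length ≤ s →
    tau (i * M + (l.map step).sum) = I.rel i + (l.map I.len).sum

/-- The memory contains the input and the tables that the dynamic program reads. -/
structure Prepared (I : JobSet K n) (s p M : ℕ) (step : ℕ → ℕ) (tau : ℕ → K) (σ : State K) :
    Prop where
  jobs : σ.imem 0 0 = n
  bound : σ.imem 0 1 = s
  rel : σ.vmem vbRel = I.rel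
  len : σ.vmem vbLen = I.len
  modulus : σ.imem bkP 0 = p
  mod : IsModTable p (σ.imem bkRow) (σ.imem bkMod) (σ.imem bkMul)
  step : σ.imem bkStep = step
  base : ∀ i ≤ n, σ.imem bkBase i = i * M
  states : σ.imem bkStates 0 = (n + 1) * M
  tau : σ.vmem vbTau = tau
  pow : σ.imem bkPow 0 = 2 ^ s
  dim : σ.imem bkDim 0 = 2 * 2 ^ s + 1
  zeros : ∀ h < 2 * 2 ^ s + 1, σ.imem bkZeros h = zeros h
  basisRow : ∀ t < 2 * 2 ^ s + 3, σ.imem bkBasisRow t = t * (2 * 2 ^ s + 1)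

theorem Prepared.frame {I : JobSet K n} {s p M : ℕ} {step : ℕ → ℕ} {tau : ℕ → K} {σ σ' : State K}
    {P : Prog} (h : Prepared I s p M step tau σ) (hF : Frame P σ σ')
    (hP : (∀ b ∈ [0, bkP, bkRow, bkMod, bkMul, bkStep, bkBase, bkStates, bkPow, bkDim, bkZeros,
      bkBasisRow], P.wI b = false) ∧ ∀ b ∈ [vbRel, vbLen, vbTau], P.wV b = false := by decide) :
    Prepared I s p M step tau σ' := by
  simp only [List.mem_cons, List.not_mem_nil, or_false, forall_eq_or_imp, forall_eq] at hP
  obtain ⟨⟨h0, h1, h2, h3, h4, h5, h6, h7, h8, h9, h10, h11⟩, k0, k1, k2⟩ := hP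
  constructor
  · rw [hF.i _ h0]; exact h.jobs
  · rw [hF.i _ h0]; exact h.bound
  · rw [hF.v _ k0]; exact h.rel
  · rw [hF.v _ k1]; exact h.len
  · rw [hF.i _ h1]; exact h.modulus
  · rw [hF.i _ h2, hF.i _ h3, hF.i _ h4]; exact h.mod
  · rw [hF.i _ h5]; exact h.step
  · rw [hF.i _ h6]; exact h.base
  · rw [hF.i _ h7]; exact h.states
  · rw [hF.v _ k2]; exact h.tau
  · rw [hF.i _ h8]; exact h.pow
  · rw [hF.i _ h9]; exact h.dim
  · rw [hF.i _ h10]; exact h.zeros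
  · rw [hF.i _ h11]; exact h.basisRow

/-- Computes all tables. -/
def prepareProg : Prog := fieldProg ;; offsetProg ;; timeProg ;; treeProg

theorem run_prepareProg (I : JobSet K n) (s : ℕ) :
    Run f prepareProg (I.input s)
      (2000 * (n + s + 1) ^ 2 + 400 * (n + 1) * (n + (s + 1) ^ I.numProc) +
        400 * (n + 1) * (s + 1) ^ I.numProc + 500 * 2 ^ s)
      (fun σ' => ∃ p M step tau, p.Prime ∧ n + s + 1 < p ∧ IsStateTable I s M step tau ∧
        Prepared I s p M step tau σ') := by
  have hn : (I.input s).imem 0 0 = n := by simp [JobSet.input]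
  have hs : (I.input s).imem 0 1 = s := by simp [JobSet.input]
  have hrel : (I.input s).vmem vbRel = I.rel := by funext j; simp [JobSet.input, JobSet.rel]
  have hlen : (I.input s).vmem vbLen = I.len := by funext j; simp [JobSet.input, JobSet.len]
  refine Run.bind _ (run_fieldProg hn hs (by simp [JobSet.input])) (fun σ₁ hF₁ ⟨h1, h2, h3⟩ =>
    Run.bind _ (run_offsetProg (n := n) (s := s) (len := I.len) (by rw [hF₁.i 0 rfl, hn])
      (by rw [hF₁.i 0 rfl, hs]) (by rw [hF₁.v vbLen rfl, hlen])
      (by rw [hF₁.v vbOff rfl]; simp [JobSet.input]))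
    (fun σ₂ hF₂ h4 => Run.bind _ (run_timeProg (n := n) (M := (s + 1) ^ I.numProc) (rel := I.rel)
      (by rw [hF₂.i 0 rfl, hF₁.i 0 rfl, hn]) (by rw [h4.size, I.numLen_len])
      (Nat.one_le_pow _ _ (by omega)) (by rw [hF₂.v vbRel rfl, hF₁.v vbRel rfl, hrel]) rfl)
    (fun σ₃ hF₃ ⟨h5, h6, h7⟩ => Run.post (run_treeProg (s := s)
      (by rw [hF₃.i 0 rfl, hF₂.i 0 rfl, hF₁.i 0 rfl, hs])
      (by rw [hF₃.i bkZeros rfl, hF₂.i bkZeros rfl, hF₁.i bkZeros rfl]; simp [JobSet.input]))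
    ?_) le_rfl) le_rfl) ?_
  · rintro σ₄ hF₄ ⟨h8, h9, h10, h11⟩
    have h4M := h4.size
    rw [I.numLen_len] at h4M
    refine ⟨σ₁.imem bkP 0, (s + 1) ^ I.numProc, σ₂.imem bkStep, σ₃.vmem vbTau, h1, h2,
      ⟨rfl, ?_, ?_⟩, ?_⟩
    · intro l hl hls; rw [← h4M]; exact h4.lt l hl hls
    · intro i hi l hl hls
      rw [h7 i hi _ (by rw [← h4M]; exact h4.lt l hl hls), h4.off l hl hls]
    · constructor
      · rw [hF₄.i 0 rfl, hF₃.i 0 rfl, hF₂.i 0 rfl, hF₁.i 0 rfl, hn]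
      · rw [hF₄.i 0 rfl, hF₃.i 0 rfl, hF₂.i 0 rfl, hF₁.i 0 rfl, hs]
      · rw [hF₄.v 0 rfl, hF₃.v 0 rfl, hF₂.v 0 rfl, hF₁.v 0 rfl, hrel]
      · rw [hF₄.v 1 rfl, hF₃.v 1 rfl, hF₂.v 1 rfl, hF₁.v 1 rfl, hlen]
      · rw [hF₄.i bkP rfl, hF₃.i bkP rfl, hF₂.i bkP rfl]
      · rw [hF₄.i bkRow rfl, hF₃.i bkRow rfl, hF₂.i bkRow rfl, hF₄.i bkMod rfl, hF₃.i bkMod rfl,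
          hF₂.i bkMod rfl, hF₄.i bkMul rfl, hF₃.i bkMul rfl, hF₂.i bkMul rfl]
        exact h3
      · rw [hF₄.i bkStep rfl, hF₃.i bkStep rfl]
      · rw [hF₄.i bkBase rfl]; exact h5
      · rw [hF₄.i bkStates rfl]; exact h6
      · rw [hF₄.v vbTau rfl]
      · exact h8
      · exact h9
      · exact h10
      · exact h11
  · rw [I.numLen_len]; omega

end Tables

/-! ### The vector of a job set -/

section Vectors

/-- The first `k` jobs of the linked list that starts at the entry `e`. -/
def chain (job nxt : ℕ → ℕ) : ℕ → ℕ → List ℕ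
  | 0, _ => []
  | k + 1, e => job e :: chain job nxt k (nxt e)

theorem length_chain (job nxt : ℕ → ℕ) (k e : ℕ) : (chain job nxt k e).length = k := by
  induction k generalizing e with
  | zero => rfl
  | succ k ih => simp [chain, ih]

theorem chain_succ_eq_append (job nxt : ℕ → ℕ) (k e : ℕ) :
    chain job nxt (k + 1) e = chain job nxt k e ++ [job (nxt^[k] e)] := by
  induction k generalizing e with
  | zero => rfl
  | succ k ih => rw [chain, ih]; rfl

theorem chain_congr {job nxt job' nxt' : ℕ → ℕ} {cnt : ℕ} (hj : ∀ e < cnt, job' e = job e)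
    (hn : ∀ e < cnt, nxt' e = nxt e) (hlt : ∀ e < cnt, nxt e < cnt) {k e : ℕ} (he : e < cnt) :
    chain job' nxt' k e = chain job nxt k e := by
  induction k generalizing e with
  | zero => rfl
  | succ k ih => rw [chain, chain, hj e he, hn e he, ih (hlt e he)]

theorem lt_of_mem_chain {job nxt : ℕ → ℕ} {cnt m : ℕ} (hj : ∀ e < cnt, job e < m)
    (hlt : ∀ e < cnt, nxt e < cnt) {k e : ℕ} (he : e < cnt) :
    ∀ x ∈ chain job nxt k e, x < m := by
  induction k generalizing e with
  | zero => simp [chain]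
  | succ k ih =>
    intro x hx
    rcases List.mem_cons.1 hx with rfl | hx
    · exact hj e he
    · exact ih (hlt e he) x hx

/-- The vector of monomials that represents a list of jobs. -/
def jobVec (p s : ℕ) [Fact p.Prime] (l : List ℕ) : ℕ → ZMod p :=
  mon (rootValues s (l.map (Nat.cast : ℕ → ZMod p)))

/-- The linear functional with coefficients `c` on vectors with `D` coordinates. -/
def lin {p : ℕ} (D : ℕ) (c g : ℕ → ZMod p) : ZMod p := ∑ h ∈ Finset.range D, c h * g h

theorem rootValues_perm {F : Type} [Field F] {s : ℕ} {Y Y' : List F} (h : Y.Perm Y') :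
    rootValues s Y = rootValues s Y' := by
  funext t
  simp only [rootValues, (h.map _).prod_eq]

theorem rootValues_cons {F : Type} [Field F] {s t : ℕ} (y : F) (Y : List F) (ht : t ≤ s) :
    rootValues s (y :: Y) t = rootValues s Y t * (t - y) := by
  simp [rootValues, ht, mul_comm]

variable {K : Type*} [AddCommGroup K] [LinearOrder K] {n : ℕ} {f : ℕ → K → K}
  {I : JobSet K n} {s p M : ℕ} {step : ℕ → ℕ} {tau : ℕ → K}

/-- Multiplication modulo `p` by table look-up. -/
abbrev mulExp (x y : IExp) : IExp := .cell bkMul (.add (.cell bkRow x) y)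

/-- Subtraction modulo `p` by table look-up. -/
abbrev subExp (x y : IExp) : IExp := .cell bkMod (.add x (.sub (var bkP) y))

theorem Prepared.eval_mulExp {σ : State K} (hσ : Prepared I s p M step tau σ) {x y : IExp}
    (hx : x.eval σ < p) (hy : y.eval σ < p) :
    (mulExp x y).eval σ < p ∧
      (((mulExp x y).eval σ : ℕ) : ZMod p) = (x.eval σ : ℕ) * (y.eval σ : ℕ) := by
  have h : (mulExp x y).eval σ = x.eval σ * y.eval σ % p := by
    simp only [IExp.eval, hσ.mod.row _ hx, hσ.mod.mul _ hx _ hy]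
  rw [h]
  exact ⟨Nat.mod_lt _ (by omega), by simp⟩

theorem Prepared.eval_subExp {σ : State K} (hσ : Prepared I s p M step tau σ) {x y : IExp}
    (hx : x.eval σ < p) (hy : y.eval σ < p) :
    (subExp x y).eval σ < p ∧
      (((subExp x y).eval σ : ℕ) : ZMod p) = (x.eval σ : ℕ) - (y.eval σ : ℕ) := by
  have h : (subExp x y).eval σ = (x.eval σ + (p - y.eval σ)) % p := by
    simp only [IExp.eval, hσ.modulus]
    exact hσ.mod.md _ (by omega)
  rw [h]
  refine ⟨Nat.mod_lt _ (by omega), ?_⟩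
  rw [ZMod.natCast_mod, Nat.cast_add, Nat.cast_sub hy.le, ZMod.natCast_self]
  ring

/-- Sets `bkDup` if the job `bkV3` is among the first `bkV0` jobs of the list `bkE`. -/
def dupProg : Prog :=
  .iset bkDup (.lit 0) (.lit 0) ;; .iset bkCh (.lit 0) (var bkE) ;;
  forLoop bkV5 (var bkV0)
    (.cond (.conj (.ile (.cell bkJob (var bkCh)) (var bkV3))
        (.ile (var bkV3) (.cell bkJob (var bkCh))))
      (.iset bkDup (.lit 0) (.lit 1)) .skip ;;
     .iset bkCh (.lit 0) (.cell bkNxt (var bkCh)))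

theorem run_dupProg {σ : State K} {k j e : ℕ} {job nxt : ℕ → ℕ} (hk : σ.imem bkV0 0 = k)
    (hj : σ.imem bkV3 0 = j) (he : σ.imem bkE 0 = e) (hjob : σ.imem bkJob = job)
    (hnxt : σ.imem bkNxt = nxt) :
    Run f dupProg σ (60 * (k + 1)) (fun σ' => σ'.imem bkDup 0 = 0 ↔ j ∉ chain job nxt k e) := by
  refine Run.bind (T := 3) (fun σ₁ => σ₁.imem bkDup 0 = 0) (Run.block (by simp))
    (fun σ₁ hF₁ h1 => Run.bind (T := 5) (fun σ₂ => σ₂.imem bkCh 0 = e)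
      (Run.block (by simp [hF₁.i bkE rfl, he]))
      (fun σ₂ hF₂ h2 => Run.post (Run.forLoop (N := k) (T := 30) (fun i σ' =>
        σ'.imem bkCh 0 = nxt^[i] e ∧ (σ'.imem bkDup 0 = 0 ↔ j ∉ chain job nxt i e)) rfl ?_ ?_ ?_)
        fun _ _ h => h.2) le_rfl) (by simp; omega)
  · intro σ' hF
    simp [hF.i bkV0 rfl, hF₂.i bkV0 rfl, hF₁.i bkV0 rfl, hk]
  · simp [h2, hF₂.i bkDup rfl, h1, chain]
  · rintro i σ' hi hv hF ⟨h3, h4⟩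
    have h5 : σ'.imem bkV3 0 = j := by rw [hF.i bkV3 rfl, hF₂.i bkV3 rfl, hF₁.i bkV3 rfl, hj]
    have h6 : σ'.imem bkJob = job := by rw [hF.i bkJob rfl, hF₂.i bkJob rfl, hF₁.i bkJob rfl, hjob]
    have h7 : σ'.imem bkNxt = nxt := by rw [hF.i bkNxt rfl, hF₂.i bkNxt rfl, hF₁.i bkNxt rfl, hnxt]
    refine Run.block ⟨?_, ?_⟩
    · simp [h3, h7, ← Function.iterate_succ_apply' nxt]
    · rw [chain_succ_eq_append]
      by_cases hc : job (nxt^[i] e) = j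
      · simp [h3, h5, h6, hc]
      · have hc' : ¬ (job (nxt^[i] e) ≤ j ∧ j ≤ job (nxt^[i] e)) := fun h =>
          hc (le_antisymm h.1 h.2)
        simp [h3, h5, h6, hc', h4, Ne.symm hc]

/-- Multiplies the values by the factor of the job at the entry `bkCh`. -/
def valStepProg : Prog :=
  forLoop bkV6 (.add (.cell 0 (.lit 1)) (.lit 1))
    (.iset bkVal (var bkV6)
      (mulExp (.cell bkVal (var bkV6)) (subExp (var bkV6) (.cell bkJob (var bkCh)))))

/-- Computes the values at `0, …, s` of the polynomial whose roots are the job `bkV3` and the first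
`bkV0` jobs of the list `bkE`. -/
def valProg : Prog :=
  forLoop bkV6 (.add (.cell 0 (.lit 1)) (.lit 1))
    (.iset bkVal (var bkV6) (subExp (var bkV6) (var bkV3))) ;;
  .iset bkCh (.lit 0) (var bkE) ;;
  forLoop bkV5 (var bkV0) (valStepProg ;; .iset bkCh (.lit 0) (.cell bkNxt (var bkCh)))

/-- `val` holds the residues of `g` on the numbers below `N`. -/
def Holds (p N : ℕ) (val : ℕ → ℕ) (g : ℕ → ZMod p) : Prop :=
  ∀ t < N, val t < p ∧ ((val t : ℕ) : ZMod p) = g t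

variable [Fact p.Prime]

theorem run_valStepProg {σ : State K} (hσ : Prepared I s p M step tau σ) (hp : n + s + 1 < p)
    {x : ℕ} {Y : List (ZMod p)} (hx : σ.imem bkJob (σ.imem bkCh 0) = x) (hxp : x < p)
    (hY : Holds p (s + 1) (σ.imem bkVal) (rootValues s Y)) :
    Run f valStepProg σ (60 * (s + 2)) (fun σ' =>
      Holds p (s + 1) (σ'.imem bkVal) (rootValues s ((x : ZMod p) :: Y))) := by
  refine Run.mono (Run.forLoop (N := s + 1) (T := 30) (fun i σ' => ∀ t < s + 1,
      σ'.imem bkVal t < p ∧ ((σ'.imem bkVal t : ℕ) : ZMod p) =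
        if t < i then rootValues s ((x : ZMod p) :: Y) t else rootValues s Y t) rfl ?_ ?_ ?_)
      (by simp; omega) ?_
  · intro σ' hF
    simp [(hσ.frame hF).bound]
  · simpa [Holds, Nat.lt_succ_iff] using hY
  · intro i σ' hi hv hF hI
    have h1 : σ'.imem bkJob (σ'.imem bkCh 0) = x := by rw [hF.i bkJob rfl, hF.i bkCh rfl, hx]
    have hσ' := hσ.frame hF
    have h2 := hσ'.eval_subExp (x := var bkV6) (y := .cell bkJob (var bkCh))
      (by simp [hv]; omega) (by simp [h1]; omega)
    have h3 := hσ'.eval_mulExp (x := .cell bkVal (var bkV6))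
      (y := subExp (var bkV6) (.cell bkJob (var bkCh))) (by simpa [hv] using (hI i hi).1) h2.1
    rw [h2.2] at h3
    simp only [IExp.eval, hv, h1, (hI i hi).2, lt_irrefl, if_false] at h3
    refine Run.block fun t ht => ?_
    by_cases hti : t = i
    · subst hti
      have h4 := h3.2
      rw [← rootValues_cons _ _ (by omega)] at h4
      simpa [hv, h1, h4] using h3.1
    · have h4 := hI t ht
      have h5 : t < i + 1 ↔ t < i := by omega
      simp only [h5]
      simpa [hv, hti] using h4
  · intro σ' hF hI t ht
    have := hI t ht
    rwa [if_pos ht] at this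

theorem run_valProg {σ : State K} (hσ : Prepared I s p M step tau σ) (hp : n + s + 1 < p)
    {k j e : ℕ} {job nxt : ℕ → ℕ} (hk : σ.imem bkV0 0 = k)
    (hj : σ.imem bkV3 0 = j) (he : σ.imem bkE 0 = e) (hjob : σ.imem bkJob = job)
    (hnxt : σ.imem bkNxt = nxt) (hjn : j ≤ n) (hle : ∀ x ∈ chain job nxt k e, x ≤ n) :
    Run f valProg σ (100 * (s + 2) * (k + 2)) (fun σ' => Holds p (s + 1) (σ'.imem bkVal)
      (rootValues s ((j :: chain job nxt k e).map (Nat.cast : ℕ → ZMod p)))) := by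
  refine Run.bind (fun σ₁ => Holds p (s + 1) (σ₁.imem bkVal) (rootValues s [(j : ZMod p)]))
    (Run.forLoop (N := s + 1) (T := 30) (fun i σ' =>
      Holds p i (σ'.imem bkVal) (rootValues s [(j : ZMod p)])) rfl ?_ ?_ ?_)
    (fun σ₁ hF₁ h1 => Run.bind (T := 5) (fun σ₂ => σ₂.imem bkCh 0 = e)
      (Run.block (by simp [hF₁.i bkE rfl, he]))
      (fun σ₂ hF₂ h2 => Run.post (Run.forLoop (N := k) (T := 60 * (s + 2) + 10) (fun i σ' =>
        σ'.imem bkCh 0 = nxt^[i] e ∧ Holds p (s + 1) (σ'.imem bkVal)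
          (rootValues s ((j :: chain job nxt i e).map (Nat.cast : ℕ → ZMod p)))) rfl ?_ ?_ ?_)
        fun _ _ h => h.2) le_rfl) ?_
  · intro σ' hF
    simp [(hσ.frame hF).bound]
  · simp [Holds]
  · intro i σ' hi hv hF hI
    have h1 : σ'.imem bkV3 0 = j := by rw [hF.i bkV3 rfl, hj]
    have h2 := (hσ.frame hF).eval_subExp (x := var bkV6) (y := var bkV3)
      (by simp [hv]; omega) (by simp [h1]; omega)
    refine Run.block fun t ht => ?_
    by_cases hti : t = i
    · subst hti
      simp [hv, h1] at h2 ⊢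
      simpa [rootValues, Nat.lt_succ_iff.1 hi] using h2
    · simpa [hv, hti] using hI t (by omega)
  · intro σ' hF
    simp [hF.i bkV0 rfl, hF₂.i bkV0 rfl, hF₁.i bkV0 rfl, hk]
  · simp [h2, hF₂.i bkVal rfl, chain, h1]
  · rintro i σ' hi hv hF ⟨h3, h4⟩
    have h6 : σ'.imem bkJob = job := by rw [hF.i bkJob rfl, hF₂.i bkJob rfl, hF₁.i bkJob rfl, hjob]
    have h7 : σ'.imem bkNxt = nxt := by rw [hF.i bkNxt rfl, hF₂.i bkNxt rfl, hF₁.i bkNxt rfl, hnxt]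
    have h8 : job (nxt^[i] e) ≤ n := by
      refine hle _ ?_
      have : ∀ d, job (nxt^[i] e) ∈ chain job nxt (i + 1 + d) e := by
        intro d
        induction d with
        | zero => simp [chain_succ_eq_append]
        | succ d ih => rw [← add_assoc, chain_succ_eq_append]; exact List.mem_append_left _ ih
      have := this (k - (i + 1))
      rwa [show i + 1 + (k - (i + 1)) = k by omega] at this
    refine Run.bind _ (run_valStepProg (((hσ.frame hF₁).frame hF₂).frame hF) hp
      (x := job (nxt^[i] e)) (by rw [h6, h3]) (by omega) h4)
      (fun σ₃ hF₃ h5 => Run.block (T := 10) ⟨?_, ?_⟩) le_rfl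
    · simp [hF₃.i bkCh rfl, h3, hF₃.i bkNxt rfl, h7, ← Function.iterate_succ_apply' nxt]
    · have hperm : ((j :: chain job nxt (i + 1) e).map (Nat.cast : ℕ → ZMod p)).Perm
          ((job (nxt^[i] e) : ZMod p) :: (j :: chain job nxt i e).map (Nat.cast : ℕ → ZMod p)) := by
        rw [chain_succ_eq_append, ← List.map_cons]
        refine List.Perm.map _ ?_
        rw [← List.cons_append]
        exact List.perm_append_singleton _ _
      rw [rootValues_perm hperm]
      simpa using h5
  · simp only [IExp.cost]; nlinarith

/-- Computes the vector of monomials from the values. -/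
def vecProg : Prog :=
  .iset bkVec (.lit 0) (.lit 1) ;;
  forLoop bkV5 (var bkPow)
    (.iset bkVec (.add (.add (var bkV5) (var bkV5)) (.lit 1)) (.cell bkVec (var bkV5)) ;;
     .iset bkVec (.add (.add (var bkV5) (var bkV5)) (.lit 2))
      (mulExp (.cell bkVec (var bkV5)) (.cell bkVal (.cell bkZeros (var bkV5)))))

theorem run_vecProg {σ : State K} (hσ : Prepared I s p M step tau σ)
    {v : ℕ → ZMod p} (hv : Holds p (s + 1) (σ.imem bkVal) v) :
    Run f vecProg σ (60 * (2 ^ s + 1)) (fun σ' =>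
      Holds p (2 * 2 ^ s + 1) (σ'.imem bkVec) (mon v)) := by
  have hp1 : 1 < p := (Fact.out : p.Prime).one_lt
  refine Run.bind (T := 3) (fun σ₁ => σ₁.imem bkVec 0 = 1) (Run.block (by simp))
    (fun σ₁ hF₁ h1 => Run.forLoop (N := 2 ^ s) (T := 35) (fun i σ' =>
      Holds p (2 * i + 1) (σ'.imem bkVec) (mon v)) rfl ?_ ?_ ?_) (by
      have := Nat.one_le_two_pow (n := s)
      simp only [IExp.cost]; linarith)
  · intro σ' hF
    simp [((hσ.frame hF₁).frame hF).pow]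
  · intro t ht
    obtain rfl : t = 0 := by simpa using ht
    simp [h1, mon_zero, hp1]
  · intro i σ' hi hvi hF hI
    have hσ' := (hσ.frame hF₁).frame hF
    have hz : σ'.imem bkZeros i = zeros i := hσ'.zeros i (by omega)
    have hval : σ'.imem bkVal = σ.imem bkVal := by rw [hF.i bkVal rfl, hF₁.i bkVal rfl]
    have hzs := hv (zeros i) (Nat.lt_succ_of_le (zeros_le_of_lt hi))
    have h2 := hI i (by omega)
    have hm := hσ'.eval_mulExp (x := .cell bkVec (var bkV5))
      (y := .cell bkVal (.cell bkZeros (var bkV5))) (by simpa [hvi] using h2.1)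
      (by simpa [hvi, hz, hval] using hzs.1)
    simp only [IExp.eval, hvi, hz, hval, h2.2, hzs.2] at hm
    rw [← mon_right] at hm
    refine Run.block fun t ht => ?_
    by_cases ht1 : t = i + i + 1
    · simpa [hvi, ht1, mon_left] using h2
    · by_cases ht2 : t = i + i + 2
      · have hne : i ≠ i + i + 1 := by omega
        simpa [hvi, ht2, hne, hz, hval] using hm
      · simpa [hvi, ht1, ht2] using hI t (by omega)

end Vectors

/-! ### Elimination -/

section Elimination

/-- `bas 0, …, bas (r - 1)` are vectors of residues in echelon form: each one is nonzero at its
pivot, and vanishes at the pivots of its predecessors. -/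
structure IsEchelon (p D r : ℕ) (bas : ℕ → ℕ → ℕ) (piv : ℕ → ℕ) : Prop where
  lt : ∀ i < r, ∀ h < D, bas i h < p
  piv_lt : ∀ i < r, piv i < D
  ne_zero : ∀ i < r, bas i (piv i) ≠ 0
  eq_zero : ∀ i < r, ∀ i' < i, bas i (piv i') = 0

/-- The pivots are distinct. -/
theorem IsEchelon.le {p D r : ℕ} {bas : ℕ → ℕ → ℕ} {piv : ℕ → ℕ} (h : IsEchelon p D r bas piv) :
    r ≤ D := by
  have hinj : Set.InjOn piv (Finset.range r : Set ℕ) := by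
    have key : ∀ i < r, ∀ i' < i, piv i ≠ piv i' := fun i hi i' hi' he =>
      h.ne_zero i hi (he ▸ h.eq_zero i hi i' hi')
    intro a ha b hb hab
    simp only [Finset.coe_range, Set.mem_Iio] at ha hb
    rcases lt_trichotomy a b with hlt | heq | hlt
    · exact absurd hab.symm (key b hb a hlt)
    · exact heq
    · exact absurd hab (key a ha b hlt)
  have := Finset.card_le_card_of_injOn (s := Finset.range r) (t := Finset.range D) piv
    (fun i hi => Finset.mem_coe.2 (Finset.mem_range.2 (h.piv_lt i (Finset.mem_range.1 hi)))) hinj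
  simpa using this

theorem lin_sub {p : ℕ} (D : ℕ) (c g g' : ℕ → ZMod p) (a b : ZMod p) :
    lin D c (fun h => a * g h - b * g' h) = a * lin D c g - b * lin D c g' := by
  simp only [lin, Finset.mul_sum, ← Finset.sum_sub_distrib]
  exact Finset.sum_congr rfl fun h _ => by ring

theorem lin_congr {p : ℕ} {D : ℕ} {c g g' : ℕ → ZMod p} (h : ∀ x < D, g x = g' x) :
    lin D c g = lin D c g' :=
  Finset.sum_congr rfl fun x hx => by rw [h x (Finset.mem_range.1 hx)]

/-- A vector `g` is spanned by `r` vectors if every linear functional that vanishes on them vanishes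
on `g`. -/
def Spanned (p D r : ℕ) (bas : ℕ → ℕ → ℕ) (g : ℕ → ZMod p) : Prop :=
  ∀ c : ℕ → ZMod p, (∀ i < r, lin D c (fun h => (bas i h : ZMod p)) = 0) → lin D c g = 0

/-- The vector `u` with the pivot `q` extends the echelon form, and is spanned by it together
with `g`. -/
structure Extends (p D r : ℕ) (bas : ℕ → ℕ → ℕ) (piv : ℕ → ℕ) (g : ℕ → ZMod p) (u : ℕ → ℕ)
    (q : ℕ) : Prop where
  lt : ∀ h < D, u h < p
  piv_lt : q < D
  ne_zero : u q ≠ 0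
  eq_zero : ∀ i < r, u (piv i) = 0
  spanned : ∀ c : ℕ → ZMod p, (∀ i < r, lin D c (fun h => (bas i h : ZMod p)) = 0) →
    lin D c g = 0 → lin D c (fun h => (u h : ZMod p)) = 0

variable {K : Type*} [AddCommGroup K] [LinearOrder K] {n : ℕ} {f : ℕ → K → K}
  {I : JobSet K n} {s p M : ℕ} {step : ℕ → ℕ} {tau : ℕ → K}

/-- Subtracts `bkB` times the row `bkV5` of the echelon form from `bkA` times the vector. -/
def reduceRowProg : Prog :=
  forLoop bkV6 (var bkDim)
    (.iset bkVec (var bkV6)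
      (subExp (mulExp (var bkA) (.cell bkVec (var bkV6)))
        (mulExp (var bkB) (.cell bkBas (.add (.cell bkBasisRow (var bkV5)) (var bkV6))))))

/-- Reduces the vector by the rows of the echelon form. -/
def reduceProg : Prog :=
  forLoop bkV5 (var bkRank)
    (.iset bkA (.lit 0)
        (.cell bkBas (.add (.cell bkBasisRow (var bkV5)) (.cell bkPiv (var bkV5)))) ;;
     .iset bkB (.lit 0) (.cell bkVec (.cell bkPiv (var bkV5))) ;; reduceRowProg)

theorem run_reduceRowProg {σ : State K} (hσ : Prepared I s p M step tau σ) {i a b : ℕ}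
    {row : ℕ → ℕ} {g : ℕ → ZMod p} (hi : σ.imem bkV5 0 = i) (his : i < 2 * 2 ^ s + 1)
    (ha : σ.imem bkA 0 = a) (hap : a < p) (hb : σ.imem bkB 0 = b) (hbp : b < p)
    (hrow : ∀ h < 2 * 2 ^ s + 1, σ.imem bkBas (i * (2 * 2 ^ s + 1) + h) = row h)
    (hrowp : ∀ h < 2 * 2 ^ s + 1, row h < p)
    (hg : Holds p (2 * 2 ^ s + 1) (σ.imem bkVec) g) :
    Run f reduceRowProg σ (100 * (2 * 2 ^ s + 1)) (fun σ' =>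
      Holds p (2 * 2 ^ s + 1) (σ'.imem bkVec) fun h => a * g h - b * (row h : ZMod p)) := by
  obtain ⟨D, hD⟩ : ∃ D, 2 * 2 ^ s + 1 = D := ⟨_, rfl⟩
  simp only [hD] at hi his hrow hrowp hg ⊢
  refine Run.mono (Run.forLoop (N := D) (T := 30) (fun b' σ' => Holds p D (σ'.imem bkVec)
      (fun h => if h < b' then a * g h - b * (row h : ZMod p) else g h)) rfl ?_ ?_ ?_)
      (by simp only [IExp.cost]; omega) ?_
  · intro σ' hF
    simp [(hσ.frame hF).dim, hD]
  · simpa using hg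
  · intro h σ' hh hv hF hI
    have hσ' := hσ.frame hF
    have e1 : σ'.imem bkV5 0 = i := by rw [hF.i bkV5 rfl, hi]
    have e2 : σ'.imem bkA 0 = a := by rw [hF.i bkA rfl, ha]
    have e3 : σ'.imem bkB 0 = b := by rw [hF.i bkB rfl, hb]
    have e4 : σ'.imem bkBas (i * D + h) = row h := by rw [hF.i bkBas rfl, hrow h hh]
    have e5 : σ'.imem bkBasisRow i = i * D := by
      have := hσ'.basisRow i (by omega)
      rwa [hD] at this
    have hIh := hI h hh
    simp only [lt_irrefl, if_false] at hIh
    have m1 := hσ'.eval_mulExp (x := var bkA) (y := .cell bkVec (var bkV6)) (by simp [e2, hap])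
      (by simpa [hv] using hIh.1)
    have m2 := hσ'.eval_mulExp (x := var bkB)
      (y := .cell bkBas (.add (.cell bkBasisRow (var bkV5)) (var bkV6))) (by simp [e3, hbp])
      (by simpa [hv, e1, e5, e4] using hrowp h hh)
    have m3 := hσ'.eval_subExp m1.1 m2.1
    rw [m1.2, m2.2] at m3
    refine Run.block fun t ht => ?_
    by_cases hth : t = h
    · subst hth
      simp only [IExp.eval, hv, e1, e2, e3, e4, e5, hIh.2] at m3
      simpa [hv, e1, e2, e3, e4, e5] using m3
    · have h5 : t < h + 1 ↔ t < h := by omega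
      have := hI t ht
      simp only [h5]
      simpa [hv, hth] using this
  · intro σ' hF hI t ht
    have := hI t ht
    simpa [ht] using this

/-- Looks for a nonzero coordinate of the vector. -/
def pivotProg : Prog :=
  .iset bkNz (.lit 0) (.lit 0) ;;
  forLoop bkV5 (var bkDim)
    (.cond (.ile (.lit 1) (.cell bkVec (var bkV5)))
      (.iset bkNz (.lit 0) (.lit 1) ;; .iset bkPv (.lit 0) (var bkV5)) .skip)

theorem run_pivotProg {σ : State K} (hσ : Prepared I s p M step tau σ) :
    Run f pivotProg σ (60 * (2 * 2 ^ s + 2)) (fun σ' =>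
      (σ'.imem bkNz 0 = 0 ∧ ∀ h < 2 * 2 ^ s + 1, σ'.imem bkVec h = 0) ∨
      (σ'.imem bkNz 0 = 1 ∧ σ'.imem bkPv 0 < 2 * 2 ^ s + 1 ∧
        σ'.imem bkVec (σ'.imem bkPv 0) ≠ 0)) := by
  refine Run.bind (T := 3) (fun σ₁ => σ₁.imem bkNz 0 = 0) (Run.block (by simp))
    (fun σ₁ hF₁ h1 => Run.forLoop (N := 2 * 2 ^ s + 1) (T := 25) (fun i σ' =>
      (σ'.imem bkNz 0 = 0 ∧ ∀ h < i, σ'.imem bkVec h = 0) ∨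
      (σ'.imem bkNz 0 = 1 ∧ σ'.imem bkPv 0 < 2 * 2 ^ s + 1 ∧
        σ'.imem bkVec (σ'.imem bkPv 0) ≠ 0)) rfl ?_ ?_ ?_) (by simp only [IExp.cost]; omega)
  · intro σ' hF
    simp [((hσ.frame hF₁).frame hF).dim]
  · simp [h1]
  · intro i σ' hi hv hF hI
    refine Run.block ?_
    by_cases hc : σ'.imem bkVec i = 0
    · simp [hv, hc]
      rcases hI with ⟨h2, h3⟩ | h2
      · refine Or.inl ⟨h2, fun h' hh' => ?_⟩
        rcases Nat.lt_or_eq_of_le hh' with hh' | rfl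
        · exact h3 h' hh'
        · exact hc
      · exact Or.inr ⟨h2.1, Nat.lt_succ_iff.1 h2.2.1, h2.2.2⟩
    · right
      have hc' : 1 ≤ σ'.imem bkVec i := Nat.one_le_iff_ne_zero.2 hc
      simp [hv, hc', hi, hc]

variable [Fact p.Prime]

/-- The machine cannot divide, so that the vector is multiplied by each pivot entry before a
multiple of the row is subtracted; on functionals that vanish on all rows, this changes the vector
only by a factor `α ≠ 0`. -/
theorem run_reduceProg {σ : State K} (hσ : Prepared I s p M step tau σ) {r : ℕ}
    {bas : ℕ → ℕ → ℕ} {piv : ℕ → ℕ} {g : ℕ → ZMod p} (hr : σ.imem bkRank 0 = r)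
    (hech : IsEchelon p (2 * 2 ^ s + 1) r bas piv)
    (hbas : ∀ i < r, ∀ h < 2 * 2 ^ s + 1, σ.imem bkBas (i * (2 * 2 ^ s + 1) + h) = bas i h)
    (hpiv : ∀ i < r, σ.imem bkPiv i = piv i)
    (hg : Holds p (2 * 2 ^ s + 1) (σ.imem bkVec) g) :
    Run f reduceProg σ (200 * (2 * 2 ^ s + 2) ^ 2) (fun σ' => ∃ u : ℕ → ZMod p,
      Holds p (2 * 2 ^ s + 1) (σ'.imem bkVec) u ∧ (∀ i < r, u (piv i) = 0) ∧
      ∃ α : ZMod p, α ≠ 0 ∧ ∀ c : ℕ → ZMod p,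
        (∀ i < r, lin (2 * 2 ^ s + 1) c (fun h => (bas i h : ZMod p)) = 0) →
        lin (2 * 2 ^ s + 1) c u = α * lin (2 * 2 ^ s + 1) c g) := by
  obtain ⟨D, hD⟩ : ∃ D, 2 * 2 ^ s + 1 = D := ⟨_, rfl⟩
  have hrD := hech.le
  refine Run.mono (Run.forLoop (N := r) (T := 100 * D + 50) (fun i σ' => ∃ u : ℕ → ZMod p,
      Holds p (2 * 2 ^ s + 1) (σ'.imem bkVec) u ∧ (∀ i' < i, u (piv i') = 0) ∧
      ∃ α : ZMod p, α ≠ 0 ∧ ∀ c : ℕ → ZMod p,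
        (∀ i < r, lin (2 * 2 ^ s + 1) c (fun h => (bas i h : ZMod p)) = 0) →
        lin (2 * 2 ^ s + 1) c u = α * lin (2 * 2 ^ s + 1) c g) rfl ?_ ?_ ?_) ?_
      fun _ _ h => h
  · intro σ' hF
    simp [hF.i bkRank rfl, hr]
  · exact ⟨g, by simpa using hg, by simp, 1, one_ne_zero, by simp⟩
  · rintro i σ' hi hv hF ⟨u, hu, hz, α, hα, hlin⟩
    have hσ' := hσ.frame hF
    have e1 : σ'.imem bkPiv i = piv i := by rw [hF.i bkPiv rfl, hpiv i hi]
    have e2 : ∀ h < 2 * 2 ^ s + 1, σ'.imem bkBas (i * (2 * 2 ^ s + 1) + h) = bas i h :=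
      fun h hh => by rw [hF.i bkBas rfl, hbas i hi h hh]
    have e3 := hσ'.basisRow i (by omega)
    have hpi := hech.piv_lt i hi
    refine Run.bind (T := 20) (fun σ₁ => σ₁.imem bkA 0 = bas i (piv i)) (Run.block ?_)
      (fun σ₁ hF₁ h1 => Run.bind (T := 20) (fun σ₂ => σ₂.imem bkB 0 = σ'.imem bkVec (piv i))
        (Run.block ?_) (fun σ₂ hF₂ h2 => Run.post (run_reduceRowProg
          (a := bas i (piv i)) (b := σ'.imem bkVec (piv i)) (i := i) (row := bas i) (g := u)
          ((hσ'.frame hF₁).frame hF₂) ?_ (by omega) ?_ (hech.lt i hi _ hpi) h2 (hu _ hpi).1 ?_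
          (hech.lt i hi) ?_) ?_) le_rfl) (by omega)
    · simp [hv, e1, e2 _ hpi, e3]
    · simp [hF₁.i bkVec rfl, hF₁.i bkPiv rfl, hF₁.i bkV5 rfl, hv, e1]
    · rw [hF₂.i bkV5 rfl, hF₁.i bkV5 rfl, hv]
    · rw [hF₂.i bkA rfl, h1]
    · rw [hF₂.i bkBas rfl, hF₁.i bkBas rfl]; exact e2
    · rw [hF₂.i bkVec rfl, hF₁.i bkVec rfl]; exact hu
    · intro σ₃ hF₃ h3
      refine ⟨_, by simpa using h3, ?_, (bas i (piv i) : ZMod p) * α, ?_, ?_⟩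
      · intro i' hi'
        rcases Nat.lt_succ_iff_lt_or_eq.1 hi' with hi' | rfl
        · simp [hz i' hi', hech.eq_zero i hi i' hi']
        · simp only [(hu _ hpi).2]; ring
      · refine mul_ne_zero ?_ hα
        rw [Ne, ZMod.natCast_eq_zero_iff]
        exact Nat.not_dvd_of_pos_of_lt (Nat.pos_of_ne_zero (hech.ne_zero i hi)) (hech.lt i hi _ hpi)
      · intro c hc
        rw [lin_sub, hc i hi, hlin c hc]; ring
  · rw [hD] at hrD
    simp only [IExp.cost]
    have : 2 * 2 ^ s + 2 = D + 1 := by omega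
    rw [this]
    nlinarith

end Elimination

/-! ### Candidates -/

section Candidates

/-- The data that stay fixed while candidates for the next member of a family are compared:
the number `k` of jobs of the previous layer, the linked lists and their profits on the entries
below `cnt`, and an echelon form with `rank` rows. -/
structure ScanData (K : Type*) where
  k : ℕ
  cnt : ℕ
  rank : ℕ
  job : ℕ → ℕ
  nxt : ℕ → ℕ
  wt : ℕ → K
  bas : ℕ → ℕ → ℕ
  piv : ℕ → ℕ

variable {K : Type*} {n s p : ℕ}

/-- Linked lists stay below `cnt`, their members are at most `n`, and the rows are in echelon
form. -/
structure ScanData.Valid (d : ScanData K) (n s p : ℕ) : Prop where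
  job_le : ∀ e < d.cnt, d.job e ≤ n
  nxt_lt : ∀ e < d.cnt, d.nxt e < d.cnt
  echelon : IsEchelon p (2 * 2 ^ s + 1) d.rank d.bas d.piv

/-- The list of jobs of an entry. -/
abbrev ScanData.list (d : ScanData K) (e : ℕ) : List ℕ := chain d.job d.nxt d.k e

/-- The memory holds the data.  The entry `cnt` and the row `rank` serve as the store for the best
candidate so far. -/
structure ScanData.In (d : ScanData K) (s : ℕ) (σ : State K) : Prop where
  k : σ.imem bkV0 0 = d.k
  cnt : σ.imem bkCnt 0 = d.cnt
  rank : σ.imem bkRank 0 = d.rank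
  job : ∀ e ≠ d.cnt, σ.imem bkJob e = d.job e
  nxt : ∀ e ≠ d.cnt, σ.imem bkNxt e = d.nxt e
  wt : ∀ e ≠ d.cnt, σ.vmem vbWt e = d.wt e
  bas : ∀ i < d.rank, ∀ h < 2 * 2 ^ s + 1, σ.imem bkBas (i * (2 * 2 ^ s + 1) + h) = d.bas i h
  piv : ∀ i < d.rank, σ.imem bkPiv i = d.piv i

theorem ScanData.In.frame {d : ScanData K} {σ σ' : State K} {P : Prog} (h : d.In s σ)
    (hF : Frame P σ σ')
    (hP : (∀ b ∈ [bkV0, bkCnt, bkRank, bkJob, bkNxt, bkBas, bkPiv], P.wI b = false) ∧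
      ∀ b ∈ [vbWt], P.wV b = false := by decide) : d.In s σ' := by
  simp only [List.mem_cons, List.not_mem_nil, or_false, forall_eq_or_imp, forall_eq] at hP
  obtain ⟨⟨h0, h1, h2, h3, h4, h5, h6⟩, k0⟩ := hP
  constructor
  · rw [hF.i _ h0]; exact h.k
  · rw [hF.i _ h1]; exact h.cnt
  · rw [hF.i _ h2]; exact h.rank
  · rw [hF.i _ h3]; exact h.job
  · rw [hF.i _ h4]; exact h.nxt
  · rw [hF.v _ k0]; exact h.wt
  · rw [hF.i _ h5]; exact h.bas
  · rw [hF.i _ h6]; exact h.piv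

variable [AddCommGroup K] [LinearOrder K] {f : ℕ → K → K}
  {I : JobSet K n} {M : ℕ} {step : ℕ → ℕ} {tau : ℕ → K}

/-- Computes profit and reduced vector of the candidate that consists of the job `bkV3` and the list
at the entry `bkE`. -/
def evalProg : Prog :=
  dupProg ;; .vset vbW (.lit 0) (.add (.cell vbWj (.lit 0)) (.cell vbWt (var bkE))) ;;
  valProg ;; vecProg ;; reduceProg ;; pivotProg

/-- The result of evaluating the candidate with the job `j` and the list at the entry `e`, where `w`
is the profit of `j`. -/
structure Evaluated (d : ScanData K) (s p : ℕ) [Fact p.Prime] (j e : ℕ) (w : K) (σ : State K) :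
    Prop where
  dup : σ.imem bkDup 0 = 0 ↔ j ∉ d.list e
  profit : σ.vmem vbW 0 = w + d.wt e
  vec : (σ.imem bkNz 0 = 0 ∧ Spanned p (2 * 2 ^ s + 1) d.rank d.bas (jobVec p s (j :: d.list e))) ∨
    (σ.imem bkNz 0 = 1 ∧ Extends p (2 * 2 ^ s + 1) d.rank d.bas d.piv (jobVec p s (j :: d.list e))
      (σ.imem bkVec) (σ.imem bkPv 0))

variable [Fact p.Prime]

theorem run_evalProg {σ : State K} (hσ : Prepared I s p M step tau σ) (hp : n + s + 1 < p)
    {d : ScanData K} (hd : d.Valid n s p) (hin : d.In s σ) {j e : ℕ} {w : K}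
    (hj : σ.imem bkV3 0 = j) (hjn : j < n) (he : σ.imem bkE 0 = e) (hec : e < d.cnt)
    (hw : σ.vmem vbWj 0 = w) (hks : d.k < s) :
    Run f evalProg σ (1000 * (2 * 2 ^ s + 2) ^ 2) (Evaluated d s p j e w) := by
  have hs2 : s + 1 ≤ 2 ^ s := Nat.lt_two_pow_self
  have hchain : ∀ {σ' : State K}, d.In s σ' → ∀ k,
      chain (σ'.imem bkJob) (σ'.imem bkNxt) k e = chain d.job d.nxt k e := fun h k =>
    chain_congr (fun x hx => h.job x hx.ne) (fun x hx => h.nxt x hx.ne) hd.nxt_lt hec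
  refine Run.bind (U := 1000 * (2 * 2 ^ s + 2) ^ 2 - 60 * (d.k + 1)) _
    (run_dupProg hin.k hj he rfl rfl) (fun σ₁ hF₁ h1 => ?_) ?_
  rotate_left
  · have : 60 * (d.k + 1) ≤ 1000 * (2 * 2 ^ s + 2) ^ 2 := by nlinarith
    omega
  rw [hchain hin] at h1
  have hin₁ := hin.frame hF₁
  refine Run.bind (T := 10) (fun σ₂ => σ₂.vmem vbW 0 = w + d.wt e) (Run.block ?_)
    (fun σ₂ hF₂ h2 => Run.bind _ (run_valProg (k := d.k) (j := j) (e := e)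
      ((hσ.frame hF₁).frame hF₂) hp (hin₁.frame hF₂).k ?_ ?_ rfl rfl hjn.le ?_)
    (fun σ₃ hF₃ h3 => Run.bind _ (run_vecProg (((hσ.frame hF₁).frame hF₂).frame hF₃) h3)
    (fun σ₄ hF₄ h4 => Run.bind _ (run_reduceProg
      ((((hσ.frame hF₁).frame hF₂).frame hF₃).frame hF₄)
      (((hin₁.frame hF₂).frame hF₃).frame hF₄).rank hd.echelon
      (((hin₁.frame hF₂).frame hF₃).frame hF₄).bas (((hin₁.frame hF₂).frame hF₃).frame hF₄).piv h4)
    (fun σ₅ hF₅ h5 => Run.post (run_pivotProg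
      (((((hσ.frame hF₁).frame hF₂).frame hF₃).frame hF₄).frame hF₅)) ?_) le_rfl) le_rfl) le_rfl) ?_
  · simp [hF₁.v vbWj rfl, hw, hF₁.i bkE rfl, he, hin₁.wt e hec.ne]
  · rw [hF₂.i bkV3 rfl, hF₁.i bkV3 rfl, hj]
  · rw [hF₂.i bkE rfl, hF₁.i bkE rfl, he]
  · rw [hchain (hin₁.frame hF₂)]
    intro x hx
    exact Nat.lt_succ_iff.1
      (lt_of_mem_chain (fun y hy => Nat.lt_succ_of_le (hd.job_le y hy)) hd.nxt_lt hec x hx)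
  · intro σ₆ hF₆ h6
    obtain ⟨u, hu, hz, α, hα, hlin⟩ := h5
    rw [hchain (hin₁.frame hF₂)] at hlin
    have hvec : σ₆.imem bkVec = σ₅.imem bkVec := hF₆.i bkVec rfl
    refine ⟨?_, ?_, ?_⟩
    · rw [hF₆.i bkDup rfl, hF₅.i bkDup rfl, hF₄.i bkDup rfl, hF₃.i bkDup rfl, hF₂.i bkDup rfl]
      exact h1
    · rw [hF₆.v vbW rfl, hF₅.v vbW rfl, hF₄.v vbW rfl, hF₃.v vbW rfl]
      exact h2
    · rw [hvec] at h6 ⊢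
      refine h6.imp (fun ⟨h7, h8⟩ => ⟨h7, fun c hc => ?_⟩) (fun ⟨h7, h8, h9⟩ => ⟨h7, ?_⟩)
      · have h10 : lin (2 * 2 ^ s + 1) c u = 0 := by
          refine Finset.sum_eq_zero fun h hh => ?_
          have h11 := Finset.mem_range.1 hh
          rw [← (hu h h11).2, h8 h h11]
          simp
        rw [hlin c hc] at h10
        exact (mul_eq_zero.1 h10).resolve_left hα
      · refine ⟨fun h hh => (hu h hh).1, h8, h9, fun i hi => ?_, fun c hc hg => ?_⟩
        · have h10 := hu _ (hd.echelon.piv_lt i hi)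
          rw [hz i hi, ZMod.natCast_eq_zero_iff] at h10
          exact Nat.eq_zero_of_dvd_of_lt h10.2 h10.1
        · rw [lin_congr fun h hh => (hu h hh).2, hlin c hc]
          exact (congrArg (α * ·) hg).trans (mul_zero α)
  · obtain ⟨A, hA⟩ : ∃ A, 2 ^ s = A := ⟨_, rfl⟩
    rw [hA] at hs2 ⊢
    have h1 : (s + 2) * (d.k + 2) ≤ (2 * A + 2) * (2 * A + 2) :=
      Nat.mul_le_mul (by omega) (by omega)
    have h2 : 60 * (d.k + 1) ≤ 60 * (2 * A + 2) := by omega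
    have h3 : 1 * (2 * A + 2) ≤ (2 * A + 2) * (2 * A + 2) := Nat.mul_le_mul_right _ (by omega)
    rw [pow_two, mul_assoc 100]
    generalize (2 * A + 2) * (2 * A + 2) = Q at *
    generalize (s + 2) * (d.k + 2) = Q' at *
    omega

end Candidates

/-! ### Comparison of all candidates -/

section Scan

variable {K : Type*} [AddCommGroup K] [LinearOrder K] {n : ℕ} {f : ℕ → K → K}
  {I : JobSet K n} {s p M : ℕ} {step : ℕ → ℕ} {tau : ℕ → K}

/-- Stores the current candidate as the best one. -/
def storeProg : Prog :=
  .iset bkFnd (.lit 0) (.lit 1) ;;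
  .iset bkJob (var bkCnt) (var bkV3) ;;
  .iset bkNxt (var bkCnt) (var bkE) ;;
  .vset vbWt (var bkCnt) (.cell vbW (.lit 0)) ;;
  .iset bkPiv (var bkRank) (var bkPv) ;;
  forLoop bkV5 (var bkDim)
    (.iset bkBas (.add (.cell bkBasisRow (var bkRank)) (var bkV5)) (.cell bkVec (var bkV5)))

theorem run_storeProg {σ : State K} (hσ : Prepared I s p M step tau σ) {d : ScanData K}
    (hr : d.rank ≤ 2 * 2 ^ s + 1) (hin : d.In s σ) {j e : ℕ} (hj : σ.imem bkV3 0 = j)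
    (he : σ.imem bkE 0 = e) :
    Run f storeProg σ (100 * (2 * 2 ^ s + 2)) (fun σ' => d.In s σ' ∧ σ'.imem bkFnd 0 = 1 ∧
      σ'.imem bkJob d.cnt = j ∧ σ'.imem bkNxt d.cnt = e ∧ σ'.vmem vbWt d.cnt = σ.vmem vbW 0 ∧
      σ'.imem bkPiv d.rank = σ.imem bkPv 0 ∧ ∀ h < 2 * 2 ^ s + 1,
        σ'.imem bkBas (d.rank * (2 * 2 ^ s + 1) + h) = σ.imem bkVec h) := by
  refine Run.bind (T := 5) (fun σ₁ => d.In s σ₁ ∧ σ₁.imem bkFnd 0 = 1) (Run.block ?_)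
    (fun σ₁ hF₁ ⟨h1, h1'⟩ => Run.bind (T := 10) (fun σ₂ => d.In s σ₂ ∧ σ₂.imem bkJob d.cnt = j)
      (Run.block ?_)
    (fun σ₂ hF₂ ⟨h2, h2'⟩ => Run.bind (T := 10) (fun σ₃ => d.In s σ₃ ∧ σ₃.imem bkNxt d.cnt = e)
      (Run.block ?_)
    (fun σ₃ hF₃ ⟨h3, h3'⟩ => Run.bind (T := 10)
      (fun σ₄ => d.In s σ₄ ∧ σ₄.vmem vbWt d.cnt = σ.vmem vbW 0) (Run.block ?_)
    (fun σ₄ hF₄ ⟨h4, h4'⟩ => Run.bind (T := 10)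
      (fun σ₅ => d.In s σ₅ ∧ σ₅.imem bkPiv d.rank = σ.imem bkPv 0) (Run.block ?_)
    (fun σ₅ hF₅ ⟨h5, h5'⟩ => Run.post (Run.forLoop (N := 2 * 2 ^ s + 1) (T := 20)
      (fun i σ' => d.In s σ' ∧ ∀ h < i,
        σ'.imem bkBas (d.rank * (2 * 2 ^ s + 1) + h) = σ.imem bkVec h) rfl ?_ ?_ ?_) ?_)
    le_rfl) le_rfl) le_rfl) le_rfl) ?_
  · exact ⟨⟨by simp [hin.k], by simp [hin.cnt], by simp [hin.rank], by simpa using hin.job,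
      by simpa using hin.nxt, by simpa using hin.wt, by simpa using hin.bas,
      by simpa using hin.piv⟩, by simp⟩
  · have e1 : σ₁.imem bkV3 0 = j := by rw [hF₁.i bkV3 rfl, hj]
    exact ⟨⟨by simp [h1.k], by simp [h1.cnt], by simp [h1.rank],
      fun x hx => by simpa [h1.cnt, hx] using h1.job x hx,
      by simpa using h1.nxt, by simpa using h1.wt, by simpa using h1.bas,
      by simpa using h1.piv⟩, by simp [h1.cnt, e1]⟩
  · have e1 : σ₂.imem bkE 0 = e := by rw [hF₂.i bkE rfl, hF₁.i bkE rfl, he]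
    exact ⟨⟨by simp [h2.k], by simp [h2.cnt], by simp [h2.rank], by simpa using h2.job,
      fun x hx => by simpa [h2.cnt, hx] using h2.nxt x hx,
      by simpa using h2.wt, by simpa using h2.bas,
      by simpa using h2.piv⟩, by simp [h2.cnt, e1]⟩
  · have e1 : σ₃.vmem vbW = σ.vmem vbW := by rw [hF₃.v vbW rfl, hF₂.v vbW rfl, hF₁.v vbW rfl]
    exact ⟨⟨by simp [h3.k], by simp [h3.cnt], by simp [h3.rank], by simpa using h3.job,
      by simpa using h3.nxt, fun x hx => by simpa [h3.cnt, hx] using h3.wt x hx,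
      by simpa using h3.bas, by simpa using h3.piv⟩, by simp [h3.cnt, e1]⟩
  · have e1 : σ₄.imem bkPv = σ.imem bkPv := by
      rw [hF₄.i bkPv rfl, hF₃.i bkPv rfl, hF₂.i bkPv rfl, hF₁.i bkPv rfl]
    exact ⟨⟨by simp [h4.k], by simp [h4.cnt], by simp [h4.rank], by simpa using h4.job,
      by simpa using h4.nxt, by simpa using h4.wt, by simpa using h4.bas,
      fun x hx => by simpa [h4.rank, hx.ne] using h4.piv x hx⟩, by simp [h4.rank, e1]⟩
  · intro σ' hF
    simp [((((((hσ.frame hF₁).frame hF₂).frame hF₃).frame hF₄).frame hF₅).frame hF).dim]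
  · refine ⟨⟨by simp [h5.k], by simp [h5.cnt], by simp [h5.rank], by simpa using h5.job,
      by simpa using h5.nxt, by simpa using h5.wt, by simpa using h5.bas,
      by simpa using h5.piv⟩, by simp⟩
  · rintro i σ' hi hv hF ⟨h6, h7⟩
    have e1 : σ'.imem bkVec = σ.imem bkVec := by
      rw [hF.i bkVec rfl, hF₅.i bkVec rfl, hF₄.i bkVec rfl, hF₃.i bkVec rfl, hF₂.i bkVec rfl,
        hF₁.i bkVec rfl]
    have e2 := ((((((hσ.frame hF₁).frame hF₂).frame hF₃).frame hF₄).frame hF₅).frame hF).basisRow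
      d.rank (by omega)
    refine Run.block ⟨⟨by simp [h6.k], by simp [h6.cnt], by simp [h6.rank], by simpa using h6.job,
      by simpa using h6.nxt, by simpa using h6.wt, fun a ha h hh => ?_,
      by simpa using h6.piv⟩, fun h hh => ?_⟩
    · have hne : a * (2 * 2 ^ s + 1) + h ≠ d.rank * (2 * 2 ^ s + 1) + i := by
        have : (a + 1) * (2 * 2 ^ s + 1) ≤ d.rank * (2 * 2 ^ s + 1) := Nat.mul_le_mul_right _ ha
        rw [add_mul] at this
        omega
      simpa [hv, h6.rank, e2, hne] using h6.bas a ha h hh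
    · rcases Nat.lt_succ_iff_lt_or_eq.1 hh with hh | rfl
      · simpa [hv, h6.rank, e2, hh.ne] using h7 h hh
      · simp [hv, h6.rank, e2, e1]
  · rintro σ' hF ⟨h6, h7⟩
    refine ⟨h6, ?_, ?_, ?_, ?_, ?_, h7⟩
    · rw [hF.i bkFnd rfl, hF₅.i bkFnd rfl, hF₄.i bkFnd rfl, hF₃.i bkFnd rfl, hF₂.i bkFnd rfl, h1']
    · rw [hF.i bkJob rfl, hF₅.i bkJob rfl, hF₄.i bkJob rfl, hF₃.i bkJob rfl, h2']
    · rw [hF.i bkNxt rfl, hF₅.i bkNxt rfl, hF₄.i bkNxt rfl, h3']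
    · rw [hF.v vbWt rfl, hF₅.v vbWt rfl, h4']
    · rw [hF.i bkPiv rfl, h5']
  · simp only [IExp.cost]; omega

/-- Evaluates a candidate and stores it, if it is admissible and better than the stored one. -/
def candProg : Prog :=
  evalProg ;;
  .cond (.conj (.ile (var bkDup) (.lit 0)) (.conj (.ile (.lit 1) (var bkNz))
      (.neg (.conj (.ile (.lit 1) (var bkFnd))
        (.vle (.cell vbW (.lit 0)) (.cell vbWt (var bkCnt)))))))
    storeProg .skip

variable [Fact p.Prime]

/-- The situation after the candidates `(j, e)` in `src` have been compared, where `wj j` is the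
profit of the job `j`: every other admissible candidate has a vector that is spanned by the echelon
form, or is at most as profitable as the stored one. -/
structure ScanInv (d : ScanData K) (s p : ℕ) [Fact p.Prime] (wj : ℕ → K) (src : ℕ → ℕ → Prop)
    (σ : State K) : Prop where
  data : d.In s σ
  handled : ∀ j e, src j e → j ∉ d.list e →
    Spanned p (2 * 2 ^ s + 1) d.rank d.bas (jobVec p s (j :: d.list e)) ∨
      (σ.imem bkFnd 0 = 1 ∧ wj j + d.wt e ≤ σ.vmem vbWt d.cnt)
  found : σ.imem bkFnd 0 = 0 ∨ σ.imem bkFnd 0 = 1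
  best : σ.imem bkFnd 0 = 1 → ∃ j e, src j e ∧ j ∉ d.list e ∧ σ.imem bkJob d.cnt = j ∧
    σ.imem bkNxt d.cnt = e ∧ σ.vmem vbWt d.cnt = wj j + d.wt e ∧
    Extends p (2 * 2 ^ s + 1) d.rank d.bas d.piv (jobVec p s (j :: d.list e))
      (fun h => σ.imem bkBas (d.rank * (2 * 2 ^ s + 1) + h)) (σ.imem bkPiv d.rank)

theorem ScanInv.frame {d : ScanData K} {wj : ℕ → K} {src : ℕ → ℕ → Prop} {σ σ' : State K}
    {P : Prog} (h : ScanInv d s p wj src σ) (hF : Frame P σ σ')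
    (hP : (∀ b ∈ [bkV0, bkCnt, bkRank, bkJob, bkNxt, bkBas, bkPiv], P.wI b = false) ∧
      ∀ b ∈ [vbWt], P.wV b = false := by decide) (hP' : P.wI bkFnd = false := by decide) :
    ScanInv d s p wj src σ' := by
  refine ⟨h.data.frame hF hP, ?_, ?_, ?_⟩
  · rw [hF.i _ hP', hF.v _ (hP.2 _ (by simp))]; exact h.handled
  · rw [hF.i _ hP']; exact h.found
  · rw [hF.i _ hP', hF.v _ (hP.2 _ (by simp)), hF.i bkJob (hP.1 _ (by simp)),
      hF.i bkNxt (hP.1 _ (by simp)), hF.i bkBas (hP.1 _ (by simp)), hF.i bkPiv (hP.1 _ (by simp))]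
    exact h.best

theorem ScanInv.congr {d : ScanData K} {wj : ℕ → K} {src src' : ℕ → ℕ → Prop} {σ : State K}
    (h : ScanInv d s p wj src σ) (hs : ∀ j e, src j e ↔ src' j e) : ScanInv d s p wj src' σ := by
  have : src = src' := by funext j e; exact propext (hs j e)
  rwa [← this]

theorem run_candProg {σ : State K} (hσ : Prepared I s p M step tau σ) (hp : n + s + 1 < p)
    {d : ScanData K} (hd : d.Valid n s p) {wj : ℕ → K} {src : ℕ → ℕ → Prop}
    (hI : ScanInv d s p wj src σ) {j e : ℕ} (hj : σ.imem bkV3 0 = j) (hjn : j < n)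
    (he : σ.imem bkE 0 = e) (hec : e < d.cnt) (hw : σ.vmem vbWj 0 = wj j) (hks : d.k < s) :
    Run f candProg σ (2000 * (2 * 2 ^ s + 2) ^ 2)
      (ScanInv d s p wj fun j' e' => src j' e' ∨ (j' = j ∧ e' = e)) := by
  refine Run.bind (U := 50 + 100 * (2 * 2 ^ s + 2)) _
    (run_evalProg hσ hp hd hI.data hj hjn he hec hw hks) (fun σ₁ hF₁ h1 => ?_) ?_
  rotate_left
  · have h1 : 2 ≤ 2 * 2 ^ s + 2 := by omega
    nlinarith
  have hI₁ := hI.frame hF₁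
  have hcnt := hI₁.data.cnt
  refine (Run.cond (T := 100 * (2 * 2 ^ s + 2)) (fun hb => ?_) (fun hb => ?_)).le
    (by simp only [BExp.cost, IExp.cost, VExp.cost]; omega)
  · simp [hcnt] at hb
    obtain ⟨hb1, hb2, hb3⟩ := hb
    have hdup := h1.dup.1 hb1
    have hext := h1.vec.resolve_left fun h => by simp [h.1] at hb2
    refine (run_storeProg (hσ.frame hF₁) hd.echelon.le hI₁.data (j := j) (e := e)
      (by rw [hF₁.i bkV3 rfl, hj]) (by rw [hF₁.i bkE rfl, he])).post ?_
    rintro σ₂ hF₂ ⟨h2, h3, h4, h5, h6, h7, h8⟩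
    rw [h1.profit] at h6 hb3
    refine ⟨h2, fun j' e' hs' hne => ?_, Or.inr h3, fun _ => ⟨j, e, Or.inr ⟨rfl, rfl⟩, hdup, h4, h5,
      h6, ?_⟩⟩
    · rcases hs' with hs' | ⟨rfl, rfl⟩
      · refine (hI₁.handled j' e' hs' hne).imp id fun ⟨h9, h10⟩ => ⟨h3, ?_⟩
        rw [h6]
        exact h10.trans (hb3.resolve_left (by simp [h9])).le
      · exact Or.inr ⟨h3, h6.ge⟩
    · rw [h7]
      have hx := hext.2
      exact ⟨fun h hh => by rw [h8 h hh]; exact hx.lt h hh, hx.piv_lt,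
        by rw [h8 _ hx.piv_lt]; exact hx.ne_zero,
        fun i hi => by rw [h8 _ (hd.echelon.piv_lt i hi)]; exact hx.eq_zero i hi,
        fun c hc hg => by
          rw [lin_congr fun h hh => by rw [h8 h hh]]
          exact hx.spanned c hc hg⟩
  · refine (Run.block (T := 1) ?_).le (by omega)
    simp only [Prog.sem]
    refine ⟨hI₁.data, fun j' e' hs' hne => ?_, hI₁.found, fun hf => ?_⟩
    · rcases hs' with hs' | ⟨rfl, rfl⟩
      · exact hI₁.handled j' e' hs' hne
      · rcases h1.vec with hv | hv
        · exact Or.inl hv.2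
        · right
          have hdup := h1.dup.2 hne
          by_contra hcon
          simp [hcnt, hdup, hv.1, h1.profit] at hb
          exact hcon ⟨hI₁.found.resolve_left fun h => by simp [h] at hb, hb.2⟩
    · obtain ⟨j', e', h2, h3⟩ := hI₁.best hf
      exact ⟨j', e', Or.inl h2, h3⟩

/-- The state that is reached from the state `x` when the job `j` is processed next. -/
def succState (I : JobSet K n) (M : ℕ) (step : ℕ → ℕ) (tau : ℕ → K) (x j : ℕ) : ℕ :=
  if I.rel j ≤ tau x then x + step j else j * M + step j

/-- The profit of the job `j` when it is processed next in the state `x`. -/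
def jobProfit (I : JobSet K n) (tau : ℕ → K) (x j : ℕ) : K :=
  I.oracle j (max (tau x) (I.rel j) + I.len j)

/-- The candidates: a job `j < J` and a member `e` of the family of the next state. -/
def Src (I : JobSet K n) (M : ℕ) (step : ℕ → ℕ) (tau : ℕ → K) (beg en : ℕ → ℕ) (prev x J : ℕ)
    (j e : ℕ) : Prop :=
  j < J ∧ beg (prev + succState I M step tau x j) ≤ e ∧ e < en (prev + succState I M step tau x j)

/-- Compares the candidates with the job `bkV3`. -/
def jobProg : Prog :=
  .cond (.vle (.cell vbRel (var bkV3)) (.cell vbTau (var bkV1)))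
    (.iset bkY (.lit 0) (.add (var bkPrev) (.add (var bkV1) (.cell bkStep (var bkV3)))) ;;
     .vset vbSt (.lit 0) (.cell vbTau (var bkV1)))
    (.iset bkY (.lit 0) (.add (var bkPrev)
        (.add (.cell bkBase (var bkV3)) (.cell bkStep (var bkV3)))) ;;
     .vset vbSt (.lit 0) (.cell vbRel (var bkV3))) ;;
  .vset vbWj (.lit 0) (.query (var bkV3) (.add (.cell vbSt (.lit 0)) (.cell vbLen (var bkV3)))) ;;
  .iset bkE (.lit 0) (.cell bkBeg (var bkY)) ;;
  forLoop bkV4 (.sub (.cell bkEnd (var bkY)) (.cell bkBeg (var bkY)))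
    (candProg ;; .iset bkE (.lit 0) (.add (var bkE) (.lit 1)))

theorem run_jobProg {σ : State K} (hσ : Prepared I s p M step tau σ) (hp : n + s + 1 < p)
    {d : ScanData K} (hd : d.Valid n s p) {beg en : ℕ → ℕ} {prev x j : ℕ}
    (hI : ScanInv d s p (jobProfit I tau x) (Src I M step tau beg en prev x j) σ)
    (hj : σ.imem bkV3 0 = j) (hjn : j < n) (hx : σ.imem bkV1 0 = x) (hprev : σ.imem bkPrev 0 = prev)
    (hbeg : σ.imem bkBeg = beg) (hen : σ.imem bkEnd = en) (hcnt : ∀ z, en z ≤ d.cnt)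
    (hsize : ∀ z, en z ≤ beg z + (2 * 2 ^ s + 2)) (hks : d.k < s) :
    Run I.oracle jobProg σ (5000 * (2 * 2 ^ s + 2) ^ 3)
      (ScanInv d s p (jobProfit I tau x) (Src I M step tau beg en prev x (j + 1))) := by
  obtain ⟨y, hy⟩ : ∃ y, prev + succState I M step tau x j = y := ⟨_, rfl⟩
  refine Run.bind (T := 50) (fun σ₁ => σ₁.imem bkY 0 = y ∧
    σ₁.vmem vbSt 0 = max (tau x) (I.rel j)) (Run.block ?_) (fun σ₁ hF₁ ⟨h1, h1'⟩ =>
    Run.bind (T := 20) (fun σ₂ => σ₂.vmem vbWj 0 = jobProfit I tau x j) (Run.block ?_)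
    (fun σ₂ hF₂ h2 => Run.bind (T := 10) (fun σ₃ => σ₃.imem bkE 0 = beg y) (Run.block ?_)
    (fun σ₃ hF₃ h3 => Run.post (Run.forLoop (N := en y - beg y)
      (T := 2000 * (2 * 2 ^ s + 2) ^ 2 + 10)
      (fun i σ' => σ'.imem bkE 0 = beg y + i ∧ ScanInv d s p (jobProfit I tau x)
        (fun j' e' => Src I M step tau beg en prev x j j' e' ∨
          (j' = j ∧ beg y ≤ e' ∧ e' < beg y + i)) σ') rfl ?_ ?_ ?_) ?_) le_rfl) le_rfl) ?_
  · by_cases hc : I.rel j ≤ tau x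
    · rw [← hy, succState, if_pos hc]
      simp [hj, hx, hprev, hσ.rel, hσ.tau, hσ.step, hc]
    · rw [← hy, succState, if_neg hc]
      simp [hj, hx, hprev, hσ.rel, hσ.tau, hσ.step, hc, hσ.base j hjn.le, (not_le.1 hc).le]
  · simp [hF₁.i bkV3 rfl, hj, h1', (hσ.frame hF₁).len, jobProfit]
  · simp [hF₂.i bkY rfl, h1, hF₂.i bkBeg rfl, hF₁.i bkBeg rfl, hbeg]
  · intro σ' hF
    simp [hF.i bkEnd rfl, hF₃.i bkEnd rfl, hF₂.i bkEnd rfl, hF₁.i bkEnd rfl, hen,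
      hF.i bkBeg rfl, hF₃.i bkBeg rfl, hF₂.i bkBeg rfl, hF₁.i bkBeg rfl, hbeg,
      hF.i bkY rfl, hF₃.i bkY rfl, hF₂.i bkY rfl, h1]
  · refine ⟨by simp [h3], ?_⟩
    have hF₄ : Frame (.iset bkV4 (.lit 0) (.lit 0)) σ₃ (σ₃.setI bkV4 0 0) := by
      exact (Exec.iset (f := I.oracle) bkV4 (.lit 0) (.lit 0) σ₃).frame
    refine ((((hI.frame hF₁).frame hF₂).frame hF₃).frame hF₄).congr fun j' e' => ?_
    constructor
    · exact Or.inl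
    · rintro (h | h)
      · exact h
      · omega
  · rintro i σ' hi hv hF ⟨h4, h5⟩
    have hσ' := (((hσ.frame hF₁).frame hF₂).frame hF₃).frame hF
    refine Run.bind _ (run_candProg hσ' hp hd h5 (j := j) (e := beg y + i)
      (by rw [hF.i bkV3 rfl, hF₃.i bkV3 rfl, hF₂.i bkV3 rfl, hF₁.i bkV3 rfl, hj]) hjn h4
      (by have := hcnt y; omega) (by rw [hF.v vbWj rfl, hF₃.v vbWj rfl, h2]) hks)
      (fun σ₄ hF₄ h6 => Run.with_frame (Run.block (T := 10)
        (R := fun σ₅ => σ₅.imem bkE 0 = beg y + (i + 1)) ?_) |>.post ?_) le_rfl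
    · simp [hF₄.i bkE rfl, h4]; omega
    · rintro σ₅ - ⟨hF₅, h7⟩
      refine ⟨by simpa using h7, ?_⟩
      have hF₆ : Frame (.iset bkV4 (.lit 0) (.lit (i + 1))) σ₅ (σ₅.setI bkV4 0 (i + 1)) :=
        (Exec.iset (f := I.oracle) bkV4 (.lit 0) (.lit (i + 1)) σ₅).frame
      refine ((h6.frame hF₅).frame hF₆ ⟨by simp [Prog.wI], by simp [Prog.wV]⟩
        (by simp [Prog.wI])).congr fun j' e' => ?_
      constructor
      · rintro ((h | h) | h)
        · exact Or.inl h
        · exact Or.inr (by omega)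
        · exact Or.inr (by omega)
      · rintro (h | h)
        · exact Or.inl (Or.inl h)
        · by_cases he : e' = beg y + i
          · exact Or.inr ⟨h.1, he⟩
          · exact Or.inl (Or.inr (by omega))
  · rintro σ' hF ⟨-, h4⟩
    refine h4.congr fun j' e' => ?_
    constructor
    · rintro (⟨h5, h6⟩ | ⟨rfl, h6, h7⟩)
      · exact ⟨by omega, h6⟩
      · exact ⟨by omega, by rw [hy]; omega, by rw [hy]; omega⟩
    · rintro ⟨h5, h6, h7⟩
      rcases Nat.lt_succ_iff_lt_or_eq.1 h5 with h5 | rfl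
      · exact Or.inl ⟨h5, h6, h7⟩
      · rw [hy] at h6 h7
        exact Or.inr ⟨rfl, h6, by omega⟩
  · have h1 := hsize y
    obtain ⟨B, hB⟩ : ∃ B, 2 * 2 ^ s + 2 = B := ⟨_, rfl⟩
    rw [hB] at h1 ⊢
    have h2 : en y - beg y ≤ B := by omega
    have h3 : 2 ≤ B := by omega
    simp only [IExp.cost]
    have h4 : (en y - beg y + 1) * (2000 * B ^ 2 + 10 + (1 + (1 + (1 + 1)) + (1 + (1 + 1))) + 11)
        ≤ (B + 1) * (2000 * B ^ 2 + 28) := Nat.mul_le_mul (by omega) (by omega)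
    have h5 : (B + 1) * (2000 * B ^ 2 + 28) + 80 ≤ 5000 * B ^ 3 := by nlinarith [sq_nonneg B]
    omega

/-- Compares all candidates. -/
def scanProg : Prog :=
  .iset bkFnd (.lit 0) (.lit 0) ;; forLoop bkV3 (.cell 0 (.lit 0)) jobProg

theorem run_scanProg {σ : State K} (hσ : Prepared I s p M step tau σ) (hp : n + s + 1 < p)
    {d : ScanData K} (hd : d.Valid n s p) (hin : d.In s σ) {beg en : ℕ → ℕ} {prev x : ℕ}
    (hx : σ.imem bkV1 0 = x) (hprev : σ.imem bkPrev 0 = prev)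
    (hbeg : σ.imem bkBeg = beg) (hen : σ.imem bkEnd = en) (hcnt : ∀ z, en z ≤ d.cnt)
    (hsize : ∀ z, en z ≤ beg z + (2 * 2 ^ s + 2)) (hks : d.k < s) :
    Run I.oracle scanProg σ (6000 * (n + 1) * (2 * 2 ^ s + 2) ^ 3)
      (ScanInv d s p (jobProfit I tau x) (Src I M step tau beg en prev x n)) := by
  refine Run.bind (T := 3) (fun σ₁ => d.In s σ₁ ∧ σ₁.imem bkFnd 0 = 0)
    (Run.with_frame (Run.block (R := fun σ₁ => σ₁.imem bkFnd 0 = 0) (by simp)) |>.post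
      fun σ₁ _ ⟨hF, h⟩ => ⟨hin.frame hF, h⟩)
    (fun σ₁ hF₁ ⟨h1, h2⟩ => Run.forLoop (N := n) (T := 5000 * (2 * 2 ^ s + 2) ^ 3)
      (fun j σ' => ScanInv d s p (jobProfit I tau x) (Src I M step tau beg en prev x j) σ')
      rfl ?_ ?_ ?_) ?_
  · intro σ' hF
    simp [((hσ.frame hF₁).frame hF).jobs]
  · have hF₂ : Frame (.iset bkV3 (.lit 0) (.lit 0)) σ₁ (σ₁.setI bkV3 0 0) :=
      (Exec.iset (f := I.oracle) bkV3 (.lit 0) (.lit 0) σ₁).frame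
    exact ⟨h1.frame hF₂, fun j e h => absurd h.1 (Nat.not_lt_zero j), Or.inl (by simp [h2]),
      fun h => by simp [h2] at h⟩
  · intro j σ' hj hv hF h3
    refine (run_jobProg ((hσ.frame hF₁).frame hF) hp hd h3 hv hj
      (by rw [hF.i bkV1 rfl, hF₁.i bkV1 rfl, hx]) (by rw [hF.i bkPrev rfl, hF₁.i bkPrev rfl, hprev])
      (by rw [hF.i bkBeg rfl, hF₁.i bkBeg rfl, hbeg]) (by rw [hF.i bkEnd rfl, hF₁.i bkEnd rfl, hen])
      hcnt hsize hks).post fun σ'' _ h4 => ?_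
    have hF₂ : Frame (.iset bkV3 (.lit 0) (.lit (j + 1))) σ'' (σ''.setI bkV3 0 (j + 1)) :=
      (Exec.iset (f := I.oracle) bkV3 (.lit 0) (.lit (j + 1)) σ'').frame
    exact h4.frame hF₂ ⟨by simp [Prog.wI], by simp [Prog.wV]⟩ (by simp [Prog.wI])
  · simp only [IExp.cost]
    obtain ⟨Q, hQ⟩ : ∃ Q, (2 * 2 ^ s + 2) ^ 3 = Q := ⟨_, rfl⟩
    have h2 : 1 ≤ Q := hQ ▸ Nat.one_le_pow _ _ (by omega)
    rw [hQ]
    nlinarith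

end Scan

/-! ### Greedy construction of a family -/

section Greedy

variable {K : Type*}

/-- `d'` extends `d`: it agrees with `d` on the entries below `d.cnt` and the rows below
`d.rank`. -/
structure ScanData.Agree (s : ℕ) (d d' : ScanData K) : Prop where
  k : d'.k = d.k
  job : ∀ e < d.cnt, d'.job e = d.job e
  nxt : ∀ e < d.cnt, d'.nxt e = d.nxt e
  wt : ∀ e < d.cnt, d'.wt e = d.wt e
  bas : ∀ i < d.rank, ∀ h < 2 * 2 ^ s + 1, d'.bas i h = d.bas i h
  piv : ∀ i < d.rank, d'.piv i = d.piv i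

theorem ScanData.Agree.trans {s : ℕ} {d d' d'' : ScanData K} (h : d.Agree s d')
    (h' : d'.Agree s d'') (hc : d.cnt ≤ d'.cnt) (hr : d.rank ≤ d'.rank) : d.Agree s d'' :=
  ⟨h'.k.trans h.k, fun e he => (h'.job e (he.trans_le hc)).trans (h.job e he),
    fun e he => (h'.nxt e (he.trans_le hc)).trans (h.nxt e he),
    fun e he => (h'.wt e (he.trans_le hc)).trans (h.wt e he),
    fun i hi x hx => (h'.bas i (hi.trans_le hr) x hx).trans (h.bas i hi x hx),
    fun i hi => (h'.piv i (hi.trans_le hr)).trans (h.piv i hi)⟩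

theorem ScanData.Agree.list_eq {n s p : ℕ} {d d' : ScanData K} (h : d.Agree s d')
    (hd : d.Valid n s p) {e : ℕ} (he : e < d.cnt) : d'.list e = d.list e := by
  rw [ScanData.list, h.k]
  exact chain_congr h.job h.nxt hd.nxt_lt he

/-- The data in the memory. -/
def dataOf (s : ℕ) (σ : State K) : ScanData K where
  k := σ.imem bkV0 0
  cnt := σ.imem bkCnt 0
  rank := σ.imem bkRank 0
  job := σ.imem bkJob
  nxt := σ.imem bkNxt
  wt := σ.vmem vbWt
  bas i h := σ.imem bkBas (i * (2 * 2 ^ s + 1) + h)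
  piv := σ.imem bkPiv

theorem dataOf_in (s : ℕ) (σ : State K) : (dataOf s σ).In s σ :=
  ⟨rfl, rfl, rfl, fun _ _ => rfl, fun _ _ => rfl, fun _ _ => rfl, fun _ _ _ _ => rfl,
    fun _ _ => rfl⟩

theorem ScanData.In.agree {s : ℕ} {d : ScanData K} {σ : State K} (h : d.In s σ) :
    d.Agree s (dataOf s σ) :=
  ⟨h.k, fun e he => h.job e he.ne, fun e he => h.nxt e he.ne, fun e he => h.wt e he.ne, h.bas,
    h.piv⟩

/-- The jobs of the `i`-th member of the family that is built on top of `d₀`. -/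
abbrev ScanData.member (d₀ d : ScanData K) (i : ℕ) : List ℕ :=
  d.job (d₀.cnt + i) :: d₀.list (d.nxt (d₀.cnt + i))

variable [AddCommGroup K] {n s p : ℕ}

/-- The family consists of candidates, and their vectors span the echelon form. -/
structure FamilyInv (n s p : ℕ) [Fact p.Prime] (d₀ : ScanData K) (src : ℕ → ℕ → Prop) (wj : ℕ → K)
    (d : ScanData K) : Prop where
  valid : d.Valid n s p
  cnt : d.cnt = d₀.cnt + d.rank
  agree : d₀.Agree s d
  entry : ∀ i < d.rank, src (d.job (d₀.cnt + i)) (d.nxt (d₀.cnt + i)) ∧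
    d.job (d₀.cnt + i) ∉ d₀.list (d.nxt (d₀.cnt + i)) ∧
    d.wt (d₀.cnt + i) = wj (d.job (d₀.cnt + i)) + d₀.wt (d.nxt (d₀.cnt + i))
  vanish : ∀ i < d.rank, ∀ c : ℕ → ZMod p,
    (∀ i' ≤ i, lin (2 * 2 ^ s + 1) c (jobVec p s (d₀.member d i')) = 0) →
    lin (2 * 2 ^ s + 1) c (fun h => (d.bas i h : ZMod p)) = 0

theorem FamilyInv.member_eq [Fact p.Prime] {d₀ d d' : ScanData K} {src : ℕ → ℕ → Prop}
    {wj : ℕ → K} (h : FamilyInv n s p d₀ src wj d) (hA : d.Agree s d')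
    {i : ℕ} (hi : i < d.rank) : d₀.member d' i = d₀.member d i ∧
      d'.wt (d₀.cnt + i) = d.wt (d₀.cnt + i) := by
  have hlt : d₀.cnt + i < d.cnt := by rw [h.cnt]; omega
  simp only [ScanData.member, hA.job _ hlt, hA.nxt _ hlt, hA.wt _ hlt, and_self]

variable [LinearOrder K]

/-- Some member of the family on which the functional `c` does not vanish has at least the
profit `w`. -/
def Dominated (s p : ℕ) [Fact p.Prime] (d₀ d : ScanData K) (c : ℕ → ZMod p) (w : K) : Prop :=
  ∃ i < d.rank, lin (2 * 2 ^ s + 1) c (jobVec p s (d₀.member d i)) ≠ 0 ∧ w ≤ d.wt (d₀.cnt + i)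

/-- Every candidate is dominated, for every functional that does not vanish on it. -/
def Complete (s p : ℕ) [Fact p.Prime] (d₀ : ScanData K) (src : ℕ → ℕ → Prop) (wj : ℕ → K)
    (d : ScanData K) : Prop :=
  ∀ j e, src j e → j ∉ d₀.list e → ∀ c : ℕ → ZMod p,
    lin (2 * 2 ^ s + 1) c (jobVec p s (j :: d₀.list e)) ≠ 0 →
    Dominated s p d₀ d c (wj j + d₀.wt e)

/-- The situation after `t` rounds of the greedy construction: candidates that are not dominated
have at most the profits of the members chosen so far. -/
structure GreedyInv (n s p : ℕ) [Fact p.Prime] (d₀ : ScanData K) (src : ℕ → ℕ → Prop) (wj : ℕ → K)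
    (t : ℕ) (d : ScanData K) : Prop extends FamilyInv n s p d₀ src wj d where
  dom : ∀ j e, src j e → j ∉ d₀.list e → ∀ c : ℕ → ZMod p,
    lin (2 * 2 ^ s + 1) c (jobVec p s (j :: d₀.list e)) ≠ 0 →
    Dominated s p d₀ d c (wj j + d₀.wt e) ∨ ∀ i < d.rank, wj j + d₀.wt e ≤ d.wt (d₀.cnt + i)
  progress : d.rank = t ∨ Complete s p d₀ src wj d

variable [Fact p.Prime] {d₀ d d' : ScanData K} {src : ℕ → ℕ → Prop} {wj : ℕ → K}

theorem Dominated.mono (h : FamilyInv n s p d₀ src wj d) (hA : d.Agree s d')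
    (hr : d.rank ≤ d'.rank) {c : ℕ → ZMod p} {w : K} (hd : Dominated s p d₀ d c w) :
    Dominated s p d₀ d' c w := by
  obtain ⟨i, hi, h1, h2⟩ := hd
  obtain ⟨h3, h4⟩ := h.member_eq hA hi
  exact ⟨i, hi.trans_le hr, by rwa [h3], by rwa [h4]⟩

/-- A candidate whose vector is spanned by the echelon form is dominated by a member, provided that
it is at most as profitable as all members. -/
theorem FamilyInv.dominated (h : FamilyInv n s p d₀ src wj d) {g c : ℕ → ZMod p} {w : K}
    (hg : Spanned p (2 * 2 ^ s + 1) d.rank d.bas g) (hc : lin (2 * 2 ^ s + 1) c g ≠ 0)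
    (hw : ∀ i < d.rank, w ≤ d.wt (d₀.cnt + i)) : Dominated s p d₀ d c w := by
  by_contra hcon
  refine hc (hg c fun i hi => h.vanish i hi c fun i' hi' => ?_)
  by_contra hne
  exact hcon ⟨i', by omega, hne, hw i' (by omega)⟩

/-- The step of the greedy construction when no candidate is left. -/
theorem GreedyInv.of_spanned {t : ℕ} (h : GreedyInv n s p d₀ src wj t d) (hA : d.Agree s d')
    (hc : d'.cnt = d.cnt) (hr : d'.rank = d.rank) (hrank : d₀.rank = 0)
    (hspan : ∀ j e, src j e → j ∉ d₀.list e →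
      Spanned p (2 * 2 ^ s + 1) d.rank d.bas (jobVec p s (j :: d₀.list e))) :
    GreedyInv n s p d₀ src wj (t + 1) d' := by
  have hcomp : Complete s p d₀ src wj d := fun j e hs hne c hlin =>
    (h.dom j e hs hne c hlin).elim id fun hw => h.dominated (hspan j e hs hne) hlin hw
  have hcomp' : Complete s p d₀ src wj d' := fun j e hs hne c hlin =>
    (hcomp j e hs hne c hlin).mono h.toFamilyInv hA hr.ge
  refine ⟨⟨⟨?_, ?_, ?_⟩, ?_, ?_, ?_, ?_⟩,
    fun j e hs hne c hlin => Or.inl (hcomp' j e hs hne c hlin), Or.inr hcomp'⟩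
  · rw [hc]; intro e he; rw [hA.job e he]; exact h.valid.job_le e he
  · rw [hc]; intro e he; rw [hA.nxt e he]; exact h.valid.nxt_lt e he
  · rw [hr]
    have hE := h.valid.echelon
    refine ⟨fun i hi x hx => ?_, fun i hi => ?_, fun i hi => ?_, fun i hi i' hi' => ?_⟩
    · rw [hA.bas i hi x hx]; exact hE.lt i hi x hx
    · rw [hA.piv i hi]; exact hE.piv_lt i hi
    · rw [hA.piv i hi, hA.bas i hi _ (hE.piv_lt i hi)]; exact hE.ne_zero i hi
    · rw [hA.piv i' (hi'.trans hi), hA.bas i hi _ (hE.piv_lt i' (hi'.trans hi))]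
      exact hE.eq_zero i hi i' hi'
  · rw [hc, hr, h.cnt]
  · exact h.agree.trans hA (by rw [h.cnt]; omega) (by omega)
  · rw [hr]
    intro i hi
    have hlt : d₀.cnt + i < d.cnt := by rw [h.cnt]; omega
    rw [hA.job _ hlt, hA.nxt _ hlt, hA.wt _ hlt]
    exact h.entry i hi
  · rw [hr]
    intro i hi c hv
    rw [lin_congr fun x hx => by rw [hA.bas i hi x hx]]
    refine h.vanish i hi c fun i' hi' => ?_
    rw [← (h.member_eq hA (hi'.trans_lt hi)).1]
    exact hv i' hi'

/-- The step of the greedy construction that adds a candidate of maximum profit. -/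
theorem GreedyInv.extend {t : ℕ} (h : GreedyInv n s p d₀ src wj t d) (hA : d.Agree s d')
    (hc : d'.cnt = d.cnt + 1) (hr : d'.rank = d.rank + 1) (hrank : d₀.rank = 0)
    (hsrc : src (d'.job d.cnt) (d'.nxt d.cnt)) (hjob : d'.job d.cnt ≤ n)
    (hnxt : d'.nxt d.cnt < d.cnt)
    (hne : d'.job d.cnt ∉ d₀.list (d'.nxt d.cnt))
    (hwt : d'.wt d.cnt = wj (d'.job d.cnt) + d₀.wt (d'.nxt d.cnt))
    (hext : Extends p (2 * 2 ^ s + 1) d.rank d.bas d.piv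
      (jobVec p s (d'.job d.cnt :: d₀.list (d'.nxt d.cnt))) (d'.bas d.rank) (d'.piv d.rank))
    (hmax : ∀ j e, src j e → j ∉ d₀.list e →
      Spanned p (2 * 2 ^ s + 1) d.rank d.bas (jobVec p s (j :: d₀.list e)) ∨
      wj j + d₀.wt e ≤ d'.wt d.cnt) :
    GreedyInv n s p d₀ src wj (t + 1) d' := by
  have hcr : d.cnt = d₀.cnt + d.rank := h.cnt
  refine ⟨⟨⟨?_, ?_, ?_⟩, ?_, ?_, ?_, ?_⟩, fun j e hs hne c hlin => ?_, ?_⟩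
  · rw [hc]
    intro e he
    rcases Nat.lt_succ_iff_lt_or_eq.1 he with he | rfl
    · rw [hA.job e he]; exact h.valid.job_le e he
    · exact hjob
  · rw [hc]
    intro e he
    rcases Nat.lt_succ_iff_lt_or_eq.1 he with he | rfl
    · rw [hA.nxt e he]; exact (h.valid.nxt_lt e he).trans (Nat.lt_succ_self _)
    · exact hnxt.trans (Nat.lt_succ_self _)
  · rw [hr]
    have hE := h.valid.echelon
    refine ⟨fun i hi x hx => ?_, fun i hi => ?_, fun i hi => ?_, fun i hi i' hi' => ?_⟩ <;>
      rcases Nat.lt_succ_iff_lt_or_eq.1 hi with hi | rfl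
    · rw [hA.bas i hi x hx]; exact hE.lt i hi x hx
    · exact hext.lt x hx
    · rw [hA.piv i hi]; exact hE.piv_lt i hi
    · exact hext.piv_lt
    · rw [hA.piv i hi, hA.bas i hi _ (hE.piv_lt i hi)]; exact hE.ne_zero i hi
    · exact hext.ne_zero
    · rw [hA.piv i' (hi'.trans hi), hA.bas i hi _ (hE.piv_lt i' (hi'.trans hi))]
      exact hE.eq_zero i hi i' hi'
    · rw [hA.piv i' hi']; exact hext.eq_zero i' hi'
  · rw [hc, hr, h.cnt, add_assoc]
  · exact h.agree.trans hA (by omega) (by omega)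
  · rw [hr]
    intro i hi
    rcases Nat.lt_succ_iff_lt_or_eq.1 hi with hi | rfl
    · have hlt : d₀.cnt + i < d.cnt := by omega
      rw [hA.job _ hlt, hA.nxt _ hlt, hA.wt _ hlt]
      exact h.entry i hi
    · rw [← hcr]; exact ⟨hsrc, hne, hwt⟩
  · rw [hr]
    have key : ∀ i < d.rank, ∀ c : ℕ → ZMod p,
        (∀ i' ≤ i, lin (2 * 2 ^ s + 1) c (jobVec p s (d₀.member d' i')) = 0) →
        lin (2 * 2 ^ s + 1) c (fun h => (d.bas i h : ZMod p)) = 0 := by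
      intro i hi c hv
      refine h.vanish i hi c fun i' hi' => ?_
      rw [← (h.member_eq hA (hi'.trans_lt hi)).1]
      exact hv i' hi'
    intro i hi c hv
    rcases Nat.lt_succ_iff_lt_or_eq.1 hi with hi | rfl
    · rw [lin_congr fun x hx => by rw [hA.bas i hi x hx]]
      exact key i hi c hv
    · refine hext.spanned c (fun i hi => key i hi c fun i' hi' => hv i' (by omega)) ?_
      have := hv d.rank le_rfl
      rwa [ScanData.member, ← hcr] at this
  · rcases h.dom j e hs hne c hlin with h1 | h1
    · exact Or.inl (h1.mono h.toFamilyInv hA (by omega))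
    · rcases hmax j e hs hne with h2 | h2
      · exact Or.inl ((h.dominated h2 hlin h1).mono h.toFamilyInv hA (by omega))
      · refine Or.inr fun i hi => ?_
        rw [hr] at hi
        rcases Nat.lt_succ_iff_lt_or_eq.1 hi with hi | rfl
        · rw [(h.member_eq hA hi).2]; exact h1 i hi
        · rwa [← hcr]
  · exact h.progress.imp (fun h1 => by rw [hr, h1]) fun h1 j e hs hne c hlin =>
      (h1 j e hs hne c hlin).mono h.toFamilyInv hA (by omega)

theorem GreedyInv.zero (hd : d₀.Valid n s p) (hr : d₀.rank = 0) :
    GreedyInv n s p d₀ src wj 0 d₀ :=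
  ⟨⟨hd, by omega, ⟨rfl, fun _ _ => rfl, fun _ _ => rfl, fun _ _ => rfl, fun _ _ _ _ => rfl,
    fun _ _ => rfl⟩, fun i hi => by omega, fun i hi => by omega⟩,
    fun _ _ _ _ _ _ => Or.inr fun i hi => by omega, Or.inl hr⟩

/-- An echelon form has at most `2 * 2 ^ s + 1` rows, so that the construction is finished after
`2 * 2 ^ s + 2` rounds. -/
theorem GreedyInv.complete (h : GreedyInv n s p d₀ src wj (2 * 2 ^ s + 2) d) :
    Complete s p d₀ src wj d :=
  h.progress.resolve_left fun h1 => by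
    have := h.valid.echelon.le
    omega

/-- Adds the best candidate to the family. -/
def roundProg : Prog :=
  scanProg ;;
  .cond (.ile (.lit 1) (var bkFnd))
    (.iset bkCnt (.lit 0) (.add (var bkCnt) (.lit 1)) ;;
     .iset bkRank (.lit 0) (.add (var bkRank) (.lit 1))) .skip

variable {I : JobSet K n} {M : ℕ} {step : ℕ → ℕ} {tau : ℕ → K}

theorem run_roundProg {σ : State K} (hσ : Prepared I s p M step tau σ) (hp : n + s + 1 < p)
    {beg en : ℕ → ℕ} {prev x t : ℕ} (hd : d₀.Valid n s p) (hr : d₀.rank = 0)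
    (hI : GreedyInv n s p d₀ (Src I M step tau beg en prev x n) (jobProfit I tau x) t (dataOf s σ))
    (hx : σ.imem bkV1 0 = x) (hprev : σ.imem bkPrev 0 = prev)
    (hbeg : σ.imem bkBeg = beg) (hen : σ.imem bkEnd = en) (hcnt : ∀ z, en z ≤ d₀.cnt)
    (hsize : ∀ z, en z ≤ beg z + (2 * 2 ^ s + 2)) (hks : d₀.k < s) :
    Run I.oracle roundProg σ (7000 * (n + 1) * (2 * 2 ^ s + 2) ^ 3) (fun σ' =>
      GreedyInv n s p d₀ (Src I M step tau beg en prev x n) (jobProfit I tau x) (t + 1)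
        (dataOf s σ')) := by
  have hcnt' : d₀.cnt ≤ (dataOf s σ).cnt := by rw [hI.cnt]; omega
  have hlist : ∀ {j e}, Src I M step tau beg en prev x n j e →
      (dataOf s σ).list e = d₀.list e ∧ (dataOf s σ).wt e = d₀.wt e ∧ e < d₀.cnt := by
    intro j e h
    have he : e < d₀.cnt := h.2.2.trans_le (hcnt _)
    exact ⟨hI.agree.list_eq hd he, hI.agree.wt e he, he⟩
  refine Run.bind (U := 30) _ (run_scanProg hσ hp hI.valid (dataOf_in s σ) hx hprev hbeg hen
    (fun z => (hcnt z).trans hcnt') hsize (by rwa [hI.agree.k])) (fun σ₁ hF₁ h1 => ?_) ?_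
  · refine Run.block ?_
    have hA := h1.data.agree
    rcases h1.found with h0 | h0
    · simp [h0]
      refine hI.of_spanned hA h1.data.cnt h1.data.rank hr fun j e hs hne => ?_
      have h2 := h1.handled j e hs (by rwa [(hlist hs).1])
      rw [(hlist hs).1] at h2
      exact h2.resolve_right fun h3 => by simp [h0] at h3
    · simp [h0]
      obtain ⟨j, e, hs, hne, hj, he, hw, hext⟩ := h1.best h0
      rw [(hlist hs).1] at hne hext
      rw [(hlist hs).2.1] at hw
      have hcn := h1.data.cnt
      have hra := h1.data.rank
      refine hI.extend ⟨?_, ?_, ?_, ?_, ?_, ?_⟩ ?_ ?_ hr ?_ ?_ ?_ ?_ ?_ ?_ ?_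
      · simpa [dataOf] using hA.k
      · simpa [dataOf] using hA.job
      · simpa [dataOf] using hA.nxt
      · simpa [dataOf] using hA.wt
      · simpa [dataOf] using hA.bas
      · simpa [dataOf] using hA.piv
      · simp [dataOf] at hcn ⊢; exact hcn
      · simp [dataOf] at hra ⊢; exact hra
      · simp [dataOf] at hj he ⊢; rw [hj, he]; exact hs
      · simp [dataOf] at hj ⊢; rw [hj]; exact hs.1.le
      · simp [dataOf] at he ⊢; rw [he]; exact (hlist hs).2.2.trans_le hcnt'
      · simp [dataOf] at hj he ⊢; rw [hj, he]; exact hne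
      · simp [dataOf] at hj he hw ⊢; rw [hj, he]; exact hw
      · simp [dataOf] at hj he hext ⊢; rw [hj, he]; exact hext
      · intro j' e' hs' hne'
        have h2 := h1.handled j' e' hs' (by rwa [(hlist hs').1])
        rw [(hlist hs').1, (hlist hs').2.1] at h2
        exact h2.imp_right fun h3 => by simpa [dataOf] using h3.2
  · have h2 : 1 ≤ (2 * 2 ^ s + 2) ^ 3 := Nat.one_le_pow _ _ (by omega)
    nlinarith

end Greedy

/-! ### Representative families -/

section Families

/-- Disjointness from a fixed list of jobs is detected by a linear functional of the vectors. -/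
theorem exists_lin_jobVec {n s p k : ℕ} [Fact p.Prime] (hp : n + s + 1 < p) (B : List ℕ)
    (hB : ∀ b ∈ B, b < n) (hk : k + B.length ≤ s) :
    ∃ c : ℕ → ZMod p, ∀ Y : List ℕ, (∀ y ∈ Y, y < n) → Y.length = k →
      (lin (2 * 2 ^ s + 1) c (jobVec p s Y) ≠ 0 ↔ ∀ y ∈ Y, y ∉ B) := by
  have hcast : ∀ a < p, ∀ b < p, (a : ZMod p) = b → a = b := by
    intro a ha b hb hab
    rw [ZMod.natCast_eq_natCast_iff', Nat.mod_eq_of_lt ha, Nat.mod_eq_of_lt hb] at hab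
    exact hab
  obtain ⟨c, hc⟩ := exists_functional (F := ZMod p) (s := s) (k := k)
    (fun a ha b hb hab => hcast a (by simp at ha; omega) b (by simp at hb; omega) hab)
    (B.map Nat.cast) (by simpa using hk)
  refine ⟨c, fun Y hY hYk => ?_⟩
  rw [lin, jobVec, hc _ (by simpa using hYk), prod_prod_sub_ne_zero_iff]
  simp only [List.mem_map, not_exists, not_and, forall_exists_index, and_imp,
    forall_apply_eq_imp_iff₂]
  constructor
  · intro h y hy hyB
    exact h y hyB y hy rfl
  · intro h b hb y hy hyb
    obtain rfl := hcast y (by have := hY y hy; omega) b (by have := hB b hb; omega) hyb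
    exact h y hy hb

variable {K : Type*} [AddCommGroup K] [LinearOrder K] {n : ℕ} {I : JobSet K n} {s p M : ℕ}
  {step : ℕ → ℕ} {tau : ℕ → K}

/-- The state `x` is reached by at most `s - k` jobs. -/
def Reaches (n s M : ℕ) (step : ℕ → ℕ) (k x : ℕ) : Prop :=
  ∃ i ≤ n, ∃ l : List ℕ, (∀ j ∈ l, j < n) ∧ l.length + k ≤ s ∧ x = i * M + (l.map step).sum

theorem Reaches.lt (hT : IsStateTable I s M step tau) {k x : ℕ} (h : Reaches n s M step k x) :
    x < (n + 1) * M := by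
  obtain ⟨i, hi, l, hl, hs, rfl⟩ := h
  have h1 := hT.lt l hl (by omega)
  have h2 := Nat.mul_le_mul_right M hi
  rw [add_mul]
  omega

theorem Reaches.succState (hT : IsStateTable I s M step tau) {k x j : ℕ}
    (h : Reaches n s M step (k + 1) x) (hj : j < n) :
    Reaches n s M step k (succState I M step tau x j) ∧
      tau (GPSP.succState I M step tau x j) = max (tau x) (I.rel j) + I.len j := by
  obtain ⟨i, hi, l, hl, hs, rfl⟩ := h
  unfold GPSP.succState
  split_ifs with hc
  · have hl' : ∀ a ∈ j :: l, a < n := by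
      intro a ha
      rcases List.mem_cons.1 ha with rfl | ha
      exacts [hj, hl a ha]
    have he : i * M + (l.map step).sum + step j = i * M + ((j :: l).map step).sum := by
      simp only [List.map_cons, List.sum_cons]; ring
    refine ⟨⟨i, hi, j :: l, hl', by simp; omega, he⟩, ?_⟩
    rw [he, hT.tau i hi _ hl' (by simp; omega), max_eq_left hc, hT.tau i hi l hl (by omega)]
    simp only [List.map_cons, List.sum_cons]
    abel
  · have hl' : ∀ a ∈ [j], a < n := by simpa using hj
    have he : j * M + step j = j * M + ([j].map step).sum := by simp
    refine ⟨⟨j, hj.le, [j], hl', by simp; omega, he⟩, ?_⟩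
    rw [he, hT.tau j hj.le _ hl' (by simp; omega), max_eq_right (not_le.1 hc).le]
    simp

/-- The entries from `b` to `b'` represent the sequences of `k` jobs that start in the state `x`:
each entry is such a sequence, with its profit, and for every sequence `l` and every list `B` of at
most `s - k` jobs that is disjoint from `l` there is an entry that is disjoint from `B` and at least
as profitable as `l`. -/
structure IsFamily (I : JobSet K n) (s : ℕ) (tau : ℕ → K) (job nxt : ℕ → ℕ) (wt : ℕ → K)
    (k x b b' : ℕ) : Prop where
  sound : ∀ e, b ≤ e → e < b' → (chain job nxt k e).Nodup ∧ (∀ j ∈ chain job nxt k e, j < n) ∧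
    wt e = I.value (tau x) (chain job nxt k e)
  rep : ∀ l : List ℕ, l.Nodup → (∀ j ∈ l, j < n) → l.length = k →
    ∀ B : List ℕ, (∀ j ∈ B, j < n) → B.length + k ≤ s → (∀ j ∈ l, j ∉ B) →
    ∃ e, b ≤ e ∧ e < b' ∧ (∀ j ∈ chain job nxt k e, j ∉ B) ∧ I.value (tau x) l ≤ wt e

theorem IsFamily.congr {job nxt job' nxt' : ℕ → ℕ} {wt wt' : ℕ → K} {k x b b' cnt : ℕ}
    (h : IsFamily I s tau job nxt wt k x b b') (hb : b' ≤ cnt)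
    (hj : ∀ e < cnt, job' e = job e) (hn : ∀ e < cnt, nxt' e = nxt e)
    (hw : ∀ e < cnt, wt' e = wt e) (hlt : ∀ e < cnt, nxt e < cnt) :
    IsFamily I s tau job' nxt' wt' k x b b' := by
  refine ⟨fun e h1 h2 => ?_, fun l h1 h2 h3 B h4 h5 h6 => ?_⟩
  · rw [chain_congr hj hn hlt (h2.trans_le hb), hw e (h2.trans_le hb)]
    exact h.sound e h1 h2
  · obtain ⟨e, h7, h8, h9, h10⟩ := h.rep l h1 h2 h3 B h4 h5 h6
    refine ⟨e, h7, h8, ?_, ?_⟩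
    · rwa [chain_congr hj hn hlt (h8.trans_le hb)]
    · rwa [hw e (h8.trans_le hb)]

theorem IsFamily.zero {job nxt : ℕ → ℕ} {wt : ℕ → K} {x : ℕ} (hw : wt 0 = 0) :
    IsFamily I s tau job nxt wt 0 x 0 1 := by
  refine ⟨fun e _ h2 => ?_, fun l _ _ h3 B _ _ _ => ⟨0, le_rfl, one_pos, by simp [chain], ?_⟩⟩
  · obtain rfl : e = 0 := by omega
    simp [chain, seqProfit, hw]
  · rw [List.length_eq_zero_iff.1 h3, hw]; rfl

variable [IsOrderedAddMonoid K] [Fact p.Prime]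

/-- A complete greedy construction on top of representative families of the next states gives a
representative family. -/
theorem FamilyInv.isFamily (hT : IsStateTable I s M step tau) (hp : n + s + 1 < p)
    {d₀ d : ScanData K} {beg en : ℕ → ℕ} {prev x : ℕ} (hd : d₀.Valid n s p)
    (h : FamilyInv n s p d₀ (Src I M step tau beg en prev x n) (jobProfit I tau x) d)
    (hC : Complete s p d₀ (Src I M step tau beg en prev x n) (jobProfit I tau x) d)
    (hcnt : ∀ z, en z ≤ d₀.cnt) (hx : Reaches n s M step (d₀.k + 1) x)
    (hprev : ∀ y, Reaches n s M step d₀.k y →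
      IsFamily I s tau d₀.job d₀.nxt d₀.wt d₀.k y (beg (prev + y)) (en (prev + y))) :
    IsFamily I s tau d.job d.nxt d.wt (d₀.k + 1) x d₀.cnt d.cnt := by
  have hlist : ∀ {j e}, Src I M step tau beg en prev x n j e → d.list e = d₀.list e :=
    fun hs => h.agree.list_eq hd (hs.2.2.trans_le (hcnt _))
  have hmem : ∀ i < d.rank, (d₀.member d i).Nodup ∧ (∀ j ∈ d₀.member d i, j < n) ∧
      d.wt (d₀.cnt + i) = I.value (tau x) (d₀.member d i) := by
    intro i hi
    obtain ⟨h1, h2, h3⟩ := h.entry i hi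
    obtain ⟨h4, h5⟩ := hx.succState hT h1.1
    obtain ⟨h6, h7, h8⟩ := (hprev _ h4).sound _ h1.2.1 h1.2.2
    refine ⟨List.nodup_cons.2 ⟨h2, h6⟩, fun j hj => ?_, ?_⟩
    · rcases List.mem_cons.1 hj with rfl | hj
      exacts [h1.1, h7 j hj]
    · rw [h3, h8, h5]; rfl
  have hchain : ∀ i < d.rank, chain d.job d.nxt (d₀.k + 1) (d₀.cnt + i) = d₀.member d i := by
    intro i hi
    have := hlist (h.entry i hi).1
    rw [ScanData.list, h.agree.k] at this
    rw [chain, this]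
  refine ⟨fun e h1 h2 => ?_, fun l h1 h2 h3 B h4 h5 h6 => ?_⟩
  · obtain ⟨i, rfl⟩ := Nat.exists_eq_add_of_le h1
    have hi : i < d.rank := by rw [h.cnt] at h2; omega
    rw [hchain i hi]
    exact hmem i hi
  · obtain _ | ⟨j, l⟩ := l
    · simp at h3
    have hj : j < n := h2 j (by simp)
    rw [List.nodup_cons] at h1
    obtain ⟨h7, h8⟩ := hx.succState hT hj
    -- The tail of `l` is replaced by a list `e` that avoids `j` and `B`; the candidate `(j, e)` is
    -- then dominated for the functional that detects disjointness from `B`.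
    obtain ⟨e, h9, h10, h11, h12⟩ := (hprev _ h7).rep l h1.2 (fun a ha => h2 a (by simp [ha]))
      (by simpa using h3) (j :: B) (fun b hb => by
        rcases List.mem_cons.1 hb with rfl | hb
        exacts [hj, h4 b hb]) (by simp; omega) (fun a ha hab => by
        rcases List.mem_cons.1 hab with rfl | hab
        exacts [h1.1 ha, h6 a (by simp [ha]) hab])
    have hs : Src I M step tau beg en prev x n j e := ⟨hj, h9, h10⟩
    have hje : j ∉ d₀.list e := fun hje => h11 j hje (by simp)
    obtain ⟨c, hc⟩ := exists_lin_jobVec hp B h4 (k := d₀.k + 1) (by omega)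
    obtain ⟨i, hi, h13, h14⟩ := hC j e hs hje c ((hc _ (fun y hy => by
      rcases List.mem_cons.1 hy with rfl | hy
      exacts [hj, ((hprev _ h7).sound e h9 h10).2.1 y hy]) (by simp [length_chain])).2
      (fun y hy => by
      rcases List.mem_cons.1 hy with rfl | hy
      · exact h6 y (by simp)
      · exact fun hyB => h11 y hy (by simp [hyB])))
    refine ⟨d₀.cnt + i, by omega, by rw [h.cnt]; omega, ?_, le_trans ?_ h14⟩
    · rw [hchain i hi]
      exact (hc _ (hmem i hi).2.1 (by simp [length_chain])).1 h13
    · rw [h8] at h12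
      exact add_le_add_right h12 _

end Families

/-! ### The dynamic program -/

section Layers

variable {K : Type*} [AddCommGroup K] [LinearOrder K] {n : ℕ} {I : JobSet K n} {s p M : ℕ}
  {step : ℕ → ℕ} {tau : ℕ → K} {f : ℕ → K → K}

/-- The memory holds representative families for all layers and states whose index is below
`cur`, with index `k * ((n + 1) * M) + x` for the state `x` in the layer `k`. -/
structure HasFamilies (I : JobSet K n) (s M : ℕ) (step : ℕ → ℕ) (tau : ℕ → K) (cur : ℕ)
    (σ : State K) : Prop where
  cur_eq : σ.imem bkCur 0 = cur
  job_le : ∀ e < σ.imem bkCnt 0, σ.imem bkJob e ≤ n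
  nxt_lt : ∀ e < σ.imem bkCnt 0, σ.imem bkNxt e < σ.imem bkCnt 0
  end_le : ∀ z, σ.imem bkEnd z ≤ σ.imem bkCnt 0
  size : ∀ z, σ.imem bkEnd z ≤ σ.imem bkBeg z + (2 * 2 ^ s + 2)
  family : ∀ k x, Reaches n s M step k x → k * ((n + 1) * M) + x < cur →
    IsFamily I s tau (σ.imem bkJob) (σ.imem bkNxt) (σ.vmem vbWt) k x
      (σ.imem bkBeg (k * ((n + 1) * M) + x)) (σ.imem bkEnd (k * ((n + 1) * M) + x))

theorem HasFamilies.frame {cur : ℕ} {σ σ' : State K} {P : Prog}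
    (h : HasFamilies I s M step tau cur σ) (hF : Frame P σ σ')
    (hP : (∀ b ∈ [bkCur, bkCnt, bkJob, bkNxt, bkBeg, bkEnd], P.wI b = false) ∧
      ∀ b ∈ [vbWt], P.wV b = false := by decide) : HasFamilies I s M step tau cur σ' := by
  simp only [List.mem_cons, List.not_mem_nil, or_false, forall_eq_or_imp, forall_eq] at hP
  obtain ⟨⟨h0, h1, h2, h3, h4, h5⟩, k0⟩ := hP
  constructor
  · rw [hF.i _ h0]; exact h.cur_eq
  · rw [hF.i _ h1, hF.i _ h2]; exact h.job_le
  · rw [hF.i _ h1, hF.i _ h3]; exact h.nxt_lt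
  · rw [hF.i _ h1, hF.i _ h5]; exact h.end_le
  · rw [hF.i _ h4, hF.i _ h5]; exact h.size
  · rw [hF.i _ h2, hF.i _ h3, hF.i _ h4, hF.i _ h5, hF.v _ k0]; exact h.family

/-- Builds the family of the state `bkV1` in layer `bkV0 + 1`. -/
def familyProg : Prog :=
  .iset bkBeg (var bkCur) (var bkCnt) ;; .iset bkRank (.lit 0) (.lit 0) ;;
  forLoop bkV2 (.add (var bkDim) (.lit 1)) roundProg ;;
  .iset bkEnd (var bkCur) (var bkCnt) ;; .iset bkCur (.lit 0) (.add (var bkCur) (.lit 1))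

/-- Builds the families of the layer `0`: they consist of the entry `0`, the empty list. -/
def firstLayerProg : Prog :=
  .iset bkCnt (.lit 0) (.lit 1) ;; .iset bkPrev (.lit 0) (.lit 0) ;;
  .iset bkCur (.lit 0) (var bkStates) ;;
  forLoop bkV1 (var bkStates) (.iset bkEnd (var bkV1) (.lit 1))

/-- Builds the families of all layers. -/
def layersProg : Prog :=
  firstLayerProg ;;
  forLoop bkV0 (.cell 0 (.lit 1))
    (forLoop bkV1 (var bkStates) familyProg ;;
     .iset bkPrev (.lit 0) (.add (var bkPrev) (var bkStates)))

theorem run_firstLayerProg {σ : State K} (hσ : Prepared I s p M step tau σ)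
    (hj : σ.imem bkJob 0 = 0) (hn : σ.imem bkNxt 0 = 0) (hw : σ.vmem vbWt 0 = 0)
    (hb : σ.imem bkBeg = fun _ => 0) (he : σ.imem bkEnd = fun _ => 0) :
    Run f firstLayerProg σ (50 * ((n + 1) * M + 1)) (fun σ' =>
      HasFamilies I s M step tau ((n + 1) * M) σ' ∧ σ'.imem bkPrev 0 = 0) := by
  refine Run.bind (T := 3) (fun σ₁ => σ₁.imem bkCnt 0 = 1) (Run.block (by simp)) (fun σ₁ hF₁ h1 =>
    Run.bind (T := 3) (fun σ₂ => σ₂.imem bkPrev 0 = 0) (Run.block (by simp)) (fun σ₂ hF₂ h2 =>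
    Run.bind (T := 5) (fun σ₃ => σ₃.imem bkCur 0 = (n + 1) * M)
      (Run.block (by simp [((hσ.frame hF₁).frame hF₂).states])) (fun σ₃ hF₃ h3 =>
    Run.post (Run.forLoop (N := (n + 1) * M) (T := 10) (fun i σ' => ∀ z,
      σ'.imem bkEnd z = if z < i then 1 else 0) rfl ?_ ?_ ?_) ?_) le_rfl) le_rfl) ?_
  · intro σ' hF
    simp [((((hσ.frame hF₁).frame hF₂).frame hF₃).frame hF).states]
  · simp [hF₃.i bkEnd rfl, hF₂.i bkEnd rfl, hF₁.i bkEnd rfl, he]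
  · intro i σ' hi hv hF h4
    refine Run.block fun z => ?_
    by_cases hz : z = i
    · simp [hv, hz]
    · have : z < i + 1 ↔ z < i := by omega
      simp only [this]
      simpa [hv, hz] using h4 z
  · intro σ' hF h4
    have hcnt : σ'.imem bkCnt 0 = 1 := by
      rw [hF.i bkCnt rfl, hF₃.i bkCnt rfl, hF₂.i bkCnt rfl, h1]
    have hjob : σ'.imem bkJob 0 = 0 := by
      rw [hF.i bkJob rfl, hF₃.i bkJob rfl, hF₂.i bkJob rfl, hF₁.i bkJob rfl, hj]
    have hnxt : σ'.imem bkNxt 0 = 0 := by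
      rw [hF.i bkNxt rfl, hF₃.i bkNxt rfl, hF₂.i bkNxt rfl, hF₁.i bkNxt rfl, hn]
    have hbeg : σ'.imem bkBeg = fun _ => 0 := by
      rw [hF.i bkBeg rfl, hF₃.i bkBeg rfl, hF₂.i bkBeg rfl, hF₁.i bkBeg rfl, hb]
    have hwt : σ'.vmem vbWt 0 = 0 := by
      rw [hF.v vbWt rfl, hF₃.v vbWt rfl, hF₂.v vbWt rfl, hF₁.v vbWt rfl, hw]
    refine ⟨⟨?_, ?_, ?_, ?_, ?_, ?_⟩, ?_⟩
    · rw [hF.i bkCur rfl, h3]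
    · rw [hcnt]; intro e h; obtain rfl : e = 0 := by omega
      omega
    · rw [hcnt]; intro e h; obtain rfl : e = 0 := by omega
      omega
    · intro z; rw [hcnt, h4]; split_ifs <;> omega
    · intro z; rw [h4]; split_ifs <;> omega
    · intro k x hx hlt
      obtain rfl : k = 0 := by
        by_contra hk
        have := Nat.mul_le_mul_right ((n + 1) * M) (Nat.one_le_iff_ne_zero.2 hk)
        rw [one_mul] at this
        omega
      rw [h4, if_pos hlt, hbeg]
      exact IsFamily.zero hwt
    · rw [hF.i bkPrev rfl, hF₃.i bkPrev rfl, h2]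
  · simp only [IExp.cost]; omega

variable [IsOrderedAddMonoid K] [Fact p.Prime]

theorem run_familyProg {σ : State K} (hT : IsStateTable I s M step tau)
    (hσ : Prepared I s p M step tau σ) (hp : n + s + 1 < p) {k x : ℕ}
    (hI : HasFamilies I s M step tau ((k + 1) * ((n + 1) * M) + x) σ)
    (hk : σ.imem bkV0 0 = k) (hks : k < s) (hx : σ.imem bkV1 0 = x) (hxM : x < (n + 1) * M)
    (hprev : σ.imem bkPrev 0 = k * ((n + 1) * M)) :
    Run I.oracle familyProg σ (10000 * (n + 1) * (2 * 2 ^ s + 2) ^ 4)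
      (HasFamilies I s M step tau ((k + 1) * ((n + 1) * M) + (x + 1))) := by
  obtain ⟨cur, hcur⟩ : ∃ cur, (k + 1) * ((n + 1) * M) + x = cur := ⟨_, rfl⟩
  rw [hcur] at hI
  obtain ⟨cnt, hcnt⟩ : ∃ cnt, σ.imem bkCnt 0 = cnt := ⟨_, rfl⟩
  -- The cell `bkBeg cur` is written before, and `bkEnd cur` after the rounds; in between, the
  -- family `cur` is not read.
  obtain ⟨beg, hbeg⟩ : ∃ beg, Function.update (σ.imem bkBeg) cur cnt = beg := ⟨_, rfl⟩
  obtain ⟨en, hen⟩ : ∃ en, σ.imem bkEnd = en := ⟨_, rfl⟩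
  have hend : ∀ z, en z ≤ cnt := by have := hI.end_le; rwa [hcnt, hen] at this
  have hsize : ∀ z, en z ≤ beg z + (2 * 2 ^ s + 2) := by
    intro z
    rw [← hbeg, Function.update_apply]
    split_ifs
    · exact (hend z).trans (Nat.le_add_right _ _)
    · rw [← hen]; exact hI.size z
  obtain ⟨Q, hQ⟩ : ∃ Q, (2 * 2 ^ s + 2) ^ 3 = Q := ⟨_, rfl⟩
  refine Run.bind (T := 10) (fun σ₁ => σ₁.imem bkBeg = beg)
    (Run.block (by simp [hI.cur_eq, hcnt, ← hbeg, State.setI])) (fun σ₁ hF₁ h1 =>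
    Run.bind (T := 5) (U := (2 * 2 ^ s + 3) * (7000 * (n + 1) * Q + 15) + 30)
      (fun σ₂ => σ₂.imem bkRank 0 = 0) (Run.block (by simp)) (fun σ₂ hF₂ h2 => ?_) le_rfl) ?_
  rotate_left
  · have h1 : 4 ≤ 2 * 2 ^ s + 2 := by have := Nat.one_le_two_pow (n := s); omega
    rw [pow_succ, hQ]
    have h2 : 1 ≤ Q := hQ ▸ Nat.one_le_pow _ _ (by omega)
    rw [show 2 * 2 ^ s + 3 = (2 * 2 ^ s + 2) + 1 by omega]
    generalize 2 * 2 ^ s + 2 = B at h1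
    have h3 : 1 ≤ (n + 1) * Q := Nat.mul_pos n.succ_pos h2
    rw [mul_assoc 7000, ← mul_assoc (10000 * (n + 1)), mul_assoc 10000]
    generalize (n + 1) * Q = W at h3
    nlinarith [Nat.mul_le_mul h3 h1]
  have hcnt₂ : σ₂.imem bkCnt 0 = cnt := by rw [hF₂.i bkCnt rfl, hF₁.i bkCnt rfl, hcnt]
  have hσ₂ := (hσ.frame hF₁).frame hF₂
  have hd : (dataOf s σ₂).Valid n s p := by
    refine ⟨?_, ?_, ?_⟩
    · simp only [dataOf, hF₂.i bkCnt rfl, hF₁.i bkCnt rfl, hF₂.i bkJob rfl, hF₁.i bkJob rfl]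
      exact hI.job_le
    · simp only [dataOf, hF₂.i bkCnt rfl, hF₁.i bkCnt rfl, hF₂.i bkNxt rfl, hF₁.i bkNxt rfl]
      exact hI.nxt_lt
    · simp only [dataOf, h2]
      exact ⟨by simp, by simp, by simp, by simp⟩
  have hk₂ : σ₂.imem bkV0 0 = k := by rw [hF₂.i bkV0 rfl, hF₁.i bkV0 rfl, hk]
  refine Run.bind _ (Run.forLoop (N := 2 * 2 ^ s + 2) (T := 7000 * (n + 1) * Q)
      (fun t σ' => GreedyInv n s p (dataOf s σ₂) (Src I M step tau beg en (k * ((n + 1) * M)) x n)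
        (jobProfit I tau x) t (dataOf s σ')) rfl ?_ ?_ ?_)
    (fun σ₃ hF₃ h3 => Run.block (T := 30) ?_) le_rfl
  · intro σ' hF
    simp [(hσ₂.frame hF).dim]
  · have : dataOf s (σ₂.setI bkV2 0 0) = dataOf s σ₂ := by simp [dataOf]
    rw [this]
    exact GreedyInv.zero hd h2
  · intro t σ' ht hv hF h3
    rw [← hQ]
    refine (run_roundProg (hσ₂.frame hF) hp hd h2 h3
      (by rw [hF.i bkV1 rfl, hF₂.i bkV1 rfl, hF₁.i bkV1 rfl, hx])
      (by rw [hF.i bkPrev rfl, hF₂.i bkPrev rfl, hF₁.i bkPrev rfl, hprev])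
      (by rw [hF.i bkBeg rfl, hF₂.i bkBeg rfl, h1])
      (by rw [hF.i bkEnd rfl, hF₂.i bkEnd rfl, hF₁.i bkEnd rfl, hen])
      (fun z => (hend z).trans hcnt₂.ge) hsize (hk₂.trans_lt hks)).post fun σ'' _ h4 => ?_
    have : dataOf s (σ''.setI bkV2 0 (t + 1)) = dataOf s σ'' := by simp [dataOf]
    rw [this]
    exact h4
  · have hC := h3.complete
    have hcur₃ : σ₃.imem bkCur 0 = cur := by
      rw [hF₃.i bkCur rfl, hF₂.i bkCur rfl, hF₁.i bkCur rfl, hI.cur_eq]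
    have hbeg₃ : σ₃.imem bkBeg = beg := by rw [hF₃.i bkBeg rfl, hF₂.i bkBeg rfl, h1]
    have hen₃ : σ₃.imem bkEnd = en := by
      rw [hF₃.i bkEnd rfl, hF₂.i bkEnd rfl, hF₁.i bkEnd rfl, hen]
    have hcnt₃ : σ₃.imem bkCnt 0 = cnt + σ₃.imem bkRank 0 := by
      have := h3.cnt
      simpa only [dataOf, hcnt₂] using this
    have hrank : σ₃.imem bkRank 0 ≤ 2 * 2 ^ s + 1 := h3.valid.echelon.le
    have hA := h3.agree
    have hjob : σ₂.imem bkJob = σ.imem bkJob := by rw [hF₂.i bkJob rfl, hF₁.i bkJob rfl]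
    have hnxt : σ₂.imem bkNxt = σ.imem bkNxt := by rw [hF₂.i bkNxt rfl, hF₁.i bkNxt rfl]
    have hwt : σ₂.vmem vbWt = σ.vmem vbWt := by rw [hF₂.v vbWt rfl, hF₁.v vbWt rfl]
    have hajob : ∀ e < cnt, σ₃.imem bkJob e = σ.imem bkJob e := fun e he => by
      rw [← hjob]; exact hA.job e (by simpa only [dataOf, hcnt₂] using he)
    have hanxt : ∀ e < cnt, σ₃.imem bkNxt e = σ.imem bkNxt e := fun e he => by
      rw [← hnxt]; exact hA.nxt e (by simpa only [dataOf, hcnt₂] using he)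
    have hawt : ∀ e < cnt, σ₃.vmem vbWt e = σ.vmem vbWt e := fun e he => by
      rw [← hwt]; exact hA.wt e (by simpa only [dataOf, hcnt₂] using he)
    have hnl : ∀ e < cnt, σ.imem bkNxt e < cnt := hcnt ▸ hI.nxt_lt
    have hold : ∀ k' y, Reaches n s M step k' y → k' * ((n + 1) * M) + y < cur →
        IsFamily I s tau (σ.imem bkJob) (σ.imem bkNxt) (σ.vmem vbWt) k' y
          (beg (k' * ((n + 1) * M) + y)) (en (k' * ((n + 1) * M) + y)) := by
      intro k' y hy hlt
      have := hI.family k' y hy hlt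
      rwa [hen, ← Function.update_of_ne hlt.ne cnt (σ.imem bkBeg), hbeg] at this
    have hnew : Reaches n s M step (k + 1) x →
        IsFamily I s tau (σ₃.imem bkJob) (σ₃.imem bkNxt) (σ₃.vmem vbWt) (k + 1) x cnt
          (σ₃.imem bkCnt 0) := by
      intro hxr
      have := FamilyInv.isFamily hT hp hd h3.toFamilyInv hC (fun z => (hend z).trans hcnt₂.ge)
        (by simpa only [dataOf, hk₂] using hxr) (fun y hy => by
          simp only [dataOf, hk₂, hjob, hnxt, hwt] at hy ⊢
          refine hold k y hy ?_
          have := hy.lt hT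
          rw [← hcur, Nat.succ_mul k]
          omega)
      simpa only [dataOf, hk₂, hcnt₂] using this
    constructor
    · simp [hcur₃, ← hcur, add_assoc]
    · simpa [dataOf] using h3.valid.job_le
    · simpa [dataOf] using h3.valid.nxt_lt
    · intro z
      simp [hcur₃, hen₃]
      split_ifs
      · exact le_rfl
      · rw [hcnt₃]; exact (hend z).trans (Nat.le_add_right _ _)
    · intro z
      simp [hcur₃, hen₃, hbeg₃]
      split_ifs with hz
      · rw [hcnt₃, hz, ← hbeg, Function.update_self]; omega
      · exact hsize z
    · intro k' y hy hlt
      have hbc : beg cur = cnt := by rw [← hbeg, Function.update_self]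
      rw [← add_assoc, hcur, Nat.lt_succ_iff_lt_or_eq] at hlt
      rcases hlt with hlt | heq
      · have := (hold k' y hy hlt).congr (hend _) hajob hanxt hawt hnl
        simpa [hcur₃, hen₃, hbeg₃, hlt.ne] using this
      · have hyM := hy.lt hT
        have hkk : k' = k + 1 := by
          rw [← hcur] at heq
          rcases Nat.lt_trichotomy k' (k + 1) with h | h | h
          · have := Nat.mul_le_mul_right ((n + 1) * M) h
            rw [Nat.succ_mul] at this
            omega
          · exact h
          · have := Nat.mul_le_mul_right ((n + 1) * M) h
            rw [Nat.succ_mul] at this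
            omega
        subst hkk
        obtain rfl : y = x := by omega
        simpa [hcur₃, hbeg₃, hcur, hbc] using hnew hy

theorem run_layersProg {σ : State K} (hσ : Prepared I s p M step tau σ) (hp : n + s + 1 < p)
    (hT : IsStateTable I s M step tau)
    (hj : σ.imem bkJob 0 = 0) (hn : σ.imem bkNxt 0 = 0) (hw : σ.vmem vbWt 0 = 0)
    (hb : σ.imem bkBeg = fun _ => 0) (he : σ.imem bkEnd = fun _ => 0) :
    Run I.oracle layersProg σ
      (20000 * (s + 1) * ((n + 1) * M + 1) * (n + 1) * (2 * 2 ^ s + 2) ^ 4)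
      (HasFamilies I s M step tau ((s + 1) * ((n + 1) * M))) := by
  obtain ⟨Q, hQ⟩ : ∃ Q, (n + 1) * (2 * 2 ^ s + 2) ^ 4 = Q := ⟨_, rfl⟩
  refine Run.bind _ (run_firstLayerProg hσ hj hn hw hb he) (fun σ₁ hF₁ ⟨h1, h1'⟩ =>
    Run.post (Run.forLoop (N := s) (T := ((n + 1) * M + 1) * (10000 * Q + 20) + 20) (fun k σ' =>
      HasFamilies I s M step tau ((k + 1) * ((n + 1) * M)) σ' ∧
        σ'.imem bkPrev 0 = k * ((n + 1) * M)) rfl ?_ ?_ ?_) fun _ _ h => h.1) ?_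
  · intro σ' hF
    simp [((hσ.frame hF₁).frame hF).bound]
  · have hF₂ : Frame (.iset bkV0 (.lit 0) (.lit 0)) σ₁ (σ₁.setI bkV0 0 0) :=
      (Exec.iset (f := I.oracle) bkV0 (.lit 0) (.lit 0) σ₁).frame
    refine ⟨?_, by simpa using h1'⟩
    rw [zero_add, one_mul]
    exact h1.frame hF₂
  · rintro k σ' hk hv hF ⟨h2, h3⟩
    have hσ' := (hσ.frame hF₁).frame hF
    refine Run.bind _ (Run.forLoop (N := (n + 1) * M) (T := 10000 * Q) (fun x σ'' =>
      HasFamilies I s M step tau ((k + 1) * ((n + 1) * M) + x) σ'') rfl ?_ ?_ ?_)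
      (fun σ₂ hF₂ h4 => Run.with_frame (Run.block (T := 10)
        (R := fun σ₃ => σ₃.imem bkPrev 0 = (k + 1) * ((n + 1) * M)) ?_) |>.post ?_)
      (Nat.add_le_add (Nat.mul_le_mul_left _ (by simp only [IExp.cost]; omega)) (by omega))
    · intro σ'' hF'
      simp [(hσ'.frame hF').states]
    · have hF₂ : Frame (.iset bkV1 (.lit 0) (.lit 0)) σ' (σ'.setI bkV1 0 0) :=
        (Exec.iset (f := I.oracle) bkV1 (.lit 0) (.lit 0) σ').frame
      exact h2.frame hF₂
    · intro x σ'' hx hv' hF' h4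
      rw [← hQ, ← mul_assoc]
      refine (run_familyProg hT (hσ'.frame hF') hp h4 (by rw [hF'.i bkV0 rfl, hv]) hk hv' hx
        (by rw [hF'.i bkPrev rfl, h3])).post fun τ _ h5 => ?_
      have hF₂ : Frame (.iset bkV1 (.lit 0) (.lit (x + 1))) τ (τ.setI bkV1 0 (x + 1)) :=
        (Exec.iset (f := I.oracle) bkV1 (.lit 0) (.lit (x + 1)) τ).frame
      exact h5.frame hF₂ ⟨by simp [Prog.wI], by simp [Prog.wV]⟩
    · simp [hF₂.i bkPrev rfl, h3, (hσ'.frame hF₂).states]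
      ring
    · rintro σ₃ - ⟨hF₃, h5⟩
      have hF₄ : Frame (.iset bkV0 (.lit 0) (.lit (k + 1))) σ₃ (σ₃.setI bkV0 0 (k + 1)) :=
        (Exec.iset (f := I.oracle) bkV0 (.lit 0) (.lit (k + 1)) σ₃).frame
      refine ⟨?_, by simpa using h5⟩
      rw [Nat.succ_mul (k + 1)]
      exact (h4.frame hF₃).frame hF₄ ⟨by simp [Prog.wI], by simp [Prog.wV]⟩
  · rw [mul_assoc _ (n + 1), hQ]
    have h1 : 256 ≤ Q := by
      have h2 : 4 ≤ 2 * 2 ^ s + 2 := by have := Nat.one_le_two_pow (n := s); omega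
      have h3 := Nat.pow_le_pow_left h2 4
      rw [← hQ]
      nlinarith
    simp only [IExp.cost]
    generalize (n + 1) * M = X
    have h2 : 256 * (X + 1) ≤ Q * (X + 1) := Nat.mul_le_mul_right _ h1
    have h3 : (X + 1) * (10000 * Q + 20) + 20 + (1 + 1) + 11 ≤ 11000 * (Q * (X + 1)) := by nlinarith
    have h4 := Nat.mul_le_mul_left (s + 1) h3
    have h5 : 1 * (Q * (X + 1)) ≤ (s + 1) * (Q * (X + 1)) := Nat.mul_le_mul_right _ (by omega)
    nlinarith

end Layers

/-! ### The output -/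

section Output

variable {K : Type*} [AddCommGroup K] [LinearOrder K] {n : ℕ} {I : JobSet K n} {s p M : ℕ}
  {step : ℕ → ℕ} {tau : ℕ → K} {f : ℕ → K → K}

theorem chain_add (job nxt : ℕ → ℕ) (a b e : ℕ) :
    chain job nxt (a + b) e = chain job nxt a e ++ chain job nxt b (nxt^[a] e) := by
  induction a generalizing e with
  | zero => simp [chain]
  | succ a ih => rw [Nat.succ_add, chain, ih]; rfl

/-- Looks for the most profitable member of the families of the initial state, whose time is `0`, in
the layers `0, …, s`. -/
def bestProg : Prog :=
  .vset vbBest (.lit 0) .zero ;; .iset bkSize (.lit 0) (.lit 0) ;;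
  .iset bkZ (.lit 0) (.cell bkBase (.cell 0 (.lit 0))) ;;
  forLoop bkV0 (.add (.cell 0 (.lit 1)) (.lit 1))
    (.iset bkE (.lit 0) (.cell bkBeg (var bkZ)) ;;
     forLoop bkV1 (.sub (.cell bkEnd (var bkZ)) (.cell bkBeg (var bkZ)))
      (.cond (.vle (.cell vbWt (var bkE)) (.cell vbBest (.lit 0))) .skip
        (.vset vbBest (.lit 0) (.cell vbWt (var bkE)) ;; .iset bkBest (.lit 0) (var bkE) ;;
         .iset bkSize (.lit 0) (var bkV0)) ;;
       .iset bkE (.lit 0) (.add (var bkE) (.lit 1))) ;;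
     .iset bkZ (.lit 0) (.add (var bkZ) (var bkStates)))

/-- Sets the start times of the jobs of the chosen list, each one as early as possible. -/
def writeProg : Prog :=
  .vset vbTime (.lit 0) .zero ;;
  forLoop bkV0 (var bkSize)
    (.iset bkOut (.lit 0) (.cell bkJob (var bkBest)) ;;
     .cond (.vle (.cell vbRel (var bkOut)) (.cell vbTime (.lit 0))) .skip
      (.vset vbTime (.lit 0) (.cell vbRel (var bkOut))) ;;
     .vset vbStart (var bkOut) (.cell vbTime (.lit 0)) ;;
     .iset 1 (var bkOut) (.lit 1) ;;
     .vset vbTime (.lit 0) (.add (.cell vbTime (.lit 0)) (.cell vbLen (var bkOut))) ;;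
     .iset bkBest (.lit 0) (.cell bkNxt (var bkBest)))

/-- The chosen list is a job sequence whose profit is stored. -/
structure IsBest (I : JobSet K n) (s : ℕ) (job nxt : ℕ → ℕ) (σ : State K) : Prop where
  nodup : (chain job nxt (σ.imem bkSize 0) (σ.imem bkBest 0)).Nodup
  lt : ∀ j ∈ chain job nxt (σ.imem bkSize 0) (σ.imem bkBest 0), j < n
  size : σ.imem bkSize 0 ≤ s
  profit : σ.vmem vbBest 0 = I.value 0 (chain job nxt (σ.imem bkSize 0) (σ.imem bkBest 0))

theorem run_bestProg {σ : State K} (hσ : Prepared I s p M step tau σ)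
    (hT : IsStateTable I s M step tau)
    (hH : HasFamilies I s M step tau ((s + 1) * ((n + 1) * M)) σ) :
    Run f bestProg σ (400 * (s + 1) * (2 * 2 ^ s + 2)) (fun σ' =>
      IsBest I s (σ.imem bkJob) (σ.imem bkNxt) σ' ∧ ∀ l : List ℕ, l.Nodup → (∀ j ∈ l, j < n) →
        l.length ≤ s → I.value 0 l ≤ σ'.vmem vbBest 0) := by
  obtain ⟨X, hX⟩ : ∃ X, (n + 1) * M = X := ⟨_, rfl⟩
  have hreach : ∀ k ≤ s, Reaches n s M step k (n * M) := fun k hk =>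
    ⟨n, le_rfl, [], by simp, by simpa using hk, by simp⟩
  -- The initial state has the index `n * M`, because `I.rel n = 0`.
  have htau : tau (n * M) = 0 := by
    have := hT.tau n le_rfl [] (by simp) (by simp)
    simpa [JobSet.rel] using this
  have hM : 0 < M := by have := hT.lt [] (by simp) (by simp); omega
  have hfam : ∀ k ≤ s, IsFamily I s tau (σ.imem bkJob) (σ.imem bkNxt) (σ.vmem vbWt) k (n * M)
      (σ.imem bkBeg (k * X + n * M)) (σ.imem bkEnd (k * X + n * M)) := by
    intro k hk
    rw [← hX]
    refine hH.family k _ (hreach k hk) ?_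
    have := Nat.mul_le_mul_right ((n + 1) * M) (show k + 1 ≤ s + 1 by omega)
    rw [Nat.succ_mul k] at this
    have h2 : (n + 1) * M = n * M + M := by ring
    omega
  refine Run.bind (T := 3) (fun σ₁ => σ₁.vmem vbBest 0 = 0) (Run.block (by simp)) (fun σ₁ hF₁ h1 =>
    Run.bind (T := 3) (fun σ₂ => σ₂.imem bkSize 0 = 0) (Run.block (by simp)) (fun σ₂ hF₂ h2 =>
    Run.bind (T := 10) (fun σ₃ => σ₃.imem bkZ 0 = n * M) (Run.block ?_) (fun σ₃ hF₃ h3 =>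
    Run.post (Run.forLoop (N := s + 1) (T := 100 * (2 * 2 ^ s + 2) + 50) (fun k σ' =>
      σ'.imem bkZ 0 = k * X + n * M ∧ IsBest I s (σ.imem bkJob) (σ.imem bkNxt) σ' ∧
      ∀ l : List ℕ, l.Nodup → (∀ j ∈ l, j < n) → l.length < k → I.value 0 l ≤ σ'.vmem vbBest 0)
      rfl ?_ ?_ ?_) fun σ' _ h => ⟨h.2.1, fun l h1 h2 h3 => h.2.2 l h1 h2 (Nat.lt_succ_of_le h3)⟩)
      le_rfl) le_rfl) ?_
  · have := (hσ.frame hF₁).frame hF₂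
    simp [this.jobs, this.base n le_rfl]
  · intro σ' hF
    simp [((((hσ.frame hF₁).frame hF₂).frame hF₃).frame hF).bound]
  · have e1 : σ₃.imem bkSize 0 = 0 := by rw [hF₃.i bkSize rfl, h2]
    have e2 : σ₃.vmem vbBest 0 = 0 := by rw [hF₃.v vbBest rfl, hF₂.v vbBest rfl, h1]
    refine ⟨by simpa using h3, ⟨?_, ?_, ?_, ?_⟩, by simp⟩
    · simp [e1, chain]
    · simp [e1, chain]
    · simp [e1]
    · simp [e1, e2, chain, seqProfit]
  · rintro k σ' hk hv hF ⟨h4, h5, h6⟩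
    have hks : k ≤ s := Nat.lt_succ_iff.1 hk
    have hσ' := (((hσ.frame hF₁).frame hF₂).frame hF₃).frame hF
    have hbeg : σ'.imem bkBeg = σ.imem bkBeg := by
      rw [hF.i bkBeg rfl, hF₃.i bkBeg rfl, hF₂.i bkBeg rfl, hF₁.i bkBeg rfl]
    have hen : σ'.imem bkEnd = σ.imem bkEnd := by
      rw [hF.i bkEnd rfl, hF₃.i bkEnd rfl, hF₂.i bkEnd rfl, hF₁.i bkEnd rfl]
    have hwt : σ'.vmem vbWt = σ.vmem vbWt := by
      rw [hF.v vbWt rfl, hF₃.v vbWt rfl, hF₂.v vbWt rfl, hF₁.v vbWt rfl]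
    have hsz := hH.size (k * X + n * M)
    obtain ⟨hsound, hrep⟩ := hfam k hks
    rw [htau] at hsound hrep
    obtain ⟨b, hb⟩ : ∃ b, σ.imem bkBeg (k * X + n * M) = b := ⟨_, rfl⟩
    obtain ⟨e', he'⟩ : ∃ e', σ.imem bkEnd (k * X + n * M) = e' := ⟨_, rfl⟩
    rw [hb, he'] at hsound hrep hsz
    refine Run.bind (T := 5) (fun σ₄ => σ₄.imem bkE 0 = b) (Run.block ?_) (fun σ₄ hF₄ h7 =>
      Run.bind _ (Run.forLoop (N := e' - b) (T := 50) (fun i τ =>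
        τ.imem bkE 0 = b + i ∧ IsBest I s (σ.imem bkJob) (σ.imem bkNxt) τ ∧
        σ'.vmem vbBest 0 ≤ τ.vmem vbBest 0 ∧
        ∀ e, b ≤ e → e < b + i → σ.vmem vbWt e ≤ τ.vmem vbBest 0)
        rfl ?_ ?_ ?_)
      (fun σ₅ hF₅ ⟨h8, h9, h10, h11⟩ => Run.block (T := 10) ?_) le_rfl) ?_
    · simp [h4, hbeg, hb]
    · intro τ hF'
      simp [hF'.i bkEnd rfl, hF'.i bkBeg rfl, hF'.i bkZ rfl, hF₄.i bkEnd rfl, hF₄.i bkBeg rfl,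
        hF₄.i bkZ rfl, h4, hbeg, hen, hb, he']
    · have e1 : σ₄.imem bkSize = σ'.imem bkSize := hF₄.i bkSize rfl
      have e2 : σ₄.vmem vbBest = σ'.vmem vbBest := hF₄.v vbBest rfl
      have e3 : σ₄.imem bkBest = σ'.imem bkBest := hF₄.i bkBest rfl
      refine ⟨by simp [h7], ⟨?_, ?_, ?_, ?_⟩, by simp [e2], fun e h8 h9 => by omega⟩
      · simpa [e1, e3] using h5.nodup
      · simpa [e1, e3] using h5.lt
      · simpa [e1] using h5.size
      · simpa [e1, e2, e3] using h5.profit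
    · rintro i τ hi hv' hF' ⟨h8, h9, h10, h11⟩
      have e1 : τ.vmem vbWt = σ.vmem vbWt := by rw [hF'.v vbWt rfl, hF₄.v vbWt rfl, hwt]
      have e2 : τ.imem bkV0 0 = k := by rw [hF'.i bkV0 rfl, hF₄.i bkV0 rfl, hv]
      refine Run.block ?_
      obtain ⟨h12, h13, h14⟩ := hsound (b + i) (by omega) (by omega)
      have hlast : ∀ {w : K}, (∀ e, b ≤ e → e < b + i → σ.vmem vbWt e ≤ w) →
          σ.vmem vbWt (b + i) ≤ w → ∀ e, b ≤ e → e < b + (i + 1) → σ.vmem vbWt e ≤ w := by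
        intro w h15 h16 e h17 h18
        by_cases he : e = b + i
        · rw [he]; exact h16
        · exact h15 e h17 (by omega)
      by_cases hc : σ.vmem vbWt (b + i) ≤ τ.vmem vbBest 0
      · refine ⟨by simp [h8, e1, hc]; omega, ⟨?_, ?_, ?_, ?_⟩, ?_, ?_⟩
        · simpa [h8, e1, hc] using h9.nodup
        · simpa [h8, e1, hc] using h9.lt
        · simpa [h8, e1, hc] using h9.size
        · simpa [h8, e1, hc] using h9.profit
        · simpa [h8, e1, hc] using h10
        · simpa [h8, e1, hc] using hlast h11 hc
      · have hle := (not_le.1 hc).le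
        refine ⟨by simp [h8, e1, hc]; omega, ⟨?_, ?_, ?_, ?_⟩, ?_, ?_⟩
        · simpa [h8, e1, hc, e2] using h12
        · simpa [h8, e1, hc, e2] using h13
        · simpa [h8, e1, hc, e2] using hks
        · simpa [h8, e1, hc, e2] using h14
        · simpa [h8, e1, hc] using h10.trans hle
        · simpa [h8, e1, hc] using
            hlast (fun e h15 h16 => (h11 e h15 h16).trans hle) le_rfl
    · refine ⟨?_, ⟨?_, ?_, ?_, ?_⟩, fun l h12 h13 h14 => ?_⟩
      · simp [hF₅.i bkZ rfl, hF₄.i bkZ rfl, h4, ((hσ'.frame hF₄).frame hF₅).states, hX]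
        ring
      · simpa using h9.nodup
      · simpa using h9.lt
      · simpa using h9.size
      · simpa using h9.profit
      · suffices h : I.value 0 l ≤ σ₅.vmem vbBest 0 by simpa using h
        rcases Nat.lt_succ_iff_lt_or_eq.1 h14 with h14 | h14
        · exact (h6 l h12 h13 h14).trans h10
        · obtain ⟨e, h15, h16, -, h17⟩ := hrep l h12 h13 h14 [] (by simp) (by simpa using hks)
            (by simp)
          exact h17.trans (h11 e h15 (by omega))
    · have h8 : e' - b ≤ 2 * 2 ^ s + 2 := by omega
      simp only [IExp.cost]
      have h9 : (e' - b + 1) * 72 ≤ (2 * 2 ^ s + 3) * 72 := Nat.mul_le_mul_right _ (by omega)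
      have := Nat.one_le_two_pow (n := s)
      omega
  · have h4 : 4 ≤ 2 * 2 ^ s + 2 := by have := Nat.one_le_two_pow (n := s); omega
    simp only [IExp.cost]
    generalize 2 * 2 ^ s + 2 = B at h4
    nlinarith [Nat.mul_le_mul_left s h4]

/-- The invariant of the loop: whatever start times `st` extend those set so far, and are correct
for the rest of the list from the current time on, are correct for the whole list. -/
theorem run_writeProg {σ : State K} (hσ : Prepared I s p M step tau σ) {job nxt : ℕ → ℕ} {k e : ℕ}
    (hjob : σ.imem bkJob = job) (hnxt : σ.imem bkNxt = nxt) (hk : σ.imem bkSize 0 = k)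
    (he : σ.imem bkBest 0 = e) (hnd : (chain job nxt k e).Nodup) (h1 : ∀ j, σ.imem 1 j = 0) :
    Run f writeProg σ (100 * (k + 1)) (fun σ' =>
      Starts I.rel I.len (σ'.vmem vbStart) 0 (chain job nxt k e) ∧
      ∀ j, σ'.imem 1 j ≠ 0 ↔ j ∈ chain job nxt k e) := by
  refine Run.bind (T := 3) (fun σ₁ => σ₁.vmem vbTime 0 = 0) (Run.block (by simp)) (fun σ₁ hF₁ h2 =>
    Run.post (Run.forLoop (N := k) (T := 60) (fun i σ' => σ'.imem bkBest 0 = nxt^[i] e ∧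
      (∀ j, σ'.imem 1 j ≠ 0 ↔ j ∈ chain job nxt i e) ∧
      ∀ st : ℕ → K, (∀ j ∈ chain job nxt i e, st j = σ'.vmem vbStart j) →
        Starts I.rel I.len st (σ'.vmem vbTime 0) (chain job nxt (k - i) (nxt^[i] e)) →
        Starts I.rel I.len st 0 (chain job nxt k e)) rfl ?_ ?_ ?_) ?_) ?_
  · intro σ' hF
    simp [hF.i bkSize rfl, hF₁.i bkSize rfl, hk]
  · refine ⟨by simp [hF₁.i bkBest rfl, he], by simp [hF₁.i 1 rfl, h1, chain], fun st _ h3 => ?_⟩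
    simpa [h2] using h3
  · rintro i σ' hi hv hF ⟨h3, h4, h5⟩
    have hσ' := (hσ.frame hF₁).frame hF
    have e1 : σ'.imem bkJob = job := by rw [hF.i bkJob rfl, hF₁.i bkJob rfl, hjob]
    have e2 : σ'.imem bkNxt = nxt := by rw [hF.i bkNxt rfl, hF₁.i bkNxt rfl, hnxt]
    obtain ⟨J, hJ⟩ : ∃ J, job (nxt^[i] e) = J := ⟨_, rfl⟩
    have hrest : chain job nxt (k - i) (nxt^[i] e) =
        J :: chain job nxt (k - (i + 1)) (nxt^[i + 1] e) := by
      rw [show k - i = k - (i + 1) + 1 by omega, chain, hJ, Function.iterate_succ_apply']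
    have hsucc : chain job nxt (i + 1) e = chain job nxt i e ++ [J] := by
      rw [chain_succ_eq_append, hJ]
    have hJn : J ∉ chain job nxt i e := by
      rw [show k = i + (k - i) by omega, chain_add, hrest] at hnd
      exact fun h => (List.disjoint_of_nodup_append hnd) h (by simp)
    have hmax : (if I.rel J ≤ σ'.vmem vbTime 0 then σ'.vmem vbTime 0 else I.rel J) =
        max (σ'.vmem vbTime 0) (I.rel J) := by
      split_ifs with hc
      · rw [max_eq_left hc]
      · rw [max_eq_right (not_le.1 hc).le]
    refine Run.block (T := 60) ?_
    rw [hsucc]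
    refine ⟨?_, fun j => ?_, fun st h6 h7 => h5 st (fun j hj => ?_) ?_⟩
    · simp [h3, e2, ← Function.iterate_succ_apply' nxt]
    · by_cases hj : j = J
      · simp [h3, e1, hJ, hj]
      · simpa [h3, e1, hJ, hj] using h4 j
    · have hjJ : j ≠ J := fun h => hJn (h ▸ hj)
      have := h6 j (List.mem_append_left _ hj)
      simpa [h3, e1, hJ, hjJ] using this
    · rw [hrest]
      have h8 := h6 J (by simp)
      have h9 : st J = max (σ'.vmem vbTime 0) (I.rel J) := by
        rw [← hmax, h8]
        simp [h3, e1, hJ, hσ'.rel]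
      refine ⟨h9, ?_⟩
      rw [← hmax]
      simpa [h3, e1, hJ, hσ'.rel, hσ'.len] using h7
  · rintro σ' hF ⟨-, h4, h5⟩
    refine ⟨h5 _ (fun _ _ => rfl) ?_, h4⟩
    rw [Nat.sub_self]
    trivial
  · simp only [IExp.cost]; omega

end Output

/-! ### The algorithm -/

section Algorithm

/-- Computes all tables and all families, chooses the best list for the initial state, and writes
its schedule. -/
def schedulingProg : Prog := prepareProg ;; layersProg ;; bestProg ;; writeProg

variable {K : Type} [AddCommGroup K] [LinearOrder K] [IsOrderedAddMonoid K] {n : ℕ}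

/-- The algorithm is correct, and its running time is `2 ^ O(s) * (s + 1) ^ numProc * n ^ 2`. -/
theorem run_schedulingProg (I : JobSet K n) (s : ℕ) :
    Run I.oracle schedulingProg (I.input s)
      (100000 * (n + 1) ^ 2 * (s + 1) ^ 2 * (s + 1) ^ I.numProc * (2 * 2 ^ s + 2) ^ 4)
      (fun σ => I.IsOptimal s (σ.output n)) := by
  refine Run.bind (U := 60000 * (n + 1) ^ 2 * (s + 1) ^ 2 * (s + 1) ^ I.numProc *
    (2 * 2 ^ s + 2) ^ 4) _ (run_prepareProg I s)
    (fun σ₁ hF₁ ⟨p, M, step, tau, hprime, hp, hT, hσ⟩ => ?_) ?_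
  · have : Fact p.Prime := ⟨hprime⟩
    have hH := run_layersProg hσ hp hT (by rw [hF₁.i bkJob rfl]; simp [JobSet.input])
      (by rw [hF₁.i bkNxt rfl]; simp [JobSet.input])
      (by rw [hF₁.v vbWt rfl]; simp [JobSet.input])
      (by rw [hF₁.i bkBeg rfl]; simp [JobSet.input])
      (by rw [hF₁.i bkEnd rfl]; simp [JobSet.input])
    refine Run.bind (U := 400 * (s + 1) * (2 * 2 ^ s + 2) + 100 * (s + 1)) _ hH
      (fun σ₂ hF₂ h2 => Run.bind _ (run_bestProg (hσ.frame hF₂) hT h2) (fun σ₃ hF₃ ⟨h3, h4⟩ => ?_)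
        le_rfl) ?_
    · have hjob : σ₃.imem bkJob = σ₂.imem bkJob := hF₃.i bkJob rfl
      have hnxt : σ₃.imem bkNxt = σ₂.imem bkNxt := hF₃.i bkNxt rfl
      refine (run_writeProg ((hσ.frame hF₂).frame hF₃) hjob hnxt rfl rfl h3.nodup fun j => ?_).mono
        (Nat.mul_le_mul_left _ (Nat.succ_le_succ h3.size)) fun σ₄ _ ⟨h5, h6⟩ => ?_
      · rw [hF₃.i 1 rfl, hF₂.i 1 rfl, hF₁.i 1 rfl]; simp [JobSet.input]
      · exact I.isOptimal_of_starts h3.nodup h3.lt (by rw [length_chain]; exact h3.size)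
          (fun j => by simpa [State.output] using h6 j) (fun j => rfl) h5
          fun l h7 h8 h9 => (h4 l h7 h8 h9).trans h3.profit.le
    · rw [hT.size]
      have h4 : 4 ≤ 2 * 2 ^ s + 2 := by have := Nat.one_le_two_pow (n := s); omega
      have hM : 1 ≤ (s + 1) ^ I.numProc := Nat.one_le_pow _ _ (by omega)
      generalize 2 * 2 ^ s + 2 = B at h4
      generalize (s + 1) ^ I.numProc = M at hM
      have hB : B ≤ B ^ 4 := Nat.le_self_pow (by norm_num) B
      calc 20000 * (s + 1) * ((n + 1) * M + 1) * (n + 1) * B ^ 4 +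
            (400 * (s + 1) * B + 100 * (s + 1))
          ≤ 20000 * (s + 1) * ((n + 1) * M + (n + 1) * M) * (n + 1) * B ^ 4 +
            (400 * (s + 1) * B ^ 4 + 100 * (s + 1) * B ^ 4) := by
            refine Nat.add_le_add ?_ (Nat.add_le_add (Nat.mul_le_mul_left _ hB)
              (Nat.le_mul_of_pos_right _ (by omega)))
            gcongr
            exact Nat.mul_pos n.succ_pos hM
        _ = 500 * (1 * (s + 1) * B ^ 4) + 40000 * ((s + 1) * (n + 1) ^ 2 * M * B ^ 4) := by ring
        _ ≤ 500 * (((n + 1) ^ 2 * M) * (s + 1) ^ 2 * B ^ 4) +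
            40000 * ((s + 1) ^ 2 * (n + 1) ^ 2 * M * B ^ 4) := by
            gcongr
            · exact Nat.mul_pos (by positivity) hM
            · exact Nat.le_self_pow (by norm_num) _
            · exact Nat.le_self_pow (by norm_num) _
        _ = 40500 * ((n + 1) ^ 2 * (s + 1) ^ 2 * M * B ^ 4) := by ring
        _ ≤ 60000 * ((n + 1) ^ 2 * (s + 1) ^ 2 * M * B ^ 4) := Nat.mul_le_mul_right _ (by norm_num)
        _ = _ := by ring
  · have hM : 1 ≤ (s + 1) ^ I.numProc := Nat.one_le_pow _ _ (by omega)
    have hB : 2 ^ s ≤ (2 * 2 ^ s + 2) ^ 4 :=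
      le_trans (by omega) (Nat.le_self_pow (by norm_num) _)
    generalize (2 * 2 ^ s + 2) ^ 4 = B at hB
    generalize (s + 1) ^ I.numProc = M at hM
    have hB1 : 1 ≤ B := Nat.one_le_two_pow.trans hB
    have h1 : 1 ≤ (n + 1) ^ 2 := Nat.one_le_pow _ _ (by omega)
    have h2 : 1 ≤ (s + 1) ^ 2 := Nat.one_le_pow _ _ (by omega)
    have h3 : (n + s + 1) ^ 2 ≤ (n + 1) ^ 2 * (s + 1) ^ 2 * M * B :=
      calc (n + s + 1) ^ 2 ≤ ((n + 1) * (s + 1)) ^ 2 := Nat.pow_le_pow_left (by nlinarith) 2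
        _ = (n + 1) ^ 2 * (s + 1) ^ 2 * 1 * 1 := by ring
        _ ≤ _ := by gcongr
    have h4 : (n + 1) * M ≤ (n + 1) ^ 2 * (s + 1) ^ 2 * M * B :=
      calc (n + 1) * M = (n + 1) * 1 * M * 1 := by ring
        _ ≤ _ := by gcongr; exact Nat.le_self_pow (by norm_num) _
    have h5 : (n + 1) * n ≤ (n + 1) ^ 2 * (s + 1) ^ 2 * M * B :=
      calc (n + 1) * n ≤ (n + 1) ^ 2 * 1 * 1 * 1 := by nlinarith
        _ ≤ _ := by gcongr
    have h6 : 2 ^ s ≤ (n + 1) ^ 2 * (s + 1) ^ 2 * M * B :=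
      calc 2 ^ s = 1 * 1 * 1 * 2 ^ s := by ring
        _ ≤ _ := by gcongr
    generalize 2 ^ s = A at *
    have h7 : 60000 * (n + 1) ^ 2 * (s + 1) ^ 2 * M * B =
      60000 * ((n + 1) ^ 2 * (s + 1) ^ 2 * M * B) := by ring
    have h8 : 100000 * (n + 1) ^ 2 * (s + 1) ^ 2 * M * B =
      100000 * ((n + 1) ^ 2 * (s + 1) ^ 2 * M * B) := by ring
    have h9 : 400 * (n + 1) * (n + M) = 400 * ((n + 1) * n) + 400 * ((n + 1) * M) := by ring
    rw [h7, h8, h9, mul_assoc 400 (n + 1)]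
    omega

/-- The constant is `2 * 100000 * 2 ^ 2 * 4 ^ 4`: the logarithm is at least `1 / 2`, and
`n + 1 ≤ 2 * max n 2` and `2 * 2 ^ s + 2 ≤ 4 * 2 ^ s`. -/
theorem time_le (n s q : ℕ) :
    ((100000 * (n + 1) ^ 2 * (s + 1) ^ 2 * (s + 1) ^ q * (2 * 2 ^ s + 2) ^ 4 : ℕ) : ℝ) ≤
      (204800000 : ℕ) * 2 ^ (204800000 * s) * ((s : ℝ) + 1) ^ (2 * q) * (max n 2 : ℕ) ^ 2 *
        Real.log (max n 2 : ℕ) := by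
  have hlog : (1 / 2 : ℝ) ≤ Real.log (max n 2 : ℕ) := by
    have h1 : Real.log 2 ≤ Real.log (max n 2 : ℕ) :=
      Real.log_le_log (by norm_num) (by exact_mod_cast le_max_right n 2)
    linarith [Real.log_two_gt_d9]
  have hnat : 100000 * (n + 1) ^ 2 * (s + 1) ^ 2 * (s + 1) ^ q * (2 * 2 ^ s + 2) ^ 4 ≤
      102400000 * 2 ^ (204800000 * s) * (s + 1) ^ (2 * q) * (max n 2) ^ 2 := by
    have h1 : n + 1 ≤ 2 * max n 2 := by omega
    have h2 : s + 1 ≤ 2 ^ s := Nat.lt_two_pow_self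
    have h3 : 2 * 2 ^ s + 2 ≤ 4 * 2 ^ s := by omega
    calc 100000 * (n + 1) ^ 2 * (s + 1) ^ 2 * (s + 1) ^ q * (2 * 2 ^ s + 2) ^ 4
        ≤ 100000 * (2 * max n 2) ^ 2 * (2 ^ s) ^ 2 * (s + 1) ^ (2 * q) * (4 * 2 ^ s) ^ 4 := by
          gcongr <;> omega
      _ = 102400000 * 2 ^ (6 * s) * (s + 1) ^ (2 * q) * (max n 2) ^ 2 := by
          rw [mul_comm 6 s, pow_mul]; ring
      _ ≤ _ := by gcongr <;> omega
  have hreal : ((100000 * (n + 1) ^ 2 * (s + 1) ^ 2 * (s + 1) ^ q * (2 * 2 ^ s + 2) ^ 4 : ℕ) : ℝ) ≤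
      ((102400000 * 2 ^ (204800000 * s) * (s + 1) ^ (2 * q) * (max n 2) ^ 2 : ℕ) : ℝ) :=
    Nat.cast_le.2 hnat
  refine hreal.trans ?_
  push_cast
  have h0 : (0 : ℝ) ≤ 204800000 * 2 ^ (204800000 * s) * ((s : ℝ) + 1) ^ (2 * q) *
    (max (n : ℝ) 2) ^ 2 := by positivity
  have := mul_le_mul_of_nonneg_left hlog h0
  push_cast at this
  linarith

end Algorithm

end GPSP

theorem mainTheorem8 :
    ∃ (P : GPSP.Prog) (C : ℕ),
      ∀ (K : Type) [AddCommGroup K] [LinearOrder K] [IsOrderedAddMonoid K]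
        (n s : ℕ) (I : GPSP.JobSet K n),
        ∃ (t : ℕ) (σ : GPSP.State K),
          GPSP.Exec I.oracle P (I.input s) t σ ∧
          I.IsOptimal s (σ.output n) ∧
          (t : ℝ) ≤ C * 2 ^ (C * s) * ((s : ℝ) + 1) ^ (2 * I.numProc)
            * (max n 2 : ℕ) ^ 2 * Real.log (max n 2 : ℕ) := by
  refine ⟨GPSP.schedulingProg, 204800000, fun K _ _ _ n s I => ?_⟩
  obtain ⟨t, σ, he, ht, hopt⟩ := GPSP.run_schedulingProg I s
  exact ⟨t, σ, he, hopt, (Nat.cast_le.2 ht).trans (GPSP.time_le n s I.numProc)⟩
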